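/- Let $d\ge 1$, $1\le p,q\le\infty$, and let $w$ be a weight on $\mathbb R^d$, i.e. a positive, locally integrable function for which there are constants $C,c_w>0$ with $w(x)\le C\,w(x-y)\,e^{c_w|y|_1}$ for all $x,y\in\mathbb R^d$. Let $\delta$ be a norm on $\mathbb R^d$, let $b>0$ satisfy $c_w/p<b$ (where $c_w/\infty=0$), and let $L\in\mathbb N_0$ satisfy $\delta(\bar j)<L|\bar j|_1$ for all $\bar j\in\mathbb N_0^d\setminus\{0\}$. For $\bar s\in\mathbb N_0^n$ let $X_b^{\bar s}(\mathbb R^n)$ be the space of all functions $\varphi:\mathbb R^n\to\mathbb C$ (modulo null sets) whose weak derivatives $D^{\bar\alpha}\varphi$, $0\le\bar\alpha\le\bar s$ (componentwise), exist and lie in $L^2(\mathbb R^n)$, and for which $$\|\varphi\|_{X_b^{\bar s}}:=\sum_{0\le\bar\alpha\le\bar s}\ \sum_{0\le\bar\beta\le\bar s}\Big(\int_{\mathbb R^n}\big|e^{b|x|_1}x^{\bar\beta}D^{\bar\alpha}\varphi(x)\big|^2dx\Big)^{1/2}<\infty ;$$ it carries this norm. For $i=1,\dots,d$ let $\varphi_0^i,\psi_0^i\in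 X_b^{L+1}(\mathbb R)$ and put $\varphi^i(t):=\varphi_0^i(t)-2^{-1}\varphi_0^i(2^{-1}t)$, $\psi^i(t):=\psi_0^i(t)-2^{-1}\psi_0^i(2^{-1}t)$. Assume that $\int_{\mathbb R}\varphi_0^i*\varphi_0^i(x)\,dx=1=\int_{\mathbb R}\psi_0^i*\psi_0^i(x)\,dx$ and that the Fourier transforms satisfy $(D^s\widehat{\varphi^i})(0)=0=(D^s\widehat{\psi^i})(0)$ for $s=0,1,\dots,L$. For $j\ge1$ put $\varphi^i_j(t):=2^j\varphi^i(2^jt)$, $\psi^i_j(t):=2^j\psi^i(2^jt)$ (for $j=0$ the functions $\varphi_0^i,\psi_0^i$ are those given above), and for $\bar j\in\mathbb N_0^d$ let $$\boldsymbol\varphi_{\bar j}(x):=\prod_{i=1}^d\varphi^i_{j_i}(x_i),\qquad \boldsymbol\psi_{\bar j}(x):=\prod_{i=1}^d\psi^i_{j_i}(x_i).$$ For $f$ in the topological dual $X_b^{(L+1,\dots,L+1)}(\mathbb R^d)'$ let $(\boldsymbol\varphi_{\bar j}*f)(x):=f(\boldsymbol\varphi_{\bar j}(x-\cdot))$, and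 likewise for $\boldsymbol\psi_{\bar j}$. Let $L^p_w:=L^p(\mathbb R^d,w\,dx)$. Then there are constants $c_1,c_2>0$, independent of $f$, such that for all $f\in X_b^{(L+1,\dots,L+1)}(\mathbb R^d)'$ $$c_1\Big(\sum_{\bar j\in\mathbb N_0^d}2^{q\delta(\bar j)}\|\boldsymbol\varphi_{\bar j}*f\|_{L^p_w}^q\Big)^{1/q}\le\Big(\sum_{\bar j\in\mathbb N_0^d}2^{q\delta(\bar j)}\|\boldsymbol\psi_{\bar j}*f\|_{L^p_w}^q\Big)^{1/q}\le c_2\Big(\sum_{\bar j\in\mathbb N_0^d}2^{q\delta(\bar j)}\|\boldsymbol\varphi_{\bar j}*f\|_{L^p_w}^q\Big)^{1/q}$$ as elements of $[0,\infty]$ (with the supremum over $\bar j$ in place of the sum for $q=\infty$). In particular, the space $VB^{\delta,w}_{p,q}(\mathbb R^d)$ of all $f$ for which this quasinorm is finite is the same whether it is defined with the $\boldsymbol\varphi_{\bar j}$ or with the $\boldsymbol\psi_{\bar j}$, with equivalent quasinorms. -/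

import Mathlib

open MeasureTheory
open scoped ENNReal ContDiff FourierTransform

namespace VBesov

/-- The partial derivative `∂ᵢ η` of a differentiable function on `ℝ^d`. -/
noncomputable def pderiv {d : ℕ} (i : Fin d) (η : (Fin d → ℝ) → ℝ) : (Fin d → ℝ) → ℝ :=
  fun x => fderiv ℝ η x (Pi.single i 1)

/-- The mixed derivative `D^α η = ∂₁^{α₁} ⋯ ∂_d^{α_d} η` of a smooth function on `ℝ^d`. -/
noncomputable def mixedDeriv {d : ℕ} (α : Fin d → ℕ) (η : (Fin d → ℝ) → ℝ) :
    (Fin d → ℝ) → ℝ :=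
  (List.finRange d).foldr (fun i g => (pderiv i)^[α i] g) η

/-- `v` is a weak (distributional) derivative `D^α u` of `u` on `ℝ^d`. -/
def IsWeakDeriv {d : ℕ} (α : Fin d → ℕ) (u v : (Fin d → ℝ) → ℂ) : Prop :=
  LocallyIntegrable u volume ∧ LocallyIntegrable v volume ∧
    ∀ η : (Fin d → ℝ) → ℝ, ContDiff ℝ ∞ η → HasCompactSupport η →
      ∫ x, mixedDeriv α η x • u x = (-1 : ℝ) ^ (∑ i, α i) • ∫ x, η x • v x

/-- The weight `e^{b|x|₁} x^β` on `ℝ^d`. -/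
noncomputable def expMonomial {d : ℕ} (b : ℝ) (β : Fin d → ℕ) (x : Fin d → ℝ) : ℝ :=
  Real.exp (b * ∑ i, |x i|) * ∏ i, x i ^ β i

theorem mixedDeriv_continuous {d : ℕ} (α : Fin d → ℕ) {η : (Fin d → ℝ) → ℝ}
    (h : ContDiff ℝ ∞ η) (hc : HasCompactSupport η) :
    Continuous (mixedDeriv α η) ∧ HasCompactSupport (mixedDeriv α η) := by
  suffices H : ContDiff ℝ ∞ (mixedDeriv α η) ∧ HasCompactSupport (mixedDeriv α η) from
    ⟨H.1.continuous, H.2⟩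
  have step : ∀ (i : Fin d) (g : (Fin d → ℝ) → ℝ), ContDiff ℝ ∞ g ∧ HasCompactSupport g →
      ContDiff ℝ ∞ (pderiv i g) ∧ HasCompactSupport (pderiv i g) := by
    rintro i g ⟨h1, h2⟩
    refine ⟨(h1.fderiv_right (m := ∞) (by simp)).clm_apply contDiff_const, ?_⟩
    exact h2.fderiv_apply (𝕜 := ℝ) (Pi.single i 1)
  have step2 : ∀ (i : Fin d) (n : ℕ) (g : (Fin d → ℝ) → ℝ),
      ContDiff ℝ ∞ g ∧ HasCompactSupport g →
      ContDiff ℝ ∞ ((pderiv i)^[n] g) ∧ HasCompactSupport ((pderiv i)^[n] g) := by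
    intro i n
    induction n with
    | zero => intro g hg; exact hg
    | succ n ih => intro g hg; exact ih _ (step i g hg)
  unfold mixedDeriv
  induction List.finRange d with
  | nil => exact ⟨h, hc⟩
  | cons i l ih => exact step2 i _ _ ih

theorem integrable_smul_test {d : ℕ} {u : (Fin d → ℝ) → ℂ} (hu : LocallyIntegrable u volume)
    {g : (Fin d → ℝ) → ℝ} (h : Continuous g ∧ HasCompactSupport g) :
    Integrable (fun x => g x • u x) volume :=
  hu.integrable_smul_left_of_hasCompactSupport h.1 h.2

theorem IsWeakDeriv.add {d : ℕ} {α : Fin d → ℕ} {u v u' v' : (Fin d → ℝ) → ℂ}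
    (h : IsWeakDeriv α u v) (h' : IsWeakDeriv α u' v') : IsWeakDeriv α (u + u') (v + v') := by
  obtain ⟨h1, h2, h3⟩ := h
  obtain ⟨h1', h2', h3'⟩ := h'
  refine ⟨h1.add h1', h2.add h2', fun η hη hc => ?_⟩
  have hm := mixedDeriv_continuous α hη hc
  simp only [Pi.add_apply, smul_add]
  rw [integral_add (integrable_smul_test h1 hm) (integrable_smul_test h1' hm),
    integral_add (integrable_smul_test h2 ⟨hη.continuous, hc⟩)
      (integrable_smul_test h2' ⟨hη.continuous, hc⟩), h3 η hη hc, h3' η hη hc, smul_add]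

theorem IsWeakDeriv.smul {d : ℕ} {α : Fin d → ℕ} {u v : (Fin d → ℝ) → ℂ}
    (c : ℂ) (h : IsWeakDeriv α u v) : IsWeakDeriv α (c • u) (c • v) := by
  obtain ⟨h1, h2, h3⟩ := h
  refine ⟨h1.smul c, h2.smul c, fun η hη hc => ?_⟩
  simp only [Pi.smul_apply]
  simp_rw [smul_comm _ c]
  rw [integral_smul, integral_smul, h3 η hη hc, smul_comm]

theorem IsWeakDeriv.ae_unique {d : ℕ} {α : Fin d → ℕ} {u v v' : (Fin d → ℝ) → ℂ}
    (h : IsWeakDeriv α u v) (h' : IsWeakDeriv α u v') : v =ᵐ[volume] v' := by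
  refine ae_eq_of_integral_contDiff_smul_eq h.2.1 h'.2.1 fun η hη hc => ?_
  have h1 := (h.2.2 η hη hc).symm.trans (h'.2.2 η hη hc)
  have hne : ((-1 : ℝ) ^ (∑ i, α i)) ≠ 0 := pow_ne_zero _ (by norm_num)
  exact smul_right_injective ℂ hne h1

/-- The functions of `X_b^s(ℝ^d)`, `s ∈ ℕ₀^d`. The condition that all weak derivatives `D^α φ`,
`0 ≤ α ≤ s`, lie in `L²` is membership in `MB^s_{2,2}(ℝ^d)`, the `L²` Sobolev space of dominating
mixed smoothness of integer order `s`. -/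
noncomputable def testFunctions {d : ℕ} (b : ℝ) (s : Fin d → ℕ) :
    Submodule ℂ ((Fin d → ℝ) → ℂ) where
  carrier := {φ | ∀ α ≤ s, ∃ v, IsWeakDeriv α φ v ∧ MemLp v 2 volume ∧
    ∀ β ≤ s, MemLp (fun x => expMonomial b β x • v x) 2 volume}
  add_mem' := by
    intro φ χ hφ hχ α hα
    obtain ⟨v, h1, h2, h3⟩ := hφ α hα
    obtain ⟨v', h1', h2', h3'⟩ := hχ α hα
    refine ⟨v + v', h1.add h1', h2.add h2', fun β hβ => ?_⟩
    refine ((h3 β hβ).add (h3' β hβ)).ae_eq (Filter.Eventually.of_forall fun x => ?_)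
    simp only [Pi.add_apply, smul_add]
  zero_mem' := by
    intro α _
    refine ⟨0, ⟨locallyIntegrable_zero, locallyIntegrable_zero, ?_⟩, MemLp.zero, ?_⟩
    · intro η _ _
      simp
    · intro β _
      simp
  smul_mem' := by
    intro c φ hφ α hα
    obtain ⟨v, h1, h2, h3⟩ := hφ α hα
    refine ⟨c • v, h1.smul c, h2.const_smul c, fun β hβ => ?_⟩
    have := (h3 β hβ).const_smul c
    refine this.ae_eq (Filter.Eventually.of_forall fun x => ?_)
    simp only [Pi.smul_apply]
    exact smul_comm _ _ _

open Classical in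
/-- The weak derivative `D^α u` (unique up to null sets), and `0` if there is none. -/
noncomputable def weakDeriv {d : ℕ} (α : Fin d → ℕ) (u : (Fin d → ℝ) → ℂ) : (Fin d → ℝ) → ℂ :=
  if h : ∃ v, IsWeakDeriv α u v then h.choose else 0

theorem IsWeakDeriv.weakDeriv_ae {d : ℕ} {α : Fin d → ℕ} {u v : (Fin d → ℝ) → ℂ}
    (h : IsWeakDeriv α u v) : weakDeriv α u =ᵐ[volume] v := by
  have hex : ∃ v, IsWeakDeriv α u v := ⟨v, h⟩
  unfold weakDeriv
  rw [dif_pos hex]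
  exact hex.choose_spec.ae_unique h

/-- `‖e^{b|x|₁} x^β D^α φ‖_{L²}`. -/
noncomputable def weightedNorm {d : ℕ} (b : ℝ) (α β : Fin d → ℕ) (φ : (Fin d → ℝ) → ℂ) : ℝ :=
  (eLpNorm (fun x => expMonomial b β x • weakDeriv α φ x) 2 volume).toReal

/-- The norm of `X_b^s(ℝ^d)`: the sum over `0 ≤ α, β ≤ s` of `‖e^{b|x|₁} x^β D^α φ‖_{L²}`.
It is a seminorm on functions, and vanishes exactly on the functions that are zero a.e. -/
noncomputable def testNorm {d : ℕ} (b : ℝ) (s : Fin d → ℕ) (φ : (Fin d → ℝ) → ℂ) : ℝ :=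
  ∑ α ∈ Finset.Iic s, ∑ β ∈ Finset.Iic s, weightedNorm b α β φ

theorem memLp_weakDeriv {d : ℕ} {b : ℝ} {s α β : Fin d → ℕ} {φ : (Fin d → ℝ) → ℂ}
    (hφ : φ ∈ testFunctions b s) (hα : α ≤ s) (hβ : β ≤ s) :
    MemLp (fun x => expMonomial b β x • weakDeriv α φ x) 2 volume := by
  obtain ⟨v, h1, h2, h3⟩ := hφ α hα
  refine (h3 β hβ).ae_eq ?_
  filter_upwards [h1.weakDeriv_ae] with x hx
  rw [hx]

theorem weightedNorm_add_le {d : ℕ} {b : ℝ} {s α β : Fin d → ℕ} {φ χ : (Fin d → ℝ) → ℂ}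
    (hφ : φ ∈ testFunctions b s) (hχ : χ ∈ testFunctions b s) (hα : α ≤ s) (hβ : β ≤ s) :
    weightedNorm b α β (φ + χ) ≤ weightedNorm b α β φ + weightedNorm b α β χ := by
  have m1 := memLp_weakDeriv hφ hα hβ
  have m2 := memLp_weakDeriv hχ hα hβ
  obtain ⟨v, h1, -, -⟩ := hφ α hα
  obtain ⟨v', h1', -, -⟩ := hχ α hα
  unfold weightedNorm
  rw [← ENNReal.toReal_add m1.2.ne m2.2.ne]
  refine ENNReal.toReal_mono (ENNReal.add_ne_top.2 ⟨m1.2.ne, m2.2.ne⟩) ?_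
  refine le_trans (le_of_eq ?_) (eLpNorm_add_le m1.1 m2.1 (by norm_num))
  refine eLpNorm_congr_ae ?_
  filter_upwards [h1.weakDeriv_ae, h1'.weakDeriv_ae, (h1.add h1').weakDeriv_ae] with x e1 e2 e3
  simp only [Pi.add_apply, e1, e2, e3, smul_add]

theorem weightedNorm_smul {d : ℕ} {b : ℝ} {s α β : Fin d → ℕ} {φ : (Fin d → ℝ) → ℂ}
    (c : ℂ) (hφ : φ ∈ testFunctions b s) (hα : α ≤ s) :
    weightedNorm b α β (c • φ) = ‖c‖ * weightedNorm b α β φ := by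
  obtain ⟨v, h1, -, -⟩ := hφ α hα
  unfold weightedNorm
  have : eLpNorm (fun x => expMonomial b β x • weakDeriv α (c • φ) x) 2 volume
      = eLpNorm (c • fun x => expMonomial b β x • weakDeriv α φ x) 2 volume := by
    refine eLpNorm_congr_ae ?_
    filter_upwards [h1.weakDeriv_ae, (h1.smul c).weakDeriv_ae] with x e1 e2
    simp only [Pi.smul_apply, e1, e2]
    exact smul_comm _ _ _
  rw [this, eLpNorm_const_smul, ENNReal.toReal_mul, toReal_enorm]

/-- The space `X_b^s(ℝ^d)` of test functions. -/
def TestSpace {d : ℕ} (b : ℝ) (s : Fin d → ℕ) : Type :=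
  testFunctions b s

noncomputable instance {d : ℕ} (b : ℝ) (s : Fin d → ℕ) : AddCommGroup (TestSpace b s) :=
  inferInstanceAs (AddCommGroup (testFunctions b s))

noncomputable instance {d : ℕ} (b : ℝ) (s : Fin d → ℕ) : Module ℂ (TestSpace b s) :=
  inferInstanceAs (Module ℂ (testFunctions b s))

/-- The norm of `X_b^s(ℝ^d)` as a seminorm. -/
noncomputable def testSeminorm {d : ℕ} (b : ℝ) (s : Fin d → ℕ) : Seminorm ℂ (TestSpace b s) :=
  Seminorm.of (fun φ : TestSpace b s => testNorm b s φ.1)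
    (by
      intro φ χ
      change testNorm b s (φ.1 + χ.1) ≤ _
      unfold testNorm
      simp only [← Finset.sum_add_distrib]
      refine Finset.sum_le_sum fun α hα => Finset.sum_le_sum fun β hβ => ?_
      exact weightedNorm_add_le φ.2 χ.2 (Finset.mem_Iic.1 hα) (Finset.mem_Iic.1 hβ))
    (by
      intro c φ
      change testNorm b s (c • φ.1) = _
      unfold testNorm
      simp only [Finset.mul_sum]
      refine Finset.sum_congr rfl fun α hα => Finset.sum_congr rfl fun β _ => ?_
      exact weightedNorm_smul c φ.2 (Finset.mem_Iic.1 hα))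

noncomputable instance {d : ℕ} (b : ℝ) (s : Fin d → ℕ) :
    SeminormedAddCommGroup (TestSpace b s) :=
  (testSeminorm b s).toAddGroupSeminorm.toSeminormedAddCommGroup

noncomputable instance {d : ℕ} (b : ℝ) (s : Fin d → ℕ) : NormedSpace ℂ (TestSpace b s) where
  norm_smul_le c φ := le_of_eq (map_smul_eq_mul (testSeminorm b s) c φ)

open Classical in
/-- The convolution `(g * f)(x) = f(g(x - ·))` of a functional `f ∈ X_b^s(ℝ^d)'` with a function
`g` whose reflected translates `g(x - ·)` lie in `X_b^s(ℝ^d)`. -/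
noncomputable def conv {d : ℕ} {b : ℝ} {s : Fin d → ℕ} (g : (Fin d → ℝ) → ℂ)
    (f : StrongDual ℂ (TestSpace b s)) (x : Fin d → ℝ) : ℂ :=
  if h : (fun y => g (x - y)) ∈ testFunctions b s then f (⟨_, h⟩ : testFunctions b s) else 0

/-- A weight `w` on `ℝ^d`: positive, locally integrable, and
`w(x) ≲ w(x - y) e^{c|y|₁}` for all `x, y`. -/
structure IsExpWeight {d : ℕ} (w : (Fin d → ℝ) → ℝ) (c : ℝ) : Prop where
  pos : ∀ x, 0 < w x
  locallyIntegrable : LocallyIntegrable w volume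
  growth : ∃ C : ℝ, 0 < C ∧ ∀ x y, w x ≤ C * (w (x - y) * Real.exp (c * ∑ i, |y i|))

/-- `ψ = ψ₀ - 2⁻¹ ψ₀(2⁻¹ ·)`. -/
noncomputable def mother (ψ₀ : ℝ → ℂ) (t : ℝ) : ℂ :=
  ψ₀ t - 2⁻¹ * ψ₀ (2⁻¹ * t)

/-- A one-dimensional generator `ψ₀ ∈ X_b^{L+1}(ℝ)` with `∫ ψ₀ * ψ₀ = 1` and
`D^s ψ̂(0) = 0` for `s = 0, …, L`, where `ψ = ψ₀ - 2⁻¹ ψ₀(2⁻¹ ·)`. (The normalization of the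
Fourier transform does not matter for the vanishing of these derivatives at `0`.) -/
structure IsGenerator (b : ℝ) (L : ℕ) (ψ₀ : ℝ → ℂ) : Prop where
  mem : (fun t : Fin 1 → ℝ => ψ₀ (t 0)) ∈ testFunctions b (fun _ : Fin 1 => L + 1)
  integral_conv : ∫ x : ℝ, ∫ y : ℝ, ψ₀ (x - y) * ψ₀ y = 1
  moments : ∀ s ≤ L, iteratedDeriv s (𝓕 (mother ψ₀)) 0 = 0

/-- `ψ_j` for `j ∈ ℕ₀`: it is `ψ₀` for `j = 0` and `2^j ψ(2^j ·)` for `j ≥ 1`. -/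
noncomputable def dyadic (ψ₀ : ℝ → ℂ) (j : ℕ) (t : ℝ) : ℂ :=
  if j = 0 then ψ₀ t else 2 ^ j * mother ψ₀ (2 ^ j * t)

/-- The tensor products `𝛙_j(x) = ∏ᵢ ψⁱ_{jᵢ}(xᵢ)`, `j ∈ ℕ₀^d`. -/
noncomputable def tensor {d : ℕ} (ψ₀ : Fin d → ℝ → ℂ) (j : Fin d → ℕ) (x : Fin d → ℝ) : ℂ :=
  ∏ i, dyadic (ψ₀ i) (j i) (x i)

/-- `2^{δ(j)} ‖𝛙_j * f‖_{L^p_w}`, where `L^p_w = L^p(w dx)`. -/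
noncomputable def term {d : ℕ} (δ : Seminorm ℝ (Fin d → ℝ)) (w : (Fin d → ℝ) → ℝ) (p : ℝ≥0∞)
    {b : ℝ} {s : Fin d → ℕ} (ψ₀ : Fin d → ℝ → ℂ) (f : StrongDual ℂ (TestSpace b s))
    (j : Fin d → ℕ) : ℝ≥0∞ :=
  ENNReal.ofReal ((2 : ℝ) ^ δ (fun i => (j i : ℝ))) *
    eLpNorm (conv (tensor ψ₀ j) f) p (volume.withDensity fun x => ENNReal.ofReal (w x))

/-- The quasinorm `(∑_{j ∈ ℕ₀^d} 2^{q δ(j)} ‖𝛙_j * f‖_{L^p_w}^q)^{1/q}`, with the supremum over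
`j` for `q = ∞`. -/
noncomputable def quasinorm {d : ℕ} (δ : Seminorm ℝ (Fin d → ℝ)) (w : (Fin d → ℝ) → ℝ)
    (p q : ℝ≥0∞) {b : ℝ} {s : Fin d → ℕ} (ψ₀ : Fin d → ℝ → ℂ)
    (f : StrongDual ℂ (TestSpace b s)) : ℝ≥0∞ :=
  if q = ⊤ then ⨆ j : Fin d → ℕ, term δ w p ψ₀ f j
  else (∑' j : Fin d → ℕ, term δ w p ψ₀ f j ^ q.toReal) ^ (1 / q.toReal)

/-- The space `VB^{δ,w}_{p,q}(ℝ^d)`, defined with the generators `ψ₀`. -/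
def VB {d : ℕ} (δ : Seminorm ℝ (Fin d → ℝ)) (w : (Fin d → ℝ) → ℝ) (p q : ℝ≥0∞) (b : ℝ)
    (s : Fin d → ℕ) (ψ₀ : Fin d → ℝ → ℂ) : Set (StrongDual ℂ (TestSpace b s)) :=
  {f | quasinorm δ w p q ψ₀ f < ⊤}

end VBesov

namespace VBesov

/-! The two families play symmetric roles, so it suffices to bound the quasinorm built from `ψ₀` by
the one built from `φ₀`. The bound rests on a Calderón reproducing formula whose synthesis functions
also have vanishing moments.

One variable. Let `p` be a generator, p_k = 2^k p(2^k ·) and φ_k = p_k - p_{k-1}. The assumptions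
say that the moments of `p` of orders 1, …, L vanish and that ε = ∫ p satisfies ε² = 1
(`IsGenerator.moment_eq_zero`, `IsGenerator.moment_zero_sq`). Put h = 3 p * p - 2ε p * p * p, so
that ∫ h = 1. Convolution is commutative, hence h_k - h_{k-1} is divisible by p_k - p_{k-1} and
equals φ_k * λ_k. The cubic 3x² - 2εx³ is chosen because its derivative vanishes at x = ε: this
forces ∫ λ_k = 0, so that for k ≥ 1 both φ_k and λ_k have vanishing moments of all orders less than
L (`dyadicFamily_diffJet`, `dyadicFamily_dualJet`). The sum of φ_k * λ_k over k ≤ N telescopes to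
h_N (`cv_diffJet_dualJet`), an approximate identity.

Reproducing formula. Tensor products give, pointwise, ψ_j * f = lim_N ∑_{κ_i ≤ N} (λ_κ * ψ_j) * (φ_κ
* f) (`tendsto_sum_integral_conv`). To handle the functional `f`, Hahn–Banach and Riesz represent it
by densities in weighted L² spaces (`exists_density`). Its convolutions with tensor products are
then continuous, of at most exponential growth, and associative with further convolutions.

Almost orthogonality. A function with L vanishing moments is an L-th weak derivative of a function
controlled in the L¹ norm with weight e^{b|t|}. Moving these L derivatives to the other factor of a
convolution (`expNorm_cv_le_of_moments`) and counting powers of two gives ∫ e^{b|t|} |λ_k * ψ_j| ≲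
2^{-L|k-j|} (`DyadicFamily.exists_expNorm_cv_le`).

Conclusion. Young's inequality in L^p(w dx) and Fatou's lemma give ‖ψ_j * f‖ ≲ ∑_κ 2^{-L|κ-j|₁} ‖φ_κ
* f‖ (`exists_eLpNorm_conv_tensor_le`). The hypothesis on δ leaves a margin η > 0 with δ(j) ≤ δ(κ) +
(L - η)|κ-j|₁, so the weighted matrix decays like 2^{-η|κ-j|₁} and Schur's test in ℓ^q applies
(`seqNorm_tsum_mul_le`). -/

/-! ### Hölder and Young inequalities for nonnegative kernels -/

/-- Jensen's inequality for the unnormalized measure k dν, obtained from Hölder with the splitting k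
= k^{(r-1)/r} · k^{1/r}. -/
theorem lintegral_mul_rpow_le {α : Type*} [MeasurableSpace α] {ν : Measure α} {k g : α → ℝ≥0∞}
    (hk : AEMeasurable k ν) (hg : AEMeasurable g ν) {r : ℝ} (hr : 1 ≤ r) :
    (∫⁻ y, k y * g y ∂ν) ^ r ≤ (∫⁻ y, k y ∂ν) ^ (r - 1) * ∫⁻ y, k y * g y ^ r ∂ν := by
  rcases hr.eq_or_lt with rfl | hr
  · simp
  have hc : r.HolderConjugate (r / (r - 1)) := Real.HolderConjugate.conjExponent hr
  have hr0 : 0 < r := by linarith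
  have h := ENNReal.lintegral_mul_le_Lp_mul_Lq ν hc.symm (f := fun y => k y ^ ((r - 1) / r))
    (g := fun y => k y ^ (1 / r) * g y) (hk.pow_const _) ((hk.pow_const _).mul hg)
  have e1 : ∀ y, k y ^ ((r - 1) / r) * (k y ^ (1 / r) * g y) = k y * g y := by
    intro y
    rw [← mul_assoc, ← ENNReal.rpow_add_of_nonneg _ _ (div_nonneg (by linarith) hr0.le)
      (by positivity)]
    rw [← add_div, sub_add_cancel, div_self hr0.ne', ENNReal.rpow_one]
  have e2 : ∀ y, (k y ^ ((r - 1) / r)) ^ (r / (r - 1)) = k y := by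
    intro y
    rw [← ENNReal.rpow_mul, div_mul_div_comm, mul_comm r, div_self, ENNReal.rpow_one]
    exact mul_ne_zero (by linarith) hr0.ne'
  have e3 : ∀ y, (k y ^ (1 / r) * g y) ^ r = k y * g y ^ r := by
    intro y
    rw [ENNReal.mul_rpow_of_nonneg _ _ hr0.le, ← ENNReal.rpow_mul, one_div_mul_cancel hr0.ne',
      ENNReal.rpow_one]
  simp only [Pi.mul_apply, e1, e2, e3] at h
  refine (ENNReal.rpow_le_rpow h hr0.le).trans (le_of_eq ?_)
  rw [ENNReal.mul_rpow_of_nonneg _ _ hr0.le, ← ENNReal.rpow_mul, ← ENNReal.rpow_mul,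
    one_div_mul_cancel hr0.ne', ENNReal.rpow_one]
  congr 2
  field_simp

/-- Here `A y` bounds the norm of translation by `y` on L^r(μ). Inserting `A y * (A y)⁻¹` before
Hölder makes `k * A` the kernel, and after Tonelli the translation cost cancels against `(A y)⁻¹`.
With `A = 1` this serves L² on the line, with an exponential `A` it serves L^p(w dx). -/
theorem lintegral_conv_rpow_le {G : Type*} [AddCommGroup G] [MeasurableSpace G]
    [MeasurableAdd₂ G] [MeasurableNeg G] {μ ν : Measure G} [SFinite μ] [SFinite ν]
    {k g A : G → ℝ≥0∞} (hk : Measurable k) (hg : Measurable g) (hA : Measurable A)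
    (hA0 : ∀ y, A y ≠ 0) (hAt : ∀ y, A y ≠ ⊤) {r : ℝ} (hr : 1 ≤ r)
    (h : ∀ y, ∫⁻ x, g (x - y) ^ r ∂μ ≤ A y ^ r * ∫⁻ x, g x ^ r ∂μ) :
    ∫⁻ x, (∫⁻ y, k y * g (x - y) ∂ν) ^ r ∂μ
      ≤ (∫⁻ y, k y * A y ∂ν) ^ r * ∫⁻ x, g x ^ r ∂μ := by
  have hr0 : 0 < r := by linarith
  have e : ∀ x y, k y * g (x - y) = (k y * A y) * ((A y)⁻¹ * g (x - y)) := by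
    intro x y
    rw [mul_assoc, ← mul_assoc (A y), ENNReal.mul_inv_cancel (hA0 y) (hAt y), one_mul]
  set R := ∫⁻ y, k y * A y ∂ν with hR
  calc ∫⁻ x, (∫⁻ y, k y * g (x - y) ∂ν) ^ r ∂μ
      ≤ ∫⁻ x, R ^ (r - 1) * ∫⁻ y, (k y * A y) * ((A y)⁻¹ * g (x - y)) ^ r ∂ν ∂μ := by
        refine lintegral_mono fun x => ?_
        simp_rw [e x]
        exact lintegral_mul_rpow_le (hk.mul hA).aemeasurable
          (hA.inv.mul (hg.comp (measurable_const.sub measurable_id))).aemeasurable hr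
    _ = R ^ (r - 1) * ∫⁻ x, ∫⁻ y, (k y * A y) * ((A y)⁻¹ * g (x - y)) ^ r ∂ν ∂μ := by
        rw [lintegral_const_mul]
        refine Measurable.lintegral_prod_right'
          (f := fun z : G × G => (k z.2 * A z.2) * ((A z.2)⁻¹ * g (z.1 - z.2)) ^ r) ?_
        fun_prop
    _ = R ^ (r - 1) * ∫⁻ y, ∫⁻ x, (k y * A y) * ((A y)⁻¹ * g (x - y)) ^ r ∂μ ∂ν := by
        rw [lintegral_lintegral_swap]
        refine Measurable.aemeasurable ?_
        simp only [Function.uncurry_def]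
        fun_prop
    _ ≤ R ^ (r - 1) * ∫⁻ y, (k y * A y) * ∫⁻ x, g x ^ r ∂μ ∂ν := by
        gcongr with y
        rw [lintegral_const_mul _ (by fun_prop)]
        refine mul_le_mul_right ?_ _
        simp_rw [ENNReal.mul_rpow_of_nonneg _ _ hr0.le]
        rw [lintegral_const_mul _ (by fun_prop)]
        refine (mul_le_mul_right (h y) _).trans ?_
        rw [← mul_assoc, ← ENNReal.mul_rpow_of_nonneg _ _ hr0.le,
          ENNReal.inv_mul_cancel (hA0 y) (hAt y), ENNReal.one_rpow, one_mul]
    _ = R ^ r * ∫⁻ x, g x ^ r ∂μ := by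
        rw [lintegral_mul_const _ (by fun_prop), ← hR, ← mul_assoc]
        congr 1
        conv_lhs => rw [← ENNReal.rpow_one R, ← ENNReal.rpow_mul, one_mul,
          ← ENNReal.rpow_add_of_nonneg _ _ (by linarith) zero_le_one]
        rw [sub_add_cancel]

theorem lintegral_fintype_prod {d : ℕ} {f : Fin d → ℝ → ℝ≥0∞} (hf : ∀ i, Measurable (f i)) :
    ∫⁻ x : Fin d → ℝ, ∏ i, f i (x i) = ∏ i, ∫⁻ t, f i t := by
  induction d with
  | zero => simp [volume_pi]
  | succ n ih =>
    have := (volume_preserving_piFinSuccAbove (fun _ : Fin (n + 1) => ℝ) 0).symm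
    rw [← this.lintegral_comp_emb (MeasurableEquiv.measurableEmbedding _)]
    simp_rw [MeasurableEquiv.piFinSuccAbove_symm_apply, Fin.insertNthEquiv,
      Fin.prod_univ_succ, Fin.insertNth_zero]
    simp only [cast_eq, Fin.cons_zero, Fin.cons_succ,
      Equiv.coe_fn_mk, Measure.volume_eq_prod]
    rw [lintegral_prod_mul (f := f 0) (g := fun y : Fin n → ℝ => ∏ i, f i.succ (y i))
      (hf 0).aemeasurable
      (Finset.measurable_prod _ fun i _ => (hf i.succ).comp (measurable_pi_apply i)).aemeasurable, ih fun i => hf i.succ]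

/-! ### Weights and weighted L² spaces on the line -/

/-- The weight `e^{b|t|} (1 + |t|)^m` on the real line. -/
noncomputable def wt (b : ℝ) (m : ℕ) (t : ℝ) : ℝ := Real.exp (b * |t|) * (1 + |t|) ^ m

theorem wt_pos (b : ℝ) (m : ℕ) (t : ℝ) : 0 < wt b m t := by unfold wt; positivity

@[fun_prop]
theorem continuous_wt (b : ℝ) (m : ℕ) : Continuous (wt b m) := by unfold wt; fun_prop

theorem one_le_wt {b : ℝ} (hb : 0 ≤ b) (m : ℕ) (t : ℝ) : 1 ≤ wt b m t := by
  unfold wt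
  refine one_le_mul_of_one_le_of_one_le (Real.one_le_exp (by positivity)) (one_le_pow₀ ?_)
  linarith [abs_nonneg t]

theorem wt_mono_right {b : ℝ} (hb : 0 ≤ b) (m : ℕ) {s t : ℝ} (h : |s| ≤ |t|) :
    wt b m s ≤ wt b m t := by
  unfold wt
  gcongr

theorem wt_mono_pow (b : ℝ) {m n : ℕ} (h : m ≤ n) (t : ℝ) : wt b m t ≤ wt b n t := by
  unfold wt
  gcongr
  linarith [abs_nonneg t]

theorem wt_neg (b : ℝ) (m : ℕ) (t : ℝ) : wt b m (-t) = wt b m t := by simp [wt]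

theorem wt_add_le {b : ℝ} (hb : 0 ≤ b) (m : ℕ) (s t : ℝ) :
    wt b m (s + t) ≤ wt b m s * wt b m t := by
  unfold wt
  have h1 : Real.exp (b * |s + t|) ≤ Real.exp (b * |s|) * Real.exp (b * |t|) := by
    rw [← Real.exp_add, ← mul_add]
    exact Real.exp_le_exp.2 (mul_le_mul_of_nonneg_left (abs_add_le s t) hb)
  have h2 : (1 + |s + t|) ^ m ≤ (1 + |s|) ^ m * (1 + |t|) ^ m := by
    rw [← mul_pow]
    gcongr
    nlinarith [abs_add_le s t, abs_nonneg s, abs_nonneg t, mul_nonneg (abs_nonneg s) (abs_nonneg t)]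
  calc _ ≤ (Real.exp (b * |s|) * Real.exp (b * |t|)) * ((1 + |s|) ^ m * (1 + |t|) ^ m) := by gcongr
    _ = _ := by ring

theorem wt_le_mul_wt_sub {b : ℝ} (hb : 0 ≤ b) (m : ℕ) (x t : ℝ) :
    wt b m t ≤ wt b m x * wt b m (x - t) := by
  have := wt_add_le hb m x (t - x)
  rwa [add_sub_cancel, ← wt_neg b m (t - x), neg_sub] at this

/-- Since 1 + |x| is at most twice the larger of 1 + |y| and 1 + |x - y|, the whole polynomial
weight can be charged to one argument. Submultiplicativity alone is too costly for `Dec.cv`: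
functions in `Dec b (m + 1)` are guaranteed to be integrable only against `wt b m`, one power short.
-/
theorem wt_split {b : ℝ} (hb : 0 ≤ b) (m : ℕ) (x y : ℝ) :
    wt b m x ≤ 2 ^ m * (wt b m y * wt b 0 (x - y) + wt b 0 y * wt b m (x - y)) := by
  have h0 : wt b 0 x ≤ wt b 0 y * wt b 0 (x - y) := by simpa using wt_add_le hb 0 y (x - y)
  have h2 : (1 + |x|) ^ m ≤ 2 ^ m * ((1 + |y|) ^ m + (1 + |x - y|) ^ m) := by
    have : |x| ≤ |y| + |x - y| := by simpa using abs_add_le y (x - y)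
    have hM : 1 + |x| ≤ 2 * max (1 + |y|) (1 + |x - y|) := by
      linarith [le_max_left (1 + |y|) (1 + |x - y|), le_max_right (1 + |y|) (1 + |x - y|)]
    refine (pow_le_pow_left₀ (by positivity) hM m).trans ?_
    rw [mul_pow]
    gcongr
    rcases max_cases (1 + |y|) (1 + |x - y|) with h | h <;> rw [h.1]
    · exact le_add_of_nonneg_right (by positivity)
    · exact le_add_of_nonneg_left (by positivity)
  have e : ∀ t, wt b m t = wt b 0 t * (1 + |t|) ^ m := fun t => by simp [wt]
  rw [e x, e y, e (x - y)]
  calc _ ≤ (wt b 0 y * wt b 0 (x - y)) * (2 ^ m * ((1 + |y|) ^ m + (1 + |x - y|) ^ m)) := by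
        gcongr
        exact (mul_pos (wt_pos _ _ _) (wt_pos _ _ _)).le
    _ = _ := by ring

theorem memLp_inv_one_add_abs : MemLp (fun t : ℝ => (1 + |t|)⁻¹) 2 volume := by
  have hc : Continuous fun t : ℝ => (1 + |t|)⁻¹ :=
    Continuous.inv₀ (by fun_prop) fun t => by positivity
  rw [memLp_two_iff_integrable_sq hc.aestronglyMeasurable]
  refine integrable_inv_one_add_sq.mono' (hc.pow 2).aestronglyMeasurable
    (Filter.Eventually.of_forall fun t => ?_)
  rw [Real.norm_of_nonneg (by positivity), inv_pow]
  gcongr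
  nlinarith [abs_nonneg t, sq_abs t]

/-- Measurable functions `a` with `e^{b|t|} (1 + |t|)^m a ∈ L²(ℝ)`. -/
structure Dec (b : ℝ) (m : ℕ) (a : ℝ → ℂ) : Prop where
  meas : Measurable a
  memLp : MemLp (fun t => wt b m t • a t) 2 volume

theorem Dec.add {b : ℝ} {m : ℕ} {a c : ℝ → ℂ} (ha : Dec b m a) (hc : Dec b m c) :
    Dec b m (a + c) :=
  ⟨ha.1.add hc.1, by
    refine (ha.2.add hc.2).ae_eq (Filter.Eventually.of_forall fun t => ?_)
    simp only [Pi.add_apply, smul_add]⟩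

theorem Dec.smul {b : ℝ} {m : ℕ} {a : ℝ → ℂ} (z : ℂ) (ha : Dec b m a) : Dec b m (z • a) :=
  ⟨ha.1.const_smul z, by
    have h := ha.2.const_smul z
    refine h.ae_eq (Filter.Eventually.of_forall fun t => ?_)
    simp only [Pi.smul_apply]
    exact smul_comm _ _ _⟩

theorem Dec.sub {b : ℝ} {m : ℕ} {a c : ℝ → ℂ} (ha : Dec b m a) (hc : Dec b m c) :
    Dec b m (a - c) := by
  have := ha.add (hc.smul (-1))
  rwa [neg_one_smul, ← sub_eq_add_neg] at this

theorem Dec.of_wt_le {b b' : ℝ} {m m' : ℕ} {a : ℝ → ℂ} (ha : Dec b m a)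
    {C : ℝ} (h : ∀ t, wt b' m' t ≤ C * wt b m t) : Dec b' m' a := by
  refine ⟨ha.1, ha.2.of_le_mul (c := C) ?_ (Filter.Eventually.of_forall fun t => ?_)⟩
  · exact (continuous_wt b' m').aestronglyMeasurable.smul ha.1.aestronglyMeasurable
  · rw [norm_smul, norm_smul, Real.norm_of_nonneg (wt_pos _ _ _).le,
      Real.norm_of_nonneg (wt_pos _ _ _).le, ← mul_assoc]
    exact mul_le_mul_of_nonneg_right (h t) (norm_nonneg _)

theorem Dec.memLp_two {b : ℝ} (hb : 0 ≤ b) {m : ℕ} {a : ℝ → ℂ} (ha : Dec b m a) :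
    MemLp a 2 volume := by
  refine ha.2.mono ha.1.aestronglyMeasurable (Filter.Eventually.of_forall fun t => ?_)
  rw [norm_smul, Real.norm_of_nonneg (wt_pos _ _ _).le]
  exact le_mul_of_one_le_left (norm_nonneg _) (one_le_wt hb m t)

/-- Cauchy–Schwarz against (1 + |t|)⁻¹ ∈ L²: passing from L² to L¹ costs one power of the weight.
This is why decay of order L + 1 controls moments up to order L. -/
theorem Dec.integrable_wt {b : ℝ} {m : ℕ} {a : ℝ → ℂ} (ha : Dec b (m + 1) a) :
    Integrable (fun t => wt b m t • a t) volume := by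
  have h := memLp_one_iff_integrable.1 (ha.memLp.smul (r := 1) memLp_inv_one_add_abs)
  refine h.congr (Filter.Eventually.of_forall fun t => ?_)
  simp only [Pi.smul_apply', smul_smul]
  congr 1
  unfold wt
  have : (1 + |t|) ≠ 0 := by positivity
  field_simp
  ring

theorem Dec.integrable_mul {b : ℝ} {m : ℕ} {a : ℝ → ℂ} (ha : Dec b (m + 1) a)
    {g : ℝ → ℝ} (hg : Measurable g) {C : ℝ} (h : ∀ t, |g t| ≤ C * wt b m t) :
    Integrable (fun t => g t • a t) volume := by
  refine (ha.integrable_wt.norm.const_mul C).mono' (hg.smul ha.1).aestronglyMeasurable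
    (Filter.Eventually.of_forall fun t => ?_)
  rw [norm_smul, norm_smul, Real.norm_eq_abs, Real.norm_of_nonneg (wt_pos _ _ _).le, ← mul_assoc]
  exact mul_le_mul_of_nonneg_right (h t) (norm_nonneg _)

theorem Dec.integrable {b : ℝ} (hb : 0 ≤ b) {m : ℕ} {a : ℝ → ℂ} (ha : Dec b (m + 1) a) :
    Integrable a volume := by
  simpa using ha.integrable_mul (g := fun _ => 1) measurable_const (C := 1)
    (fun t => by simpa using one_le_wt hb m t)

theorem Dec.comp_sub {b : ℝ} (hb : 0 ≤ b) {m : ℕ} {a : ℝ → ℂ} (ha : Dec b m a) (x : ℝ) :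
    Dec b m (fun t => a (x - t)) := by
  have hm : Measurable fun t => a (x - t) := ha.1.comp (measurable_const.sub measurable_id)
  have h := ha.2.comp_measurePreserving (Measure.measurePreserving_sub_left volume x)
  refine ⟨hm, h.of_le_mul (c := wt b m x) ?_ (Filter.Eventually.of_forall fun t => ?_)⟩
  · exact (continuous_wt b m).aestronglyMeasurable.smul hm.aestronglyMeasurable
  · simp only [Function.comp_apply]
    rw [norm_smul, norm_smul, Real.norm_of_nonneg (wt_pos _ _ _).le,
      Real.norm_of_nonneg (wt_pos _ _ _).le, ← mul_assoc]
    exact mul_le_mul_of_nonneg_right (wt_le_mul_wt_sub hb m x t) (norm_nonneg _)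

theorem Dec.comp_mul {b : ℝ} (hb : 0 ≤ b) {m : ℕ} {a : ℝ → ℂ} (ha : Dec b m a) {r : ℝ}
    (hr : 1 ≤ r) : Dec b m (fun t => a (r * t)) := by
  have hr0 : 0 < r := by linarith
  have hm : Measurable fun t => a (r * t) := ha.1.comp (measurable_const.mul measurable_id)
  have h : MemLp (fun t => wt b m (r * t) • a (r * t)) 2 volume := by
    have h1 := ha.2
    rw [memLp_two_iff_integrable_sq_norm h1.1] at h1
    rw [memLp_two_iff_integrable_sq_norm]
    · exact h1.comp_mul_left' hr0.ne'
    · exact ((continuous_wt b m).comp (continuous_const.mul continuous_id)).aestronglyMeasurable.smul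
        hm.aestronglyMeasurable
  refine ⟨hm, h.mono ?_ (Filter.Eventually.of_forall fun t => ?_)⟩
  · exact (continuous_wt b m).aestronglyMeasurable.smul hm.aestronglyMeasurable
  · rw [norm_smul, norm_smul, Real.norm_of_nonneg (wt_pos _ _ _).le,
      Real.norm_of_nonneg (wt_pos _ _ _).le]
    refine mul_le_mul_of_nonneg_right (wt_mono_right hb m ?_) (norm_nonneg _)
    rw [abs_mul, abs_of_pos hr0]
    exact le_mul_of_one_le_left (abs_nonneg _) hr

/-! ### Convolution on the line -/

/-- The convolution of two functions on the real line. -/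
noncomputable def cv (a c : ℝ → ℂ) (x : ℝ) : ℂ := ∫ y, a y * c (x - y)

theorem measurable_cv {a c : ℝ → ℂ} (ha : Measurable a) (hc : Measurable c) :
    Measurable (cv a c) := by
  have : StronglyMeasurable fun z : ℝ × ℝ => a z.2 * c (z.1 - z.2) :=
    Measurable.stronglyMeasurable (by fun_prop)
  exact this.integral_prod_right'.measurable

theorem cv_comm (a c : ℝ → ℂ) : cv a c = cv c a := by
  funext x
  unfold cv
  rw [← integral_sub_left_eq_self _ volume x]
  simp [mul_comm]

theorem Dec.integrable_cv {b : ℝ} (hb : 0 ≤ b) {m : ℕ} {a c : ℝ → ℂ} (ha : Dec b m a)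
    (hc : Dec b m c) (x : ℝ) : Integrable (fun y => a y * c (x - y)) volume :=
  (ha.memLp_two hb).integrable_mul ((hc.comp_sub hb x).memLp_two hb)

theorem Dec.norm {b : ℝ} {m : ℕ} {a : ℝ → ℂ} (ha : Dec b m a) :
    Dec b m (fun t => (‖a t‖ : ℂ)) := by
  have hm : Measurable fun t => (‖a t‖ : ℂ) := Complex.measurable_ofReal.comp ha.1.norm
  refine ⟨hm, ha.2.mono ?_ (Filter.Eventually.of_forall fun t => ?_)⟩
  · exact (continuous_wt b m).aestronglyMeasurable.smul hm.aestronglyMeasurable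
  · simp

theorem cv_add_left {b : ℝ} (hb : 0 ≤ b) {m : ℕ} {a a' c : ℝ → ℂ} (ha : Dec b m a)
    (ha' : Dec b m a') (hc : Dec b m c) : cv (a + a') c = cv a c + cv a' c := by
  funext x
  simp only [cv, Pi.add_apply, add_mul]
  exact integral_add (ha.integrable_cv hb hc x) (ha'.integrable_cv hb hc x)

theorem cv_sub_left {b : ℝ} (hb : 0 ≤ b) {m : ℕ} {a a' c : ℝ → ℂ} (ha : Dec b m a)
    (ha' : Dec b m a') (hc : Dec b m c) : cv (a - a') c = cv a c - cv a' c := by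
  funext x
  simp only [cv, Pi.sub_apply, sub_mul]
  exact integral_sub (ha.integrable_cv hb hc x) (ha'.integrable_cv hb hc x)

theorem cv_smul_left (z : ℂ) (a c : ℝ → ℂ) : cv (z • a) c = z • cv a c := by
  funext x
  simp only [cv, Pi.smul_apply, smul_eq_mul, mul_assoc]
  exact integral_const_mul _ _

theorem cv_smul_right (z : ℂ) (a c : ℝ → ℂ) : cv a (z • c) = z • cv a c := by
  rw [cv_comm, cv_smul_left, cv_comm]

theorem cv_add_right {b : ℝ} (hb : 0 ≤ b) {m : ℕ} {a c c' : ℝ → ℂ} (ha : Dec b m a)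
    (hc : Dec b m c) (hc' : Dec b m c') : cv a (c + c') = cv a c + cv a c' := by
  rw [cv_comm, cv_add_left hb hc hc' ha, cv_comm c, cv_comm c']

theorem cv_sub_right {b : ℝ} (hb : 0 ≤ b) {m : ℕ} {a c c' : ℝ → ℂ} (ha : Dec b m a)
    (hc : Dec b m c) (hc' : Dec b m c') : cv a (c - c') = cv a c - cv a c' := by
  rw [cv_comm, cv_sub_left hb hc hc' ha, cv_comm c, cv_comm c']

theorem enorm_cv_le (a c : ℝ → ℂ) (x : ℝ) :
    ‖cv a c x‖ₑ ≤ ∫⁻ y, ‖a y‖ₑ * ‖c (x - y)‖ₑ := by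
  refine (enorm_integral_le_lintegral_enorm _).trans (le_of_eq ?_)
  simp only [enorm_mul]

theorem eLpNorm_lconv_two_le {k g : ℝ → ℝ≥0∞} (hk : Measurable k) (hg : Measurable g) :
    eLpNorm (fun x => ∫⁻ y, k y * g (x - y)) 2 volume
      ≤ (∫⁻ y, k y) * eLpNorm g 2 volume := by
  have h := lintegral_conv_rpow_le (μ := (volume : Measure ℝ)) (ν := volume) (A := fun _ => 1)
    hk hg measurable_const (by simp) (by simp) (r := 2) (by norm_num) fun y => by
      rw [ENNReal.one_rpow, one_mul, lintegral_sub_right_eq_self (fun x => g x ^ (2 : ℝ))]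
  simp only [mul_one] at h
  rw [eLpNorm_eq_lintegral_rpow_enorm_toReal two_ne_zero ENNReal.ofNat_ne_top,
    eLpNorm_eq_lintegral_rpow_enorm_toReal two_ne_zero ENNReal.ofNat_ne_top]
  simp only [enorm_eq_self, ENNReal.toReal_ofNat]
  refine (ENNReal.rpow_le_rpow h (by norm_num)).trans (le_of_eq ?_)
  rw [ENNReal.mul_rpow_of_nonneg _ _ (by norm_num), ← ENNReal.rpow_mul]
  norm_num

theorem measurable_wt (b : ℝ) (m : ℕ) : Measurable (wt b m) := (continuous_wt b m).measurable

theorem Dec.eLpNorm_lconv_lt_top {b : ℝ} {m : ℕ} {k g : ℝ → ℂ} (hk : Dec b (m + 1) k)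
    (hg : Dec b (m + 1) g) :
    eLpNorm (fun x => ∫⁻ y, ‖wt b 0 y • k y‖ₑ * ‖wt b (m + 1) (x - y) • g (x - y)‖ₑ) 2 volume
      < ⊤ := by
  refine (eLpNorm_lconv_two_le (k := fun y => ‖wt b 0 y • k y‖ₑ)
    (g := fun y => ‖wt b (m + 1) y • g y‖ₑ) ((measurable_wt b 0).smul hk.1).enorm
    ((measurable_wt b (m + 1)).smul hg.1).enorm).trans_lt ?_
  refine ENNReal.mul_lt_top ?_ ?_
  · refine (hk.integrable_mul (measurable_wt b 0) (C := 1) fun t => ?_).2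
    rw [abs_of_pos (wt_pos _ _ _), one_mul]
    exact wt_mono_pow b (Nat.zero_le _) t
  · rw [eLpNorm_enorm]
    exact hg.2.2

theorem enorm_wt_smul_cv_le {b : ℝ} (hb : 0 ≤ b) (m : ℕ) {a c : ℝ → ℂ} (ha : Measurable a)
    (hc : Measurable c) (x : ℝ) :
    ‖wt b m x • cv a c x‖ₑ ≤ ENNReal.ofReal (2 ^ m) *
      ((∫⁻ y, ‖wt b 0 y • a y‖ₑ * ‖wt b m (x - y) • c (x - y)‖ₑ) +
        ∫⁻ y, ‖wt b 0 y • c y‖ₑ * ‖wt b m (x - y) • a (x - y)‖ₑ) := by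
  have hw := measurable_wt b m
  have hw0 := measurable_wt b 0
  have hsw : ∫⁻ y, ‖wt b 0 y • c y‖ₑ * ‖wt b m (x - y) • a (x - y)‖ₑ
      = ∫⁻ y, ‖wt b m y • a y‖ₑ * ‖wt b 0 (x - y) • c (x - y)‖ₑ := by
    rw [← lintegral_sub_left_eq_self _ x]
    simp [mul_comm]
  rw [hsw, ← lintegral_add_left (by fun_prop), ← lintegral_const_mul _ (by fun_prop), enorm_smul]
  refine (mul_le_mul_right (enorm_cv_le a c x) _).trans ?_
  rw [← lintegral_const_mul _ (by fun_prop)]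
  refine lintegral_mono fun y => ?_
  have hn : ∀ n t, 0 ≤ wt b n t := fun n t => (wt_pos b n t).le
  have h := ENNReal.ofReal_le_ofReal (wt_split hb m x y)
  rw [ENNReal.ofReal_mul (by positivity), ENNReal.ofReal_add (mul_nonneg (hn _ _) (hn _ _))
    (mul_nonneg (hn _ _) (hn _ _)), ENNReal.ofReal_mul (hn _ _), ENNReal.ofReal_mul (hn _ _)] at h
  simp only [enorm_smul, Real.enorm_of_nonneg (hn _ _)]
  refine (mul_le_mul_left h _).trans (le_of_eq ?_)
  ring

theorem aestronglyMeasurable_lconv {k g : ℝ → ℝ≥0∞} (hk : Measurable k) (hg : Measurable g) :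
    AEStronglyMeasurable (fun x => ∫⁻ y, k y * g (x - y)) volume :=
  (Measurable.lintegral_prod_right' (f := fun z : ℝ × ℝ => k z.2 * g (z.1 - z.2))
    (by fun_prop)).aestronglyMeasurable

/-- By `enorm_wt_smul_cv_le` the weighted convolution is dominated by two convolutions of an L¹
function (weight e^{b|t|} only) with an L² function (full weight), and Young's inequality bounds
each. -/
theorem Dec.cv {b : ℝ} (hb : 0 ≤ b) {m : ℕ} {a c : ℝ → ℂ} (ha : Dec b (m + 1) a)
    (hc : Dec b (m + 1) c) : Dec b (m + 1) (cv a c) := by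
  have hm := measurable_cv ha.1 hc.1
  have hs : ∀ {g : ℝ → ℂ} (n : ℕ), Measurable g → Measurable fun y => ‖wt b n y • g y‖ₑ :=
    fun n hg => ((measurable_wt b n).smul hg).enorm
  refine ⟨hm, (measurable_wt b _).aestronglyMeasurable.smul hm.aestronglyMeasurable, ?_⟩
  refine (eLpNorm_le_nnreal_smul_eLpNorm_of_ae_le_mul'
    (g := (fun x => ∫⁻ y, ‖wt b 0 y • a y‖ₑ * ‖wt b (m + 1) (x - y) • c (x - y)‖ₑ) +
        fun x => ∫⁻ y, ‖wt b 0 y • c y‖ₑ * ‖wt b (m + 1) (x - y) • a (x - y)‖ₑ)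
    (Filter.Eventually.of_forall (enorm_wt_smul_cv_le hb (m + 1) ha.1 hc.1)) 2
    (c := (2 ^ (m + 1) : ℝ).toNNReal)).trans_lt ?_
  refine ENNReal.mul_lt_top ENNReal.coe_lt_top ?_
  refine (eLpNorm_add_le (aestronglyMeasurable_lconv (hs 0 ha.1) (hs (m + 1) hc.1))
    (aestronglyMeasurable_lconv (hs 0 hc.1) (hs (m + 1) ha.1)) (by norm_num)).trans_lt ?_
  exact ENNReal.add_lt_top.2 ⟨ha.eLpNorm_lconv_lt_top hc, hc.eLpNorm_lconv_lt_top ha⟩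

theorem cv_assoc {b : ℝ} (hb : 0 ≤ b) {m : ℕ} {a c e : ℝ → ℂ} (ha : Dec b (m + 1) a)
    (hc : Dec b (m + 1) c) (he : Dec b (m + 1) e) : cv (cv a c) e = cv a (cv c e) := by
  funext x
  -- `convolution_assoc` asks for absolute convergence of the iterated convolution of norms. Viewing
  -- the norms as complex functions lets `Dec.norm` and `Dec.cv` supply it.
  have hreal : ∀ y, (‖cv (fun t => (‖c t‖ : ℂ)) (fun t => (‖e t‖ : ℂ)) y‖ : ℝ)
      = convolution (fun x => ‖c x‖) (fun x => ‖e x‖) (ContinuousLinearMap.mul ℝ ℝ) volume y := by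
    intro y
    have : cv (fun t => (‖c t‖ : ℂ)) (fun t => (‖e t‖ : ℂ)) y
        = ((∫ t, ‖c t‖ * ‖e (y - t)‖ : ℝ) : ℂ) := by
      rw [← integral_complex_ofReal]
      simp [cv]
    rw [this, Complex.norm_real, Real.norm_of_nonneg (integral_nonneg fun t => by positivity)]
    rfl
  refine convolution_assoc (ContinuousLinearMap.mul ℂ ℂ) (ContinuousLinearMap.mul ℂ ℂ)
    (ContinuousLinearMap.mul ℂ ℂ) (ContinuousLinearMap.mul ℂ ℂ) (fun x y z => mul_assoc x y z)
    ha.1.aestronglyMeasurable hc.1.aestronglyMeasurable he.1.aestronglyMeasurable ?_ ?_ ?_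
  · exact Filter.Eventually.of_forall fun y => ha.integrable_cv hb hc y
  · refine Filter.Eventually.of_forall fun y => ?_
    have := (hc.norm.integrable_cv hb he.norm y).norm
    simpa [ConvolutionExistsAt] using this
  · have := (ha.norm.integrable_cv hb (hc.norm.cv hb he.norm) x).norm
    simp only [norm_mul, hreal] at this
    simpa [ConvolutionExistsAt] using this

theorem cv_left_comm {b : ℝ} (hb : 0 ≤ b) {m : ℕ} {a c e : ℝ → ℂ} (ha : Dec b (m + 1) a)
    (hc : Dec b (m + 1) c) (he : Dec b (m + 1) e) : cv a (cv c e) = cv c (cv a e) := by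
  rw [← cv_assoc hb ha hc he, cv_comm a c, cv_assoc hb hc ha he]

/-! ### Dilations and moments -/

/-- The `L¹`-normalized dilation `r a(r ·)`. -/
noncomputable def dil (r : ℝ) (a : ℝ → ℂ) (t : ℝ) : ℂ := r * a (r * t)

theorem dil_dil (r s : ℝ) (a : ℝ → ℂ) : dil r (dil s a) = dil (s * r) a := by
  funext t
  simp only [dil, Complex.ofReal_mul]
  ring_nf

theorem dil_one (a : ℝ → ℂ) : dil 1 a = a := by
  funext t
  simp [dil]

theorem dil_add (r : ℝ) (a c : ℝ → ℂ) : dil r (a + c) = dil r a + dil r c := by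
  funext t
  simp [dil, mul_add]

theorem dil_sub (r : ℝ) (a c : ℝ → ℂ) : dil r (a - c) = dil r a - dil r c := by
  funext t
  simp [dil, mul_sub]

theorem dil_smul (r : ℝ) (z : ℂ) (a : ℝ → ℂ) : dil r (z • a) = z • dil r a := by
  funext t
  simp only [dil, Pi.smul_apply, smul_eq_mul]
  ring

theorem Dec.dil {b : ℝ} (hb : 0 ≤ b) {m : ℕ} {a : ℝ → ℂ} (ha : Dec b m a) {r : ℝ}
    (hr : 1 ≤ r) : Dec b m (dil r a) :=
  (ha.comp_mul hb hr).smul (r : ℂ)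

theorem cv_dil {r : ℝ} (hr : 0 < r) (a c : ℝ → ℂ) : cv (dil r a) (dil r c) = dil r (cv a c) := by
  funext x
  simp only [cv, dil]
  have h := Measure.integral_comp_mul_left (fun y => a y * c (r * x - y)) r
  rw [abs_of_pos (inv_pos.2 hr)] at h
  have e : ∀ y, (r : ℂ) * a (r * y) * (r * c (r * (x - y)))
      = (r : ℂ) ^ 2 * (a (r * y) * c (r * x - r * y)) := by
    intro y
    rw [mul_sub]
    ring
  simp_rw [e]
  rw [integral_const_mul, h, Complex.real_smul, Complex.ofReal_inv]
  have : (r : ℂ) ≠ 0 := by exact_mod_cast hr.ne'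
  field_simp

theorem integral_cv {a c : ℝ → ℂ} (ha : Integrable a) (hc : Integrable c) :
    ∫ x, cv a c x = (∫ x, a x) * ∫ x, c x :=
  integral_convolution (ContinuousLinearMap.mul ℂ ℂ) ha hc

/-- The moment `∫ t^s a(t) dt`. -/
noncomputable def moment (s : ℕ) (a : ℝ → ℂ) : ℂ := ∫ t : ℝ, (t : ℂ) ^ s * a t

theorem pow_abs_mul_wt_le (b : ℝ) (n s : ℕ) (t : ℝ) : |t| ^ s * wt b n t ≤ wt b (n + s) t := by
  unfold wt
  rw [pow_add, mul_comm, mul_assoc]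
  gcongr
  linarith

theorem Dec.pow_mul {b : ℝ} {n s : ℕ} {a : ℝ → ℂ} (ha : Dec b (n + s) a) :
    Dec b n (fun t : ℝ => (t : ℂ) ^ s * a t) := by
  have hm : Measurable fun t : ℝ => (t : ℂ) ^ s * a t := by have := ha.1; fun_prop
  refine ⟨hm, ha.2.mono ((continuous_wt b n).aestronglyMeasurable.smul hm.aestronglyMeasurable)
    (Filter.Eventually.of_forall fun t => ?_)⟩
  rw [norm_smul, norm_smul, norm_mul, norm_pow, Complex.norm_real, ← mul_assoc,
    Real.norm_of_nonneg (wt_pos _ _ _).le, Real.norm_of_nonneg (wt_pos _ _ _).le, mul_comm (wt b n t)]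
  exact mul_le_mul_of_nonneg_right (pow_abs_mul_wt_le b n s t) (norm_nonneg _)

theorem Dec.mono_pow {b : ℝ} {n m : ℕ} (h : n ≤ m) {a : ℝ → ℂ} (ha : Dec b m a) : Dec b n a :=
  ha.of_wt_le (C := 1) fun t => by simpa using wt_mono_pow b h t

theorem Dec.integrable_moment {b : ℝ} (hb : 0 ≤ b) {L s : ℕ} (hs : s ≤ L) {a : ℝ → ℂ}
    (ha : Dec b (L + 1) a) : Integrable (fun t : ℝ => (t : ℂ) ^ s * a t) volume :=
  (Dec.pow_mul (n := 0 + 1) (s := s) (ha.mono_pow (by omega))).integrable hb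

/-- The binomial theorem for t = y + (t - y) writes t^s (a * c) as a combination of the convolutions
of t^r a with t^{s-r} c, and integrals of convolutions factor. -/
theorem moment_cv {b : ℝ} (hb : 0 ≤ b) {L s : ℕ} (hs : s ≤ L) {a c : ℝ → ℂ}
    (ha : Dec b (L + 1) a) (hc : Dec b (L + 1) c) :
    moment s (cv a c)
      = ∑ r ∈ Finset.range (s + 1), (s.choose r : ℂ) * (moment r a * moment (s - r) c) := by
  have hdec : ∀ {e : ℝ → ℂ}, Dec b (L + 1) e → ∀ r ≤ s, Dec b 1 (fun t : ℝ => (t : ℂ) ^ r * e t) :=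
    fun he r hr => Dec.pow_mul (n := 1) (he.mono_pow (by omega))
  have e : ∀ t : ℝ, (t : ℂ) ^ s * cv a c t = ∑ r ∈ Finset.range (s + 1), (s.choose r : ℂ) *
      cv (fun t : ℝ => (t : ℂ) ^ r * a t) (fun t : ℝ => (t : ℂ) ^ (s - r) * c t) t := by
    intro t
    unfold cv
    rw [← integral_const_mul]
    simp_rw [← integral_const_mul]
    rw [← integral_finsetSum _ fun r hr => ?_]
    · refine integral_congr_ae (Filter.Eventually.of_forall fun y => ?_)
      have : (t : ℂ) ^ s = ((y : ℂ) + ((t - y : ℝ) : ℂ)) ^ s := by push_cast; ring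
      simp only
      rw [this, add_pow, Finset.sum_mul]
      refine Finset.sum_congr rfl fun r _ => ?_
      ring
    · have hr' : r ≤ s := by simpa [Nat.lt_succ_iff] using hr
      exact ((hdec ha r hr').integrable_cv hb (hdec hc (s - r) (by omega)) t).const_mul _
  unfold moment
  simp_rw [e]
  rw [integral_finsetSum _ fun r hr => ?_]
  · refine Finset.sum_congr rfl fun r hr => ?_
    have hr' : r ≤ s := by simpa [Nat.lt_succ_iff] using hr
    rw [integral_const_mul, integral_cv ((hdec ha r hr').integrable hb (m := 0))
      ((hdec hc (s - r) (by omega)).integrable hb (m := 0))]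
  · have hr' : r ≤ s := by simpa [Nat.lt_succ_iff] using hr
    exact ((((hdec ha r hr').cv hb (m := 0) (hdec hc (s - r) (by omega))).integrable hb
      (m := 0))).const_mul _

theorem moment_dil {r : ℝ} (hr : 0 < r) (s : ℕ) (a : ℝ → ℂ) :
    moment s (dil r a) = ((r : ℂ) ^ s)⁻¹ * moment s a := by
  have h := Measure.integral_comp_mul_left (fun y : ℝ => (y : ℂ) ^ s * a y) r
  rw [abs_of_pos (inv_pos.2 hr), Complex.real_smul, Complex.ofReal_inv] at h
  have hr0 : (r : ℂ) ≠ 0 := by exact_mod_cast hr.ne'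
  unfold moment dil
  have e : ∀ t : ℝ, (t : ℂ) ^ s * (r * a (r * t))
      = ((r : ℂ) ^ s)⁻¹ * r * (((r * t : ℝ) : ℂ) ^ s * a (r * t)) := by
    intro t
    push_cast
    field_simp
    ring
  simp_rw [e]
  rw [integral_const_mul, h]
  field_simp

/-- All moments of `a` of orders `1, …, L - 1` vanish. -/
def FlatMoments (L : ℕ) (a : ℝ → ℂ) : Prop := ∀ s, 1 ≤ s → s < L → moment s a = 0

/-- For s ≥ 1 each binomial term has a factor of order between 1 and s, and that factor vanishes. -/
theorem FlatMoments.cv {b : ℝ} (hb : 0 ≤ b) {L : ℕ} {a c : ℝ → ℂ}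
    (ha : Dec b (L + 1) a) (hc : Dec b (L + 1) c) (fa : FlatMoments L a) (fc : FlatMoments L c) :
    FlatMoments L (cv a c) := by
  intro s h1 h2
  rw [moment_cv hb h2.le ha hc]
  refine Finset.sum_eq_zero fun r hr => ?_
  have hr' : r ≤ s := by simpa [Nat.lt_succ_iff] using hr
  rcases Nat.eq_zero_or_pos r with rfl | h
  · rw [fc _ (by omega) (by omega)]
    simp
  · rw [fa _ h (by omega)]
    simp

/-! ### Weak derivatives on the line -/

/-- `v` is a weak derivative of order `n` of `u` on the real line. -/
def IsWeak (n : ℕ) (u v : ℝ → ℂ) : Prop :=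
  ∀ η : ℝ → ℝ, ContDiff ℝ ∞ η → HasCompactSupport η →
    ∫ t, iteratedDeriv n η t • u t = (-1 : ℝ) ^ n • ∫ t, η t • v t

theorem continuous_iteratedDeriv_of_smooth {η : ℝ → ℝ} (h : ContDiff ℝ ∞ η) (n : ℕ) :
    Continuous (iteratedDeriv n η) :=
  h.continuous_iteratedDeriv n (by exact_mod_cast le_top)

theorem hasCompactSupport_iteratedDeriv {η : ℝ → ℝ} (h : HasCompactSupport η) (n : ℕ) :
    HasCompactSupport (iteratedDeriv n η) := by
  induction n with
  | zero => simpa using h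
  | succ n ih => rw [iteratedDeriv_succ]; exact ih.deriv

theorem exists_bound_of_hasCompactSupport {g : ℝ → ℝ} (h : Continuous g)
    (hc : HasCompactSupport g) : ∃ C, ∀ t, ‖g t‖ ≤ C := hc.exists_bound_of_continuous h

theorem integrable_test_smul {g : ℝ → ℝ} (h : Continuous g) (hc : HasCompactSupport g)
    {u : ℝ → ℂ} (hu : Integrable u) : Integrable (fun t => g t • u t) := by
  obtain ⟨C, hC⟩ := exists_bound_of_hasCompactSupport h hc
  exact hu.bdd_smul C h.aestronglyMeasurable (Filter.Eventually.of_forall hC)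

theorem IsWeak.add {n : ℕ} {u v u' v' : ℝ → ℂ} (hu : Integrable u) (hv : Integrable v)
    (hu' : Integrable u') (hv' : Integrable v') (h : IsWeak n u v) (h' : IsWeak n u' v') :
    IsWeak n (u + u') (v + v') := by
  intro η hη hc
  have c1 := continuous_iteratedDeriv_of_smooth hη n
  have c2 := hasCompactSupport_iteratedDeriv hc n
  simp only [Pi.add_apply, smul_add]
  rw [integral_add (integrable_test_smul c1 c2 hu) (integrable_test_smul c1 c2 hu'),
    integral_add (integrable_test_smul hη.continuous hc hv)
      (integrable_test_smul hη.continuous hc hv'), h η hη hc, h' η hη hc, smul_add]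

theorem IsWeak.smul {n : ℕ} {u v : ℝ → ℂ} (z : ℂ) (h : IsWeak n u v) :
    IsWeak n (z • u) (z • v) := by
  intro η hη hc
  simp only [Pi.smul_apply]
  simp_rw [smul_comm _ z]
  rw [integral_smul, integral_smul, h η hη hc, smul_comm]

theorem IsWeak.ae_unique {n : ℕ} {u v v' : ℝ → ℂ} (hv : Integrable v) (hv' : Integrable v')
    (h : IsWeak n u v) (h' : IsWeak n u v') : v =ᵐ[volume] v' := by
  refine ae_eq_of_integral_contDiff_smul_eq hv.locallyIntegrable hv'.locallyIntegrable
    fun η hη hc => ?_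
  have h1 := (h η hη hc).symm.trans (h' η hη hc)
  exact smul_right_injective ℂ (pow_ne_zero n (by norm_num : (-1 : ℝ) ≠ 0)) h1

theorem IsWeak.congr {n : ℕ} {u u' v v' : ℝ → ℂ} (h : IsWeak n u v) (hu : u =ᵐ[volume] u')
    (hv : v =ᵐ[volume] v') : IsWeak n u' v' := by
  intro η hη hc
  have e1 : ∫ t, iteratedDeriv n η t • u' t = ∫ t, iteratedDeriv n η t • u t :=
    integral_congr_ae (by filter_upwards [hu] with t ht; rw [ht])
  have e2 : ∫ t, η t • v' t = ∫ t, η t • v t :=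
    integral_congr_ae (by filter_upwards [hv] with t ht; rw [ht])
  rw [e1, e2, h η hη hc]

/-- Fubini turns the pairing with k * u into a superposition of pairings of u with translated test
functions, so a weak derivative of u passes through convolution with any integrable k. -/
theorem integral_smul_cv {g : ℝ → ℝ} (h : Continuous g) (hc : HasCompactSupport g)
    {k u : ℝ → ℂ} (hk : Integrable k) (hu : Integrable u) :
    ∫ t, g t • cv k u t = ∫ y, k y * ∫ t, g (t + y) • u t := by
  obtain ⟨C, hC⟩ := exists_bound_of_hasCompactSupport h hc
  have hi : Integrable (fun p : ℝ × ℝ => g p.1 • (k p.2 * u (p.1 - p.2))) (volume.prod volume) := by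
    have := hk.convolution_integrand (ContinuousLinearMap.mul ℂ ℂ) hu
    refine this.bdd_smul C (h.comp continuous_fst).aestronglyMeasurable
      (Filter.Eventually.of_forall fun p => hC _)
  calc ∫ t, g t • cv k u t = ∫ t, ∫ y, g t • (k y * u (t - y)) := by
        simp_rw [cv, integral_smul]
    _ = ∫ y, ∫ t, g t • (k y * u (t - y)) := integral_integral_swap hi
    _ = _ := by
        congr 1
        funext y
        rw [← integral_add_right_eq_self _ y, ← integral_const_mul]
        congr 1
        funext t
        simp only [add_sub_cancel_right, Complex.real_smul]
        ring

theorem IsWeak.cv {n : ℕ} {k u v : ℝ → ℂ} (hk : Integrable k) (hu : Integrable u)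
    (hv : Integrable v) (h : IsWeak n u v) : IsWeak n (cv k u) (cv k v) := by
  intro η hη hc
  rw [integral_smul_cv (continuous_iteratedDeriv_of_smooth hη n)
    (hasCompactSupport_iteratedDeriv hc n) hk hu, integral_smul_cv hη.continuous hc hk hv,
    ← integral_smul]
  congr 1
  funext y
  have h1 := h (fun t => η (t + y)) (hη.comp (contDiff_id.add contDiff_const))
    (hc.comp_homeomorph (Homeomorph.addRight y))
  rw [iteratedDeriv_comp_add_const] at h1
  rw [h1, mul_smul_comm]

/-- The affine change of variables is carried out on the test function. Positive r serves the
dilations, r = -1 the reflected translates. -/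
theorem IsWeak.comp_affine {n : ℕ} {u v : ℝ → ℂ} (h : IsWeak n u v) {r : ℝ} (hr : r ≠ 0) (x : ℝ) :
    IsWeak n (fun t => u (r * t + x)) (fun t => (r : ℂ) ^ n * v (r * t + x)) := by
  intro η hη hc
  have key : ∀ (g : ℝ → ℝ) (f : ℝ → ℂ), ∫ t, g t • f (r * t + x)
      = |r⁻¹| • ∫ s, g (r⁻¹ * (s - x)) • f s := by
    intro g f
    have h1 := Measure.integral_comp_mul_left (fun s => g (r⁻¹ * s) • f (s + x)) r
    have h2 := integral_sub_right_eq_self (μ := volume) (fun s => g (r⁻¹ * s) • f (s + x)) x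
    simp only [sub_add_cancel] at h2
    rw [h2, ← h1]
    simp only [← mul_assoc, inv_mul_cancel₀ hr, one_mul]
  have hη' : ContDiff ℝ ∞ fun s => η (r⁻¹ * (s - x)) :=
    hη.comp (contDiff_const.mul (contDiff_id.sub contDiff_const))
  have hc' : HasCompactSupport fun s => η (r⁻¹ * (s - x)) :=
    hc.comp_homeomorph ((Homeomorph.subRight x).trans (Homeomorph.mulLeft₀ r⁻¹ (inv_ne_zero hr)))
  have hd : iteratedDeriv n (fun s => η (r⁻¹ * (s - x)))
      = fun s => (r⁻¹) ^ n * iteratedDeriv n η (r⁻¹ * (s - x)) := by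
    rw [iteratedDeriv_comp_sub_const n (fun s => η (r⁻¹ * s)) x,
      iteratedDeriv_comp_const_mul (hη.of_le (by exact_mod_cast le_top))]
  have h1 := h _ hη' hc'
  rw [hd] at h1
  have e : ∀ t, η t • ((r : ℂ) ^ n * v (r * t + x)) = (r ^ n) • (η t • v (r * t + x)) := by
    intro t
    simp only [Complex.real_smul, Complex.ofReal_pow]
    ring
  simp_rw [e]
  rw [integral_smul, key, key]
  simp only [mul_smul, integral_smul] at h1
  have h2 : ∫ s, iteratedDeriv n η (r⁻¹ * (s - x)) • u s
      = r ^ n • (-1 : ℝ) ^ n • ∫ s, η (r⁻¹ * (s - x)) • v s := by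
    rw [← h1, smul_smul, ← mul_pow, mul_inv_cancel₀ hr, one_pow, one_smul]
  rw [h2]
  simp only [smul_smul]
  ring_nf

/-! ### The exponentially weighted L¹ norm; vanishing moments against derivatives -/

/-- The exponentially weighted `L¹` norm `∫ e^{b|t|} |g(t)| dt`. -/
noncomputable def expNorm (b : ℝ) (g : ℝ → ℂ) : ℝ≥0∞ := ∫⁻ t, ‖g t‖ₑ * ENNReal.ofReal (wt b 0 t)

theorem expNorm_congr (b : ℝ) {g g' : ℝ → ℂ} (h : g =ᵐ[volume] g') :
    expNorm b g = expNorm b g' :=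
  lintegral_congr_ae (by filter_upwards [h] with t ht; rw [ht])

theorem expNorm_cv_le {b : ℝ} (hb : 0 ≤ b) {a c : ℝ → ℂ} (ha : Measurable a) (hc : Measurable c) :
    expNorm b (cv a c) ≤ expNorm b a * expNorm b c := by
  have hw := measurable_wt b 0
  have hn : ∀ t, 0 ≤ wt b 0 t := fun t => (wt_pos b 0 t).le
  unfold expNorm
  calc ∫⁻ t, ‖cv a c t‖ₑ * ENNReal.ofReal (wt b 0 t)
      ≤ ∫⁻ t, ∫⁻ y, (‖a y‖ₑ * ENNReal.ofReal (wt b 0 y)) *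
          (‖c (t - y)‖ₑ * ENNReal.ofReal (wt b 0 (t - y))) := by
        refine lintegral_mono fun t => ?_
        refine (mul_le_mul_left (enorm_cv_le a c t) _).trans ?_
        rw [← lintegral_mul_const _ (by fun_prop)]
        refine lintegral_mono fun y => ?_
        have h := ENNReal.ofReal_le_ofReal (wt_add_le hb 0 y (t - y))
        rw [add_sub_cancel, ENNReal.ofReal_mul (hn _)] at h
        refine (mul_le_mul_right h _).trans (le_of_eq ?_)
        ring
    _ = ∫⁻ y, ∫⁻ t, (‖a y‖ₑ * ENNReal.ofReal (wt b 0 y)) *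
          (‖c (t - y)‖ₑ * ENNReal.ofReal (wt b 0 (t - y))) := by
        rw [lintegral_lintegral_swap]
        refine Measurable.aemeasurable ?_
        simp only [Function.uncurry_def]
        fun_prop
    _ = ∫⁻ y, (‖a y‖ₑ * ENNReal.ofReal (wt b 0 y)) *
          ∫⁻ t, ‖c t‖ₑ * ENNReal.ofReal (wt b 0 t) := by
        refine lintegral_congr fun y => ?_
        rw [lintegral_const_mul _ (by fun_prop),
          lintegral_sub_right_eq_self (fun t => ‖c t‖ₑ * ENNReal.ofReal (wt b 0 t))]
    _ = _ := lintegral_mul_const _ (by fun_prop)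

theorem Dec.expNorm_lt_top {b : ℝ} {m : ℕ} {a : ℝ → ℂ} (ha : Dec b (m + 1) a) :
    expNorm b a < ⊤ := by
  have h := (ha.integrable_mul (measurable_wt b 0) (C := 1) fun t => by
    rw [abs_of_pos (wt_pos _ _ _), one_mul]
    exact wt_mono_pow b (Nat.zero_le _) t).2
  refine lt_of_le_of_lt (le_of_eq ?_) h
  refine lintegral_congr fun t => ?_
  rw [enorm_smul, Real.enorm_of_nonneg (wt_pos _ _ _).le, mul_comm]

theorem integral_taylor_kernel {η : ℝ → ℝ} (hη : ContDiff ℝ ∞ η) (n : ℕ) (y : ℝ) :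
    ∫ t in (0 : ℝ)..y, ((y - t) ^ n / n.factorial) * iteratedDeriv (n + 1) η t
      = η y - ∑ k ∈ Finset.range (n + 1), ((k.factorial : ℝ)⁻¹ * y ^ k) * iteratedDeriv k η 0 := by
  -- At y = 0 the interval is a point, where derivatives within it are not unique; there both sides
  -- vanish.
  rcases eq_or_ne (0 : ℝ) y with rfl | hy
  · rw [intervalIntegral.integral_same, Finset.sum_eq_single 0]
    · simp
    · intro k _ hk
      simp [hk]
    · simp
  have hu := uniqueDiffOn_uIcc hy
  have hd : ∀ k : ℕ, ∀ t ∈ Set.uIcc 0 y, iteratedDerivWithin k η (Set.uIcc 0 y) t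
      = iteratedDeriv k η t := fun k t ht =>
    iteratedDerivWithin_eq_iteratedDeriv hu (hη.of_le (by exact_mod_cast le_top)).contDiffAt ht
  have h := taylor_integral_remainder (f := η) (x := y) (x₀ := 0) (n := n)
    (hη.of_le (by exact_mod_cast le_top)).contDiffOn
  rw [taylor_within_apply] at h
  simp only [hd _ 0 Set.left_mem_uIcc, sub_zero, smul_eq_mul] at h
  rw [h]
  refine intervalIntegral.integral_congr fun t ht => ?_
  simp only [hd _ t ht]

/-- The sign with which `x` is counted in `∫ x in 0..y, g x`. -/
noncomputable def intervalSign (x y : ℝ) : ℝ :=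
  (Set.Ioc 0 y).indicator 1 x - (Set.Ioc y 0).indicator 1 x

theorem measurable_intervalSign : Measurable fun z : ℝ × ℝ => intervalSign z.1 z.2 := by
  unfold intervalSign
  simp only [Set.indicator_apply, Set.mem_Ioc, Pi.one_apply]
  refine Measurable.sub (Measurable.ite ?_ measurable_const measurable_const)
    (Measurable.ite ?_ measurable_const measurable_const)
  · exact (measurableSet_lt measurable_const measurable_fst).inter
      (measurableSet_le measurable_fst measurable_snd)
  · exact (measurableSet_lt measurable_snd measurable_fst).inter
      (measurableSet_le measurable_fst measurable_const)

theorem integral_intervalSign {g : ℝ → ℝ} (hg : Continuous g) (y : ℝ) :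
    ∫ x, intervalSign x y * g x = ∫ x in (0 : ℝ)..y, g x := by
  unfold intervalSign
  have e : ∀ s : Set ℝ, MeasurableSet s →
      ∀ x, s.indicator (1 : ℝ → ℝ) x * g x = s.indicator g x := by
    intro s _ x
    by_cases hx : x ∈ s <;> simp [hx]
  simp_rw [sub_mul, e _ measurableSet_Ioc]
  have hi : ∀ u v : ℝ, Integrable ((Set.Ioc u v).indicator g) := fun u v =>
    (integrable_indicator_iff measurableSet_Ioc).2
      ((hg.integrableOn_Icc (a := u) (b := v)).mono_set Set.Ioc_subset_Icc_self)
  rw [integral_sub (hi _ _) (hi _ _), integral_indicator measurableSet_Ioc,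
    integral_indicator measurableSet_Ioc]
  rfl

theorem abs_intervalSign_eq (x y : ℝ) :
    |intervalSign x y| = (Set.uIoc 0 y).indicator 1 x := by
  unfold intervalSign
  rcases le_total 0 y with h | h
  · rw [Set.uIoc_of_le h, Set.Ioc_eq_empty (not_lt.2 h)]
    by_cases hx : x ∈ Set.Ioc 0 y <;> simp [hx]
  · rw [Set.uIoc_of_ge h, Set.Ioc_eq_empty (not_lt.2 h)]
    by_cases hx : x ∈ Set.Ioc y 0 <;> simp [hx]

/-- The kernel of iterated integration from the origin, applied to a function. -/
noncomputable def peanoKernel (n : ℕ) (a : ℝ → ℂ) (x y : ℝ) : ℂ :=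
  ((intervalSign x y * ((y - x) ^ n / n.factorial) : ℝ) : ℂ) * a y

theorem measurable_peanoKernel (n : ℕ) {a : ℝ → ℂ} (ha : Measurable a) :
    Measurable fun z : ℝ × ℝ => peanoKernel n a z.1 z.2 := by
  unfold peanoKernel
  have := measurable_intervalSign
  fun_prop

/-- For fixed y the kernel lives on x between 0 and y, where |x| and |y - x| are at most |y|. Hence
the weight at x is at most the weight at y, and the length |y| of the interval supplies the last
factor of |y|^{n+1}. -/
theorem lintegral_peanoKernel_le {b : ℝ} (hb : 0 ≤ b) (n : ℕ) {a : ℝ → ℂ} (ha : Measurable a) :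
    ∫⁻ x, ∫⁻ y, ‖peanoKernel n a x y‖ₑ * ENNReal.ofReal (wt b 0 x)
      ≤ expNorm b (fun t => (t : ℂ) ^ (n + 1) * a t) := by
  have hm := measurable_peanoKernel n ha
  have hw := measurable_wt b 0
  rw [lintegral_lintegral_swap (by
    refine Measurable.aemeasurable ?_
    simp only [Function.uncurry_def]
    exact hm.enorm.mul (by fun_prop))]
  refine lintegral_mono fun y => ?_
  have hpt : ∀ x, ‖peanoKernel n a x y‖ₑ * ENNReal.ofReal (wt b 0 x)
      ≤ (Set.uIoc 0 y).indicator
        (fun _ => ENNReal.ofReal (|y| ^ n * ‖a y‖ * wt b 0 y)) x := by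
    intro x
    rw [peanoKernel, ← ofReal_norm, ← ENNReal.ofReal_mul (norm_nonneg _), norm_mul,
      Complex.norm_real, norm_mul, Real.norm_eq_abs, abs_intervalSign_eq]
    by_cases hx : x ∈ Set.uIoc 0 y
    · simp only [hx, Set.indicator_of_mem, Pi.one_apply, one_mul]
      have h1 : |x| ≤ |y| ∧ |y - x| ≤ |y| := by
        rcases le_total 0 y with h | h
        · rw [Set.uIoc_of_le h] at hx
          rw [abs_of_pos hx.1, abs_of_nonneg h, abs_of_nonneg (by linarith [hx.2])]
          exact ⟨hx.2, by linarith [hx.1]⟩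
        · rw [Set.uIoc_of_ge h] at hx
          rw [abs_of_nonpos hx.2, abs_of_nonpos h, abs_of_nonpos (by linarith [hx.1])]
          exact ⟨by linarith [hx.1], by linarith [hx.2]⟩
      refine ENNReal.ofReal_le_ofReal ?_
      have h2 : ‖(y - x) ^ n / (n.factorial : ℝ)‖ ≤ |y| ^ n := by
        rw [norm_div, norm_pow, Real.norm_eq_abs, Real.norm_of_nonneg (by positivity)]
        refine (div_le_self (by positivity) (by exact_mod_cast Nat.succ_le_of_lt n.factorial_pos)).trans ?_
        exact pow_le_pow_left₀ (abs_nonneg _) h1.2 n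
      have h3 := wt_mono_right hb 0 h1.1
      gcongr
      exact (wt_pos _ _ _).le
    · simp [hx]
  refine (lintegral_mono hpt).trans (le_of_eq ?_)
  rw [lintegral_indicator measurableSet_uIoc, setLIntegral_const]
  have hv : volume (Set.uIoc 0 y) = ENNReal.ofReal |y| := by
    rw [Real.volume_uIoc, sub_zero]
  rw [hv, ← ENNReal.ofReal_mul (by have := (wt_pos b 0 y).le; positivity), ← ofReal_norm,
    ← ENNReal.ofReal_mul (norm_nonneg _)]
  congr 1
  simp
  ring

/-- The antiderivative is (-1)^{n+1} ∫ `peanoKernel n a x y` dy. Tested against η^{(n+1)}, the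
kernel yields the Taylor remainder of η at y times a(y); integration in y leaves ∫ η a, because the
Taylor polynomial, of degree at most n, is annihilated by the moment conditions. -/
theorem exists_weak_antideriv {b : ℝ} (hb : 0 ≤ b) {n : ℕ} {a : ℝ → ℂ} (ha : Measurable a)
    (hfin : expNorm b (fun t => (t : ℂ) ^ (n + 1) * a t) < ⊤)
    (hint : ∀ s ≤ n, Integrable fun t : ℝ => (t : ℂ) ^ s * a t)
    (hmom : ∀ s ≤ n, moment s a = 0) :
    ∃ A : ℝ → ℂ, Measurable A ∧ Integrable A ∧ IsWeak (n + 1) A a ∧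
      expNorm b A ≤ expNorm b (fun t => (t : ℂ) ^ (n + 1) * a t) := by
  have hm := measurable_peanoKernel n ha
  have hle := lintegral_peanoKernel_le hb n ha
  have hw := measurable_wt b 0
  have hiP : Integrable (fun z : ℝ × ℝ => peanoKernel n a z.1 z.2) (volume.prod volume) := by
    refine ⟨hm.aestronglyMeasurable, ?_⟩
    rw [hasFiniteIntegral_def, lintegral_prod _ hm.enorm.aemeasurable]
    refine lt_of_le_of_lt (lintegral_mono fun x => lintegral_mono fun y => ?_) (hle.trans_lt hfin)
    refine le_mul_of_one_le_right zero_le ?_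
    rw [← ENNReal.ofReal_one]
    exact ENNReal.ofReal_le_ofReal (one_le_wt hb 0 x)
  refine ⟨fun x => (-1 : ℂ) ^ (n + 1) * ∫ y, peanoKernel n a x y, ?_, ?_, ?_, ?_⟩
  · exact measurable_const.mul hm.stronglyMeasurable.integral_prod_right'.measurable
  · exact hiP.integral_prod_left.const_mul _
  · intro η hη hc
    have hcont := continuous_iteratedDeriv_of_smooth hη (n + 1)
    obtain ⟨C, hC⟩ := exists_bound_of_hasCompactSupport hcont
      (hasCompactSupport_iteratedDeriv hc (n + 1))
    have hi : Integrable (fun z : ℝ × ℝ => iteratedDeriv (n + 1) η z.1 • peanoKernel n a z.1 z.2)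
        (volume.prod volume) :=
      hiP.bdd_smul C (hcont.comp continuous_fst).aestronglyMeasurable
        (Filter.Eventually.of_forall fun p => hC _)
    have e1 : ∀ x, iteratedDeriv (n + 1) η x • ((-1 : ℂ) ^ (n + 1) * ∫ y, peanoKernel n a x y)
        = (-1 : ℂ) ^ (n + 1) * ∫ y, iteratedDeriv (n + 1) η x • peanoKernel n a x y := by
      intro x
      rw [integral_smul, mul_smul_comm]
    simp_rw [e1]
    rw [integral_const_mul, integral_integral_swap hi, ← Complex.coe_smul]
    push_cast
    rw [smul_eq_mul]
    congr 1
    have e2 : ∀ y, ∫ x, iteratedDeriv (n + 1) η x • peanoKernel n a x y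
        = η y • a y - ∑ k ∈ Finset.range (n + 1),
          (((k.factorial : ℝ)⁻¹ * iteratedDeriv k η 0 : ℝ) : ℂ) * ((y : ℂ) ^ k * a y) := by
      intro y
      have : ∀ x, iteratedDeriv (n + 1) η x • peanoKernel n a x y
          = ((intervalSign x y * (((y - x) ^ n / n.factorial) * iteratedDeriv (n + 1) η x) : ℝ) : ℂ)
            * a y := by
        intro x
        rw [peanoKernel, Complex.real_smul]
        push_cast
        ring
      simp_rw [this]
      rw [integral_mul_const, integral_complex_ofReal, integral_intervalSign (by fun_prop),
        integral_taylor_kernel hη, Complex.ofReal_sub, sub_mul, Complex.real_smul,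
        Complex.ofReal_sum, Finset.sum_mul]
      congr 1
      refine Finset.sum_congr rfl fun k _ => ?_
      push_cast
      ring
    simp_rw [e2]
    have hsum : ∀ k ∈ Finset.range (n + 1), Integrable fun y : ℝ =>
        (((k.factorial : ℝ)⁻¹ * iteratedDeriv k η 0 : ℝ) : ℂ) * ((y : ℂ) ^ k * a y) :=
      fun k hk => (hint k (Nat.lt_succ_iff.1 (Finset.mem_range.1 hk))).const_mul _
    rw [integral_sub (integrable_test_smul hη.continuous hc (by simpa using hint 0 (Nat.zero_le _)))
      (integrable_finsetSum _ hsum), integral_finsetSum _ hsum, sub_eq_self]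
    refine Finset.sum_eq_zero fun k hk => ?_
    rw [integral_const_mul]
    have := hmom k (Nat.lt_succ_iff.1 (Finset.mem_range.1 hk))
    rw [moment] at this
    rw [this, mul_zero]
  · refine le_trans (lintegral_mono fun x => ?_) hle
    have hmx : Measurable fun y => ‖peanoKernel n a x y‖ₑ :=
      (hm.comp (measurable_prodMk_left (x := x))).enorm
    rw [enorm_mul, lintegral_mul_const _ hmx]
    gcongr
    rw [enorm_pow, enorm_neg, enorm_one, one_pow, one_mul]
    exact enorm_integral_le_lintegral_enorm _

/-- Let A be the L-th weak antiderivative of a. Both A * v and a * u are L-th weak derivatives of A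
* u, hence agree almost everywhere. The vanishing moments of a are thereby traded for derivatives of
u. -/
theorem expNorm_cv_le_of_moments {b : ℝ} (hb : 0 ≤ b) {L : ℕ} {a u v : ℝ → ℂ}
    (ha : Dec b (L + 1) a) (hu : Dec b (L + 1) u) (hv : Dec b (L + 1) v) (hL : L ≠ 0)
    (hmom : ∀ s < L, moment s a = 0) (huv : IsWeak L u v) :
    expNorm b (cv a u) ≤ expNorm b (fun t => (t : ℂ) ^ L * a t) * expNorm b v := by
  obtain ⟨n, rfl⟩ := Nat.exists_eq_succ_of_ne_zero hL
  obtain ⟨A, hA1, hA2, hA3, hA4⟩ := exists_weak_antideriv hb (n := n) ha.1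
    (Dec.expNorm_lt_top (m := 0) (Dec.pow_mul (ha.mono_pow (by omega))))
    (fun s hs => ha.integrable_moment hb (by omega))
    (fun s hs => hmom s (Nat.lt_succ_of_le hs))
  have e : cv A v =ᵐ[volume] cv a u := by
    have h1 := huv.cv hA2 (hu.integrable hb) (hv.integrable hb)
    have h2 := hA3.cv (hu.integrable hb) hA2 (ha.integrable hb)
    rw [cv_comm u A, cv_comm u a] at h2
    exact h1.ae_unique (hA2.integrable_convolution (ContinuousLinearMap.mul ℂ ℂ) (hv.integrable hb))
      ((ha.cv hb hu).integrable hb) h2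
  rw [← expNorm_congr b e]
  exact (expNorm_cv_le hb hA1 hv.1).trans (mul_le_mul_left hA4 _)

theorem expNorm_dil_le {b : ℝ} (hb : 0 ≤ b) {r : ℝ} (hr : 1 ≤ r) {g : ℝ → ℂ}
    (hg : Measurable g) : expNorm b (dil r g) ≤ expNorm b g := by
  have hr0 : 0 < r := by linarith
  have hw := measurable_wt b 0
  have hF : Measurable fun t => ‖g t‖ₑ * ENNReal.ofReal (wt b 0 t) := by fun_prop
  have h := lintegral_map hF (measurable_const_mul r) (μ := volume)
  rw [Real.map_volume_mul_left hr0.ne', lintegral_smul_measure, smul_eq_mul] at h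
  calc expNorm b (dil r g)
      ≤ ∫⁻ t, ENNReal.ofReal r * (‖g (r * t)‖ₑ * ENNReal.ofReal (wt b 0 (r * t))) := by
        refine lintegral_mono fun t => ?_
        simp only [dil]
        rw [enorm_mul, mul_assoc, ← ofReal_norm (r : ℂ), Complex.norm_real,
          Real.norm_of_nonneg hr0.le]
        gcongr
        refine wt_mono_right hb 0 ?_
        rw [abs_mul, abs_of_pos hr0]
        exact le_mul_of_one_le_left (abs_nonneg _) hr
    _ = expNorm b g := by
        rw [lintegral_const_mul _ (by fun_prop), ← h, ← mul_assoc,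
          ← ENNReal.ofReal_mul hr0.le, abs_of_pos (inv_pos.2 hr0), mul_inv_cancel₀ hr0.ne',
          ENNReal.ofReal_one, one_mul]
        rfl

theorem expNorm_smul (b : ℝ) (z : ℂ) {g : ℝ → ℂ} (hg : Measurable g) :
    expNorm b (z • g) = ‖z‖ₑ * expNorm b g := by
  have hw := measurable_wt b 0
  unfold expNorm
  rw [← lintegral_const_mul _ (by fun_prop)]
  simp only [Pi.smul_apply, enorm_smul, mul_assoc]

theorem expNorm_pow_dil_le {b : ℝ} (hb : 0 ≤ b) {r : ℝ} (hr : 1 ≤ r) (L : ℕ) {a : ℝ → ℂ}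
    (ha : Measurable a) :
    expNorm b (fun t => (t : ℂ) ^ L * dil r a t)
      ≤ ENNReal.ofReal ((r ^ L)⁻¹) * expNorm b (fun t => (t : ℂ) ^ L * a t) := by
  have hr0 : (r : ℂ) ≠ 0 := by
    have : 0 < r := by linarith
    exact_mod_cast this.ne'
  have hm : Measurable fun t : ℝ => (t : ℂ) ^ L * a t := by fun_prop
  have e : (fun t : ℝ => (t : ℂ) ^ L * dil r a t)
      = (((r ^ L)⁻¹ : ℝ) : ℂ) • dil r (fun t => (t : ℂ) ^ L * a t) := by
    funext t
    simp only [dil, Pi.smul_apply, smul_eq_mul]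
    push_cast
    field_simp
    ring
  have hmd : Measurable (dil r fun t => (t : ℂ) ^ L * a t) := by unfold dil; fun_prop
  rw [e, expNorm_smul b _ hmd, ← ofReal_norm, Complex.norm_real,
    Real.norm_of_nonneg (by positivity)]
  gcongr
  exact expNorm_dil_le hb hr hm

/-! ### Jets, dyadic families and almost orthogonality -/

/-- A function `A 0` together with its weak derivatives `A n`, `n ≤ m`, all of them in the
weighted space `Dec b m`. -/
structure Jet (b : ℝ) (m : ℕ) (A : ℕ → ℝ → ℂ) : Prop where
  dec : ∀ n ≤ m, Dec b m (A n)
  weak : ∀ n ≤ m, IsWeak n (A 0) (A n)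

theorem Jet.dec_zero {b : ℝ} {m : ℕ} {A : ℕ → ℝ → ℂ} (h : Jet b m A) : Dec b m (A 0) :=
  h.dec 0 (Nat.zero_le _)

theorem Jet.add {b : ℝ} (hb : 0 ≤ b) {m : ℕ} {A B : ℕ → ℝ → ℂ} (hA : Jet b (m + 1) A)
    (hB : Jet b (m + 1) B) : Jet b (m + 1) (A + B) :=
  ⟨fun n hn => (hA.dec n hn).add (hB.dec n hn), fun n hn =>
    (hA.weak n hn).add (hA.dec_zero.integrable hb) ((hA.dec n hn).integrable hb)
      (hB.dec_zero.integrable hb) ((hB.dec n hn).integrable hb) (hB.weak n hn)⟩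

theorem Jet.smul {b : ℝ} {m : ℕ} {A : ℕ → ℝ → ℂ} (z : ℂ) (hA : Jet b m A) : Jet b m (z • A) :=
  ⟨fun n hn => (hA.dec n hn).smul z, fun n hn => (hA.weak n hn).smul z⟩

theorem Jet.sub {b : ℝ} (hb : 0 ≤ b) {m : ℕ} {A B : ℕ → ℝ → ℂ} (hA : Jet b (m + 1) A)
    (hB : Jet b (m + 1) B) : Jet b (m + 1) (A - B) := by
  have := hA.add hb (hB.smul (-1))
  rwa [neg_one_smul, ← sub_eq_add_neg] at this

/-- The convolution of a function with all derivatives of a jet. -/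
noncomputable def jcv (k : ℝ → ℂ) (A : ℕ → ℝ → ℂ) : ℕ → ℝ → ℂ := fun n => cv k (A n)

theorem Jet.jcv {b : ℝ} (hb : 0 ≤ b) {m : ℕ} {k : ℝ → ℂ} {A : ℕ → ℝ → ℂ} (hk : Dec b (m + 1) k)
    (hA : Jet b (m + 1) A) : Jet b (m + 1) (jcv k A) :=
  ⟨fun n hn => hk.cv hb (hA.dec n hn), fun n hn =>
    (hA.weak n hn).cv (hk.integrable hb) (hA.dec_zero.integrable hb) ((hA.dec n hn).integrable hb)⟩

/-- The dilation `r a(r ·)` with its derivatives. -/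
noncomputable def jdil (r : ℝ) (A : ℕ → ℝ → ℂ) : ℕ → ℝ → ℂ := fun n => ((r : ℂ) ^ n) • dil r (A n)

theorem jdil_zero (r : ℝ) (A : ℕ → ℝ → ℂ) : jdil r A 0 = dil r (A 0) := by simp [jdil]

theorem Jet.jdil {b : ℝ} (hb : 0 ≤ b) {m : ℕ} {A : ℕ → ℝ → ℂ} (hA : Jet b m A) {r : ℝ}
    (hr : 1 ≤ r) : Jet b m (jdil r A) := by
  refine ⟨fun n hn => ((hA.dec n hn).dil hb hr).smul _, fun n hn => ?_⟩
  have h := ((hA.weak n hn).comp_affine (r := r) (by linarith) 0).smul (r : ℂ)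
  rw [jdil_zero]
  refine h.congr (Filter.Eventually.of_forall fun t => ?_) (Filter.Eventually.of_forall fun t => ?_)
  · simp [dil]
  · simp only [VBesov.jdil, dil, Pi.smul_apply, smul_eq_mul, add_zero]
    ring

/-- The reflected translate `a(x - ·)` with its derivatives. -/
noncomputable def jrefl (x : ℝ) (A : ℕ → ℝ → ℂ) : ℕ → ℝ → ℂ :=
  fun n t => (-1 : ℂ) ^ n * A n (x - t)

theorem Jet.jrefl {b : ℝ} (hb : 0 ≤ b) {m : ℕ} {A : ℕ → ℝ → ℂ} (hA : Jet b m A) (x : ℝ) :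
    Jet b m (jrefl x A) := by
  refine ⟨fun n hn => ((hA.dec n hn).comp_sub hb x).smul ((-1 : ℂ) ^ n), fun n hn => ?_⟩
  have h := (hA.weak n hn).comp_affine (r := -1) (by norm_num) x
  refine h.congr (Filter.Eventually.of_forall fun t => ?_) (Filter.Eventually.of_forall fun t => ?_)
  · simp only [VBesov.jrefl, pow_zero, one_mul]
    congr 1
    ring
  · simp only [VBesov.jrefl, Complex.ofReal_neg, Complex.ofReal_one]
    congr 2
    ring

/-- A sequence `a₀, a₁, a₂, …` of jets with `a_{k+1}` the dilation of `a₁` by the factor `2^k`,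
where `a₁` has vanishing moments of order less than `L`. -/
structure DyadicFamily (b : ℝ) (L : ℕ) (A : ℕ → ℕ → ℝ → ℂ) : Prop where
  jet : ∀ k, Jet b (L + 1) (A k)
  succ : ∀ k, A (k + 1) = jdil (2 ^ k) (A 1)
  moments : ∀ s < L, moment s (A 1 0) = 0

theorem DyadicFamily.moments_succ {b : ℝ} {L : ℕ} {A : ℕ → ℕ → ℝ → ℂ} (h : DyadicFamily b L A)
    (k : ℕ) : ∀ s < L, moment s (A (k + 1) 0) = 0 := by
  intro s hs
  rw [h.succ, jdil_zero, moment_dil (by positivity), h.moments s hs, mul_zero]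

theorem DyadicFamily.exists_expNorm_pow_le {b : ℝ} (hb : 0 ≤ b) {L : ℕ} {A : ℕ → ℕ → ℝ → ℂ}
    (h : DyadicFamily b L A) : ∃ C : ℝ, 0 ≤ C ∧ ∀ k,
      expNorm b (fun t => (t : ℂ) ^ L * A (k + 1) 0 t) ≤ ENNReal.ofReal (C * (2 ^ (k * L))⁻¹) := by
  have hd := (h.jet 1).dec_zero
  have hfin : expNorm b (fun t => (t : ℂ) ^ L * A 1 0 t) < ⊤ :=
    Dec.expNorm_lt_top (m := 0) (Dec.pow_mul (hd.mono_pow (by omega)))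
  refine ⟨_, ENNReal.toReal_nonneg (a := expNorm b (fun t => (t : ℂ) ^ L * A 1 0 t)), fun k => ?_⟩
  rw [h.succ, jdil_zero]
  refine (expNorm_pow_dil_le hb (one_le_pow₀ one_le_two) L hd.1).trans (le_of_eq ?_)
  rw [mul_comm, ENNReal.ofReal_mul ENNReal.toReal_nonneg, ENNReal.ofReal_toReal hfin.ne, pow_mul]

theorem DyadicFamily.exists_expNorm_deriv_le {b : ℝ} (hb : 0 ≤ b) {L : ℕ} {A : ℕ → ℕ → ℝ → ℂ}
    (h : DyadicFamily b L A) : ∃ C : ℝ, 0 ≤ C ∧ ∀ k,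
      expNorm b (A k L) ≤ ENNReal.ofReal (C * 2 ^ (k * L)) := by
  have hL : L ≤ L + 1 := Nat.le_succ L
  have hd0 := ((h.jet 0).dec L hL).expNorm_lt_top
  have hd1 := ((h.jet 1).dec L hL).expNorm_lt_top
  -- The member `A 0` is not a dilate of `A 1`, so the constant has to cover both.
  refine ⟨(expNorm b (A 0 L)).toReal + (expNorm b (A 1 L)).toReal,
    add_nonneg ENNReal.toReal_nonneg ENNReal.toReal_nonneg, fun k => ?_⟩
  rcases Nat.eq_zero_or_pos k with rfl | hk
  · simp only [zero_mul, pow_zero, mul_one]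
    rw [ENNReal.ofReal_add ENNReal.toReal_nonneg ENNReal.toReal_nonneg,
      ENNReal.ofReal_toReal hd0.ne]
    exact le_self_add
  · obtain ⟨k, rfl⟩ := Nat.exists_eq_succ_of_ne_zero hk.ne'
    have hm := ((h.jet 1).dec L hL).1
    have hmd : Measurable (dil (2 ^ k) (A 1 L)) := by unfold dil; fun_prop
    rw [Nat.succ_eq_add_one, h.succ, jdil, expNorm_smul b _ hmd,
      ENNReal.ofReal_mul (add_nonneg ENNReal.toReal_nonneg ENNReal.toReal_nonneg), mul_comm]
    refine mul_le_mul' ?_ ?_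
    · rw [ENNReal.ofReal_add ENNReal.toReal_nonneg ENNReal.toReal_nonneg,
        ENNReal.ofReal_toReal hd1.ne]
      exact (expNorm_dil_le hb (one_le_pow₀ one_le_two) hm).trans le_add_self
    · rw [← ofReal_norm]
      refine ENNReal.ofReal_le_ofReal ?_
      simp only [Complex.ofReal_pow, Complex.ofReal_ofNat, norm_pow, Complex.norm_ofNat]
      rw [← pow_mul]
      exact pow_le_pow_right₀ one_le_two (Nat.mul_le_mul_right L (Nat.le_succ k))

/-- The finer scale j provides the moments and gains 2^{-(j-1)L}, the coarser scale k provides the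
derivatives and costs 2^{kL}; the shift of the index by one is the factor 2^L in the constant. At j
= 0 no moments are available, but then k = 0 and a plain product bound suffices. -/
theorem DyadicFamily.exists_expNorm_cv_le_of_lt {b : ℝ} (hb : 0 ≤ b) {L : ℕ} (hL : L ≠ 0)
    {A B : ℕ → ℕ → ℝ → ℂ} (hA : DyadicFamily b L A) (hB : DyadicFamily b L B) :
    ∃ C : ℝ, 0 ≤ C ∧ ∀ j k, k ≤ j → expNorm b (cv (A j 0) (B k 0))
      ≤ ENNReal.ofReal (C * ((2 : ℝ) ^ ((j - k) * L))⁻¹) := by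
  obtain ⟨C₁, h1, H1⟩ := hA.exists_expNorm_pow_le hb
  obtain ⟨C₂, h2, H2⟩ := hB.exists_expNorm_deriv_le hb
  have hA0 := (hA.jet 0).dec_zero
  have hB0 := (hB.jet 0).dec_zero
  have hf : expNorm b (A 0 0) * expNorm b (B 0 0) ≠ ⊤ :=
    (ENNReal.mul_lt_top hA0.expNorm_lt_top hB0.expNorm_lt_top).ne
  set C₀ := (expNorm b (A 0 0) * expNorm b (B 0 0)).toReal
  have h0 : 0 ≤ C₀ := ENNReal.toReal_nonneg
  have h3 : 0 ≤ C₁ * C₂ * 2 ^ L := by positivity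
  refine ⟨C₀ + C₁ * C₂ * 2 ^ L, by positivity, fun j k hk => ?_⟩
  rcases Nat.eq_zero_or_pos j with rfl | hj
  · obtain rfl : k = 0 := by omega
    refine (expNorm_cv_le hb hA0.1 hB0.1).trans ?_
    rw [← ENNReal.ofReal_toReal hf]
    refine ENNReal.ofReal_le_ofReal ?_
    simp only [tsub_self, zero_mul, pow_zero, inv_one, mul_one]
    exact le_add_of_nonneg_right h3
  · obtain ⟨j, rfl⟩ := Nat.exists_eq_succ_of_ne_zero hj.ne'
    refine (expNorm_cv_le_of_moments hb (hA.jet _).dec_zero (hB.jet k).dec_zero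
      ((hB.jet k).dec L (Nat.le_succ L)) hL (hA.moments_succ j)
      ((hB.jet k).weak L (Nat.le_succ L))).trans ?_
    refine (mul_le_mul' (H1 j) (H2 k)).trans ?_
    rw [← ENNReal.ofReal_mul (by positivity)]
    refine ENNReal.ofReal_le_ofReal ?_
    have e : (2 : ℝ) ^ (j * L) * 2 ^ L = 2 ^ ((j + 1 - k) * L) * 2 ^ (k * L) := by
      rw [← pow_add, ← pow_add, ← add_mul, Nat.sub_add_cancel hk, Nat.succ_mul]
    have e2 : ((2 : ℝ) ^ (j * L))⁻¹ * 2 ^ (k * L) = 2 ^ L * ((2 : ℝ) ^ ((j + 1 - k) * L))⁻¹ := by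
      rw [inv_mul_eq_div, ← div_eq_mul_inv, div_eq_div_iff (by positivity) (by positivity),
        mul_comm _ ((2 : ℝ) ^ ((j + 1 - k) * L)), ← e, mul_comm]
    calc C₁ * (2 ^ (j * L))⁻¹ * (C₂ * 2 ^ (k * L))
        = C₁ * C₂ * ((2 ^ (j * L))⁻¹ * 2 ^ (k * L)) := by ring
      _ = C₁ * C₂ * 2 ^ L * ((2 : ℝ) ^ ((j + 1 - k) * L))⁻¹ := by rw [e2]; ring
      _ ≤ _ := by
        refine mul_le_mul_of_nonneg_right ?_ (by positivity)
        exact le_add_of_nonneg_left h0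

/-- Both families have moments and derivatives, and convolution commutes, so whichever factor is
finer can supply the moments. -/
theorem DyadicFamily.exists_expNorm_cv_le {b : ℝ} (hb : 0 ≤ b) {L : ℕ} (hL : L ≠ 0)
    {A B : ℕ → ℕ → ℝ → ℂ} (hA : DyadicFamily b L A) (hB : DyadicFamily b L B) :
    ∃ C : ℝ, 0 ≤ C ∧ ∀ j k, expNorm b (cv (A j 0) (B k 0))
      ≤ ENNReal.ofReal (C * (2 : ℝ) ^ (-((L : ℝ) * |(k : ℝ) - j|))) := by
  obtain ⟨C₁, h1, H1⟩ := hA.exists_expNorm_cv_le_of_lt hb hL hB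
  obtain ⟨C₂, h2, H2⟩ := hB.exists_expNorm_cv_le_of_lt hb hL hA
  have e : ∀ j k : ℕ, k ≤ j → ((2 : ℝ) ^ ((j - k) * L))⁻¹ = (2 : ℝ) ^ (-((L : ℝ) * ((j : ℝ) - k))) := by
    intro j k h
    rw [Real.rpow_neg two_pos.le, ← Real.rpow_natCast]
    push_cast [Nat.cast_sub h]
    ring_nf
  refine ⟨C₁ + C₂, by positivity, fun j k => ?_⟩
  rcases le_total k j with h | h
  · refine (H1 j k h).trans (ENNReal.ofReal_le_ofReal ?_)
    have h' : (k : ℝ) ≤ j := by exact_mod_cast h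
    rw [e j k h, abs_of_nonpos (by linarith), neg_sub]
    gcongr
    linarith
  · rw [cv_comm]
    refine (H2 k j h).trans (ENNReal.ofReal_le_ofReal ?_)
    have h' : (j : ℝ) ≤ k := by exact_mod_cast h
    rw [e k j h, abs_of_nonneg (by linarith)]
    gcongr
    linarith

/-! ### From generators to jets with vanishing moments -/

theorem measurePreserving_const_fin_one :
    MeasurePreserving (fun (t : ℝ) (_ : Fin 1) => t) volume volume := by
  exact (volume_preserving_funUnique (Fin 1) ℝ).symm

theorem integral_comp_const_fin_one (g : (Fin 1 → ℝ) → ℂ) :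
    ∫ t : ℝ, g (fun _ => t) = ∫ x, g x := by
  have h := (volume_preserving_funUnique (Fin 1) ℝ).symm
  exact h.integral_comp' (f := (MeasurableEquiv.funUnique (Fin 1) ℝ).symm) g

theorem pderiv_comp_eval {d : ℕ} (i : Fin d) {g : ℝ → ℝ} (hg : Differentiable ℝ g) :
    pderiv i (fun x => g (x i)) = fun x => deriv g (x i) := by
  funext x
  have h := (hg (x i)).hasDerivAt.comp_hasFDerivAt x
    (ContinuousLinearMap.proj (R := ℝ) (φ := fun _ : Fin d => ℝ) i).hasFDerivAt
  have h' : fderiv ℝ (fun x : Fin d → ℝ => g (x i)) x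
      = deriv g (x i) • ContinuousLinearMap.proj (R := ℝ) (φ := fun _ : Fin d => ℝ) i := h.fderiv
  simp [pderiv, h']

theorem contDiff_iteratedDeriv {g : ℝ → ℝ} (hg : ContDiff ℝ ∞ g) (n : ℕ) :
    ContDiff ℝ ∞ (iteratedDeriv n g) := by
  induction n with
  | zero => simpa using hg
  | succ n ih =>
    rw [iteratedDeriv_succ]
    exact (contDiff_infty_iff_deriv.1 ih).2

theorem iterate_pderiv_comp_eval {d : ℕ} (i : Fin d) {g : ℝ → ℝ} (hg : ContDiff ℝ ∞ g) (n : ℕ) :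
    (pderiv i)^[n] (fun x => g (x i)) = fun x => iteratedDeriv n g (x i) := by
  induction n with
  | zero => simp
  | succ n ih =>
    rw [Function.iterate_succ_apply', ih,
      pderiv_comp_eval i ((contDiff_iteratedDeriv hg n).differentiable (by simp)),
      iteratedDeriv_succ]

theorem IsWeakDeriv.isWeak {n : ℕ} {u v : (Fin 1 → ℝ) → ℂ} (h : IsWeakDeriv (fun _ => n) u v) :
    IsWeak n (fun t => u fun _ => t) (fun t => v fun _ => t) := by
  intro η hη hc
  have hc' : HasCompactSupport fun x : Fin 1 → ℝ => η (x 0) :=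
    hc.comp_homeomorph (Homeomorph.funUnique (Fin 1) ℝ)
  have hη' : ContDiff ℝ ∞ fun x : Fin 1 → ℝ => η (x 0) := hη.comp (contDiff_apply ℝ ℝ 0)
  have h1 := h.2.2 _ hη' hc'
  have e : mixedDeriv (fun _ : Fin 1 => n) (fun x => η (x 0))
      = fun x => iteratedDeriv n η (x 0) := by
    rw [← iterate_pderiv_comp_eval 0 hη n]
    simp [mixedDeriv, List.finRange_succ]
  rw [e, ← integral_comp_const_fin_one, ← integral_comp_const_fin_one] at h1
  simpa using h1

theorem one_add_pow_le (m : ℕ) (t : ℝ) : (1 + |t|) ^ m ≤ 2 ^ m * (1 + |t| ^ m) := by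
  have h : 1 + |t| ≤ 2 * max 1 |t| := by linarith [le_max_left 1 |t|, le_max_right 1 |t|]
  refine (pow_le_pow_left₀ (by positivity) h m).trans ?_
  rw [mul_pow]
  gcongr
  rcases max_cases 1 |t| with h | h <;> rw [h.1]
  · rw [one_pow]
    exact le_add_of_nonneg_right (by positivity)
  · exact le_add_of_nonneg_left zero_le_one

theorem exists_jet {b : ℝ} (hb : 0 ≤ b) {m : ℕ} {ψ : ℝ → ℂ}
    (h : (fun t : Fin 1 → ℝ => ψ (t 0)) ∈ testFunctions b (fun _ : Fin 1 => m)) :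
    ∃ A, Jet b m A ∧ A 0 =ᵐ[volume] ψ := by
  have H : ∀ n : ℕ, ∃ a : ℝ → ℂ, n ≤ m → (Dec b m a ∧ IsWeak n ψ a) := by
    intro n
    by_cases hn : n ≤ m
    swap
    · exact ⟨0, fun h => absurd h hn⟩
    obtain ⟨v, h1, -, h3⟩ := h (fun _ => n) fun _ => hn
    have hmp := measurePreserving_const_fin_one
    have h3' : ∀ k ≤ m, MemLp (fun t : ℝ => (Real.exp (b * |t|) * t ^ k) • v fun _ => t) 2
        volume := by
      intro k hk
      have := (h3 (fun _ => k) fun _ => hk).comp_measurePreserving hmp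
      refine this.ae_eq (Filter.Eventually.of_forall fun t => ?_)
      simp [expMonomial]
    have hvm : AEStronglyMeasurable (fun t : ℝ => v fun _ => t) volume :=
      (h1.2.1.aestronglyMeasurable).comp_measurePreserving hmp
    have hae := hvm.ae_eq_mk
    refine ⟨hvm.mk _, fun _ => ⟨⟨hvm.stronglyMeasurable_mk.measurable, ?_⟩, ?_⟩⟩
    -- The monomials of degrees 0 and m suffice, because (1 + |t|)^m ≤ 2^m (1 + |t|^m).
    · have h4 := ((h3' 0 (Nat.zero_le _)).norm.add (h3' m le_rfl).norm)
      refine h4.of_le_mul (c := 2 ^ m) ((continuous_wt b m).aestronglyMeasurable.smul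
        hvm.stronglyMeasurable_mk.aestronglyMeasurable) ?_
      filter_upwards [hae] with t ht
      rw [← ht, Pi.add_apply, norm_smul, norm_smul, norm_smul, norm_mul, norm_mul, norm_pow,
        Real.norm_of_nonneg (wt_pos b m t).le, Real.norm_of_nonneg (Real.exp_pos _).le]
      simp only [pow_zero, mul_one, Real.norm_eq_abs, abs_pow]
      rw [abs_of_nonneg (by positivity), wt]
      calc _ ≤ Real.exp (b * |t|) * (2 ^ m * (1 + |t| ^ m)) * ‖v fun _ => t‖ := by
            gcongr
            exact one_add_pow_le m t
        _ = _ := by ring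
    · exact h1.isWeak.congr (Filter.EventuallyEq.rfl) hae
  choose A hA using H
  obtain ⟨v, h1, -, -⟩ := h 0 fun _ => Nat.zero_le _
  -- A weak derivative of order zero is the function itself up to a null set; `A 0` is the Borel
  -- representative used from here on.
  have hz : A 0 =ᵐ[volume] ψ := by
    obtain ⟨hd, hw⟩ := hA 0 (Nat.zero_le _)
    have hψ : LocallyIntegrable ψ volume := by
      have := h1.1
      have e : ψ = (fun t : Fin 1 → ℝ => ψ (t 0)) ∘ fun t _ => t := rfl
      intro x
      obtain ⟨s, hs, hi⟩ := this (fun _ => x)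
      have hcont : Continuous (fun (t : ℝ) (_ : Fin 1) => t) := by fun_prop
      refine ⟨_, hcont.continuousAt.preimage_mem_nhds hs, ?_⟩
      rw [e]
      exact (measurePreserving_const_fin_one.integrableOn_comp_preimage
        (MeasurableEquiv.funUnique (Fin 1) ℝ).symm.measurableEmbedding).2 hi
    have hA0 : LocallyIntegrable (A 0) volume :=
      (hd.memLp_two hb).locallyIntegrable one_le_two
    refine ae_eq_of_integral_contDiff_smul_eq hA0 hψ fun η hη hc => ?_
    simpa using (hw η hη hc).symm
  exact ⟨A, ⟨fun n hn => (hA n hn).1, fun n hn =>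
    (hA n hn).2.congr hz.symm Filter.EventuallyEq.rfl⟩, hz⟩

theorem moment_congr {s : ℕ} {a c : ℝ → ℂ} (h : a =ᵐ[volume] c) : moment s a = moment s c :=
  integral_congr_ae (by filter_upwards [h] with t ht; rw [ht])

theorem moment_add {b : ℝ} (hb : 0 ≤ b) {L s : ℕ} (hs : s ≤ L) {a c : ℝ → ℂ}
    (ha : Dec b (L + 1) a) (hc : Dec b (L + 1) c) : moment s (a + c) = moment s a + moment s c := by
  unfold moment
  rw [← integral_add (ha.integrable_moment hb hs) (hc.integrable_moment hb hs)]
  simp [mul_add]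

theorem moment_smul (s : ℕ) (z : ℂ) (a : ℝ → ℂ) : moment s (z • a) = z * moment s a := by
  unfold moment
  rw [← integral_const_mul]
  simp [mul_left_comm]

theorem moment_sub {b : ℝ} (hb : 0 ≤ b) {L s : ℕ} (hs : s ≤ L) {a c : ℝ → ℂ}
    (ha : Dec b (L + 1) a) (hc : Dec b (L + 1) c) : moment s (a - c) = moment s a - moment s c := by
  unfold moment
  rw [← integral_sub (ha.integrable_moment hb hs) (hc.integrable_moment hb hs)]
  simp [mul_sub]

theorem mother_eq (ψ : ℝ → ℂ) : mother ψ = ψ - dil (1 / 2) ψ := by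
  funext t
  simp [mother, dil]

theorem dil_congr {r : ℝ} (hr : r ≠ 0) {a c : ℝ → ℂ} (h : a =ᵐ[volume] c) :
    dil r a =ᵐ[volume] dil r c := by
  have hq : Measure.QuasiMeasurePreserving (fun t : ℝ => r * t) volume volume := by
    refine ⟨measurable_const_mul r, ?_⟩
    rw [Real.map_volume_mul_left hr]
    exact Measure.smul_absolutelyContinuous
  filter_upwards [hq.ae h] with t ht
  simp only [dil, ht]

/-- Dilation by 1/2 spreads the function out, so `Dec.dil`, which needs a factor at least 1, does
not apply; integrability of a moment, however, is unaffected by scaling. -/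
theorem integrable_moment_mother {b : ℝ} (hb : 0 ≤ b) {L s : ℕ} (hs : s ≤ L) {ψ a : ℝ → ℂ}
    (ha : Dec b (L + 1) a) (h : a =ᵐ[volume] ψ) :
    Integrable fun t : ℝ => (t : ℂ) ^ s * dil (1 / 2) ψ t := by
  have h1 := (ha.integrable_moment hb hs).comp_mul_left' (R := 1 / 2) (by norm_num)
  have h2 := (h1.const_mul ((2 : ℂ) ^ s * (1 / 2)))
  refine h2.congr ?_
  filter_upwards [dil_congr (r := 1 / 2) (by norm_num) h] with t ht
  rw [← ht]
  simp only [dil]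
  push_cast
  rw [mul_pow]
  have : (2 : ℂ) ^ s * (1 / 2) ^ s = 1 := by rw [← mul_pow]; norm_num
  linear_combination ((t : ℂ) ^ s * (1 / 2) * a (1 / 2 * t)) * this

/-- The s-th derivative of the Fourier transform at 0 is (-2πi)^s times the moment of ψ - 2⁻¹ψ(2⁻¹
·), which equals (1 - 2^s) times the moment of ψ. The factor 1 - 2^s is nonzero exactly when s ≥ 1;
order zero is governed by the normalization instead. -/
theorem IsGenerator.moment_eq_zero {b : ℝ} (hb : 0 ≤ b) {L : ℕ} {ψ a : ℝ → ℂ}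
    (hψ : IsGenerator b L ψ) (ha : Dec b (L + 1) a) (h : a =ᵐ[volume] ψ) {s : ℕ} (h1 : 1 ≤ s)
    (hs : s ≤ L) : moment s a = 0 := by
  have hi : ∀ n ≤ L, Integrable fun t : ℝ => (t : ℂ) ^ n * ψ t := fun n hn =>
    (ha.integrable_moment hb hn).congr (by filter_upwards [h] with t ht; rw [ht])
  have hm : ∀ n ≤ L, Integrable fun t : ℝ => (t : ℂ) ^ n * mother ψ t := by
    intro n hn
    have := (hi n hn).sub (integrable_moment_mother hb hn ha h)
    refine this.congr (Filter.Eventually.of_forall fun t => ?_)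
    simp only [mother_eq, Pi.sub_apply, mul_sub]
  have hf := hψ.moments s hs
  rw [Real.iteratedDeriv_fourier (N := (L : ℕ∞)) (fun n hn => ?_) (by exact_mod_cast hs),
    Real.fourier_real_eq_integral_exp_smul] at hf
  · have e : ∀ v : ℝ, Complex.exp (((-2 * Real.pi * v * 0 : ℝ) : ℂ) * Complex.I) •
        (-2 * (Real.pi : ℂ) * Complex.I * v) ^ s • mother ψ v
        = (-2 * (Real.pi : ℂ) * Complex.I) ^ s * ((v : ℂ) ^ s * ψ v - (v : ℂ) ^ s * dil (1 / 2) ψ v) := by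
      intro v
      simp only [mul_zero, Complex.ofReal_zero, zero_mul, Complex.exp_zero, smul_eq_mul,
        mother_eq, Pi.sub_apply]
      ring
    simp_rw [e] at hf
    rw [integral_const_mul, integral_sub (hi s hs) (integrable_moment_mother hb hs ha h)] at hf
    have hne : (-2 * (Real.pi : ℂ) * Complex.I) ^ s ≠ 0 := by
      refine pow_ne_zero s (mul_ne_zero (mul_ne_zero (by norm_num) ?_) Complex.I_ne_zero)
      exact_mod_cast Real.pi_ne_zero
    have h3 := (mul_eq_zero.1 hf).resolve_left hne
    have h4 := moment_dil (r := 1 / 2) (by norm_num) s ψ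
    rw [moment_congr h]
    unfold moment at h4 ⊢
    rw [h4] at h3
    have h5 : (1 - ((((1 / 2 : ℝ) : ℂ)) ^ s)⁻¹) * ∫ t : ℝ, (t : ℂ) ^ s * ψ t = 0 := by
      rw [← h3]
      ring
    refine (mul_eq_zero.1 h5).resolve_left fun h6 => ?_
    have h7 : ((2 : ℂ)) ^ s = 1 := by
      rw [sub_eq_zero] at h6
      rw [h6, ← inv_pow]
      norm_num
    have h8 : (2 : ℝ) ^ s = 1 := by exact_mod_cast h7
    exact (one_lt_pow₀ one_lt_two (by omega)).ne' h8
  · refine (hm n (by exact_mod_cast hn)).congr (Filter.Eventually.of_forall fun t => ?_)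
    simp [Complex.real_smul]

theorem IsGenerator.moment_zero_sq {b : ℝ} (hb : 0 ≤ b) {L : ℕ} {ψ a : ℝ → ℂ}
    (hψ : IsGenerator b L ψ) (ha : Dec b (L + 1) a) (h : a =ᵐ[volume] ψ) :
    moment 0 a * moment 0 a = 1 := by
  have h1 := hψ.integral_conv
  have h2 := integral_cv (ha.integrable hb) (ha.integrable hb)
  simp only [moment, pow_zero, one_mul]
  rw [← h2, ← h1]
  congr 1
  funext x
  refine integral_congr_ae ?_
  filter_upwards [h, (Measure.measurePreserving_sub_left volume x).quasiMeasurePreserving.ae h]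
    with y e1 e2
  rw [← e1, ← e2, mul_comm]

/-! ### The one-dimensional Calderón resolution -/

/-- The jets of the dyadic resolution `p_0`, `p_k - p_{k-1}`, where `p_k = 2^k p(2^k ·)`. -/
noncomputable def diffJet (P : ℕ → ℝ → ℂ) : ℕ → ℕ → ℝ → ℂ
  | 0 => P
  | k + 1 => jdil (2 ^ k) (jdil 2 P - P)

/-- The jets of the factors `λ_k` with `φ_k * λ_k = h_k - h_{k-1}`, where
`h_k = 3 p_k * p_k - 2 ε p_k * p_k * p_k` and `φ_k = p_k - p_{k-1}`. -/
noncomputable def dualJet (ε : ℂ) (P : ℕ → ℝ → ℂ) : ℕ → ℕ → ℝ → ℂ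
  | 0 => (3 : ℂ) • P - (2 * ε) • jcv (P 0) P
  | k + 1 => jdil (2 ^ k) ((3 : ℂ) • (jdil 2 P + P) -
      (2 * ε) • (jcv (dil 2 (P 0)) (jdil 2 P) + jcv (dil 2 (P 0)) P + jcv (P 0) P))

/-- The approximate identity `h = 3 p * p - 2 ε p * p * p`. -/
noncomputable def approxId (ε : ℂ) (p : ℝ → ℂ) : ℝ → ℂ :=
  (3 : ℂ) • cv p p - (2 * ε) • cv p (cv p p)

theorem dil_approxId {r : ℝ} (hr : 0 < r) (ε : ℂ) (p : ℝ → ℂ) :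
    dil r (approxId ε p) = approxId ε (dil r p) := by
  simp only [approxId, dil_sub, dil_smul, cv_dil hr]

theorem Dec.approxId {b : ℝ} (hb : 0 ≤ b) {m : ℕ} {p : ℝ → ℂ} (hp : Dec b (m + 1) p) (ε : ℂ) :
    Dec b (m + 1) (approxId ε p) :=
  ((hp.cv hb hp).smul _).sub ((hp.cv hb (hp.cv hb hp)).smul _)

theorem integral_approxId {b : ℝ} (hb : 0 ≤ b) {m : ℕ} {p : ℝ → ℂ} (hp : Dec b (m + 1) p) {ε : ℂ}
    (hε : moment 0 p = ε) (h1 : ε * ε = 1) : ∫ t, approxId ε p t = 1 := by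
  have hε' : ∫ t, p t = ε := by simpa [moment] using hε
  have hpp := hp.cv hb hp
  simp only [approxId, Pi.sub_apply, Pi.smul_apply, smul_eq_mul]
  rw [integral_sub (((hpp.integrable hb)).const_mul _)
    (((hp.cv hb hpp).integrable hb).const_mul _), integral_const_mul, integral_const_mul,
    integral_cv (hp.integrable hb) (hpp.integrable hb),
    integral_cv (hp.integrable hb) (hp.integrable hb), hε']
  -- With z = ε² the claim is 3z - 2z² - 1 = (1 - 2z)(z - 1).
  linear_combination (3 - 2 * (ε * ε) - 2) * h1

/-- In the commutative algebra under convolution this is the factorization of 3(p² - q²) - 2ε(p³ -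
q³) by p - q. -/
theorem approxId_sub {b : ℝ} (hb : 0 ≤ b) {m : ℕ} {p q : ℝ → ℂ} (hp : Dec b (m + 1) p)
    (hq : Dec b (m + 1) q) (ε : ℂ) :
    cv (p - q) ((3 : ℂ) • (p + q) - (2 * ε) • (cv p p + cv p q + cv q q))
      = approxId ε p - approxId ε q := by
  have hpp := hp.cv hb hp
  have hpq := hp.cv hb hq
  have hqq := hq.cv hb hq
  have hs := (hpp.add hpq).add hqq
  rw [cv_sub_right hb (hp.sub hq) ((hp.add hq).smul _) (hs.smul _), cv_smul_right, cv_smul_right,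
    cv_sub_left hb hp hq (hp.add hq), cv_sub_left hb hp hq hs, cv_add_right hb hp hp hq,
    cv_add_right hb hq hp hq, cv_add_right hb hp (hpp.add hpq) hqq, cv_add_right hb hp hpp hpq,
    cv_add_right hb hq (hpp.add hpq) hqq, cv_add_right hb hq hpp hpq, cv_comm q p,
    cv_left_comm hb hq hp hp, cv_comm q p, cv_left_comm hb hq hp hq]
  simp only [approxId]
  module

theorem diffJet_succ_zero (P : ℕ → ℝ → ℂ) (k : ℕ) :
    diffJet P (k + 1) 0 = dil (2 ^ (k + 1)) (P 0) - dil (2 ^ k) (P 0) := by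
  rw [diffJet, jdil_zero, Pi.sub_apply, jdil_zero, dil_sub, dil_dil, pow_succ']

theorem dualJet_succ_zero (ε : ℂ) (P : ℕ → ℝ → ℂ) (k : ℕ) :
    dualJet ε P (k + 1) 0 = (3 : ℂ) • (dil (2 ^ (k + 1)) (P 0) + dil (2 ^ k) (P 0)) -
      (2 * ε) • (cv (dil (2 ^ (k + 1)) (P 0)) (dil (2 ^ (k + 1)) (P 0)) +
        cv (dil (2 ^ (k + 1)) (P 0)) (dil (2 ^ k) (P 0)) +
        cv (dil (2 ^ k) (P 0)) (dil (2 ^ k) (P 0))) := by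
  have h2 : (0 : ℝ) < 2 ^ k := by positivity
  rw [dualJet, jdil_zero]
  simp only [Pi.sub_apply, Pi.smul_apply, Pi.add_apply, jcv, jdil_zero, dil_sub, dil_smul, dil_add,
    ← cv_dil h2, dil_dil, pow_succ']

theorem Jet.diffJet {b : ℝ} (hb : 0 ≤ b) {m : ℕ} {P : ℕ → ℝ → ℂ} (hP : Jet b (m + 1) P) (k : ℕ) :
    Jet b (m + 1) (diffJet P k) := by
  cases k with
  | zero => exact hP
  | succ k => exact ((hP.jdil hb one_le_two).sub hb hP).jdil hb (one_le_pow₀ one_le_two)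

theorem Jet.dualJet {b : ℝ} (hb : 0 ≤ b) {m : ℕ} {P : ℕ → ℝ → ℂ} (hP : Jet b (m + 1) P) (ε : ℂ)
    (k : ℕ) : Jet b (m + 1) (dualJet ε P k) := by
  have h0 := hP.dec_zero
  have h2 := hP.jdil hb (r := 2) one_le_two
  have hd := h0.dil hb (r := 2) one_le_two
  cases k with
  | zero => exact (hP.smul _).sub hb ((hP.jcv hb h0).smul _)
  | succ k =>
    exact Jet.jdil hb (((h2.add hb hP).smul _).sub hb
      ((((h2.jcv hb hd).add hb (hP.jcv hb hd)).add hb (hP.jcv hb h0)).smul _))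
      (one_le_pow₀ one_le_two)

theorem jdil_one (A : ℕ → ℝ → ℂ) : jdil 1 A = A := by
  funext n
  simp [jdil, dil_one]

theorem FlatMoments.dil {L : ℕ} {a : ℝ → ℂ} (h : FlatMoments L a) {r : ℝ} (hr : 0 < r) :
    FlatMoments L (dil r a) := by
  intro s h1 h2
  rw [moment_dil hr, h s h1 h2, mul_zero]

theorem dyadicFamily_diffJet {b : ℝ} (hb : 0 ≤ b) {L : ℕ} {P : ℕ → ℝ → ℂ} (hP : Jet b (L + 1) P)
    (hm : FlatMoments L (P 0)) : DyadicFamily b L (diffJet P) := by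
  refine ⟨fun k => hP.diffJet hb k, fun k => ?_, fun s hs => ?_⟩
  · simp only [diffJet, pow_zero, jdil_one]
  · have h0 := hP.dec_zero
    rw [diffJet_succ_zero, zero_add, pow_one, pow_zero, dil_one,
      moment_sub hb hs.le (h0.dil hb one_le_two) h0, moment_dil two_pos]
    rcases Nat.eq_zero_or_pos s with rfl | h
    · simp
    · rw [hm s h hs]
      simp

/-- The cubic pays off here: the mean of λ_1 is 3 · 2ε - 2ε · 3ε² = 6ε(1 - ε²) = 0, whereas the
factor p + q arising from p * p alone would have mean 2ε. Moments of orders 1, …, L - 1 vanish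
because `FlatMoments` survives dilation and convolution. -/
theorem dyadicFamily_dualJet {b : ℝ} (hb : 0 ≤ b) {L : ℕ} {P : ℕ → ℝ → ℂ} (hP : Jet b (L + 1) P)
    (hm : FlatMoments L (P 0)) {ε : ℂ} (hε : moment 0 (P 0) = ε) (h1 : ε * ε = 1) :
    DyadicFamily b L (dualJet ε P) := by
  refine ⟨fun k => hP.dualJet hb ε k, fun k => ?_, fun s hs => ?_⟩
  · simp only [dualJet, pow_zero, jdil_one]
  · have h0 := hP.dec_zero
    have hd := h0.dil hb (r := 2) one_le_two
    have f2 := hm.dil (r := 2) two_pos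
    have hpp := hd.cv hb hd
    have hpq := hd.cv hb h0
    have hqq := h0.cv hb h0
    rw [dualJet_succ_zero, zero_add, pow_one, pow_zero, dil_one,
      moment_sub hb hs.le ((hd.add h0).smul _) (((hpp.add hpq).add hqq).smul _), moment_smul,
      moment_smul, moment_add hb hs.le hd h0, moment_add hb hs.le (hpp.add hpq) hqq,
      moment_add hb hs.le hpp hpq]
    rcases Nat.eq_zero_or_pos s with rfl | h
    · have e : ∀ {a c : ℝ → ℂ}, Dec b (L + 1) a → Dec b (L + 1) c →
          moment 0 (cv a c) = moment 0 a * moment 0 c := by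
        intro a c ha hc
        simpa [moment] using integral_cv (ha.integrable hb) (hc.integrable hb)
      rw [e hd hd, e hd h0, e h0 h0, moment_dil two_pos, hε]
      simp only [pow_zero, inv_one, one_mul]
      linear_combination (-6 * ε) * h1
    · rw [f2 s h hs, hm s h hs, f2.cv hb hd hd f2 s h hs, f2.cv hb hd h0 hm s h hs,
        hm.cv hb h0 h0 hm s h hs]
      simp

/-- A telescoping sum by `approxId_sub`. Its initial term is the undilated `approxId`, which is
divisible by p with quotient 3p - 2ε p * p. -/
theorem cv_diffJet_dualJet {b : ℝ} (hb : 0 ≤ b) {m : ℕ} {P : ℕ → ℝ → ℂ} (hP : Jet b (m + 1) P)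
    (ε : ℂ) (N : ℕ) :
    ∑ k ∈ Finset.range (N + 1), cv (diffJet P k 0) (dualJet ε P k 0)
      = dil (2 ^ N) (approxId ε (P 0)) := by
  have h0 := hP.dec_zero
  induction N with
  | zero =>
    rw [zero_add, Finset.sum_range_one, pow_zero, dil_one]
    simp only [diffJet, dualJet, Pi.sub_apply, Pi.smul_apply, jcv, approxId]
    rw [cv_sub_right hb h0 (h0.smul _) ((h0.cv hb h0).smul _), cv_smul_right, cv_smul_right]
  | succ N ih =>
    have e : ∀ k, Dec b (m + 1) (dil (2 ^ k) (P 0)) := fun k =>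
      h0.dil hb (one_le_pow₀ one_le_two)
    rw [Finset.sum_range_succ, ih, diffJet_succ_zero, dualJet_succ_zero,
      approxId_sub hb (e _) (e _), ← dil_approxId (by positivity), ← dil_approxId (by positivity)]
    abel

theorem sum_cv_left {b : ℝ} (hb : 0 ≤ b) {m : ℕ} {a : ℕ → ℝ → ℂ} {c : ℝ → ℂ}
    (ha : ∀ k, Dec b m (a k)) (hc : Dec b m c) (s : Finset ℕ) :
    ∑ k ∈ s, cv (a k) c = cv (∑ k ∈ s, a k) c := by
  funext x
  simp only [Finset.sum_apply, cv, Finset.sum_mul]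
  exact (integral_finsetSum _ fun k _ => (ha k).integrable_cv hb hc x).symm

/-- The factors are reordered so that φ_k stands last: it will be convolved with the functional,
while λ_k * u becomes the kernel acting on the result. -/
theorem sum_cv_cv_eq {b : ℝ} (hb : 0 ≤ b) {m : ℕ} {P : ℕ → ℝ → ℂ} (hP : Jet b (m + 1) P)
    (ε : ℂ) {u : ℝ → ℂ} (hu : Dec b (m + 1) u) (N : ℕ) :
    ∑ k ∈ Finset.range (N + 1), cv (cv (dualJet ε P k 0) u) (diffJet P k 0)
      = cv (dil (2 ^ N) (approxId ε (P 0))) u := by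
  rw [← cv_diffJet_dualJet hb hP ε N, ← sum_cv_left hb (m := m + 1) (fun k => ?_) hu]
  · refine Finset.sum_congr rfl fun k _ => ?_
    rw [cv_comm (cv _ u), cv_assoc hb (hP.diffJet hb k).dec_zero (hP.dualJet hb ε k).dec_zero hu]
  · exact (hP.diffJet hb k).dec_zero.cv hb (hP.dualJet hb ε k).dec_zero

theorem dyadic_ae_eq {ψ : ℝ → ℂ} {P : ℕ → ℝ → ℂ} (h : P 0 =ᵐ[volume] ψ) (k : ℕ) :
    dyadic ψ k =ᵐ[volume] diffJet P k 0 := by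
  cases k with
  | zero =>
    filter_upwards [h] with t ht
    simp [dyadic, diffJet, ht]
  | succ k =>
    have e : dyadic ψ (k + 1) = dil (2 ^ (k + 1)) ψ - dil (2 ^ k) ψ := by
      funext t
      simp only [dyadic, Nat.add_eq_zero_iff, one_ne_zero, and_false, if_false, mother, dil,
        Pi.sub_apply, pow_succ]
      push_cast
      have : (2 : ℝ)⁻¹ * (2 ^ k * 2 * t) = 2 ^ k * t := by ring
      rw [this]
      ring
    rw [e, diffJet_succ_zero]
    filter_upwards [dil_congr (r := 2 ^ (k + 1)) (by positivity) h,
      dil_congr (r := 2 ^ k) (by positivity) h] with t h1 h2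
    simp only [Pi.sub_apply, h1, h2]

/-! ### Representation of functionals by weighted L² densities -/

/-- The tensor weight `∏ᵢ e^{b|xᵢ|} (1 + |xᵢ|)^m`. -/
noncomputable def pwt {d : ℕ} (b : ℝ) (m : ℕ) (x : Fin d → ℝ) : ℝ := ∏ i, wt b m (x i)

theorem pwt_pos {d : ℕ} (b : ℝ) (m : ℕ) (x : Fin d → ℝ) : 0 < pwt b m x :=
  Finset.prod_pos fun i _ => wt_pos b m (x i)

theorem continuous_pwt {d : ℕ} (b : ℝ) (m : ℕ) : Continuous (pwt (d := d) b m) :=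
  continuous_finsetProd _ fun i _ => (continuous_wt b m).comp (continuous_apply i)

theorem pwt_le_mul {d : ℕ} {b : ℝ} (hb : 0 ≤ b) (m : ℕ) (x y : Fin d → ℝ) :
    pwt b m y ≤ pwt b m x * pwt b m (x - y) := by
  unfold pwt
  rw [← Finset.prod_mul_distrib]
  exact Finset.prod_le_prod (fun i _ => (wt_pos _ _ _).le)
    fun i _ => wt_le_mul_wt_sub hb m (x i) (y i)

theorem continuous_expMonomial {d : ℕ} (b : ℝ) (β : Fin d → ℕ) : Continuous (expMonomial b β) := by
  unfold expMonomial
  fun_prop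

theorem abs_expMonomial_le {d : ℕ} (b : ℝ) {m : ℕ} {β : Fin d → ℕ} (hβ : ∀ i, β i ≤ m)
    (x : Fin d → ℝ) : |expMonomial b β x| ≤ pwt b m x := by
  unfold expMonomial pwt
  rw [Finset.mul_sum, Real.exp_sum, ← Finset.prod_mul_distrib, Finset.abs_prod]
  refine Finset.prod_le_prod (fun i _ => abs_nonneg _) fun i _ => ?_
  rw [abs_mul, abs_of_pos (Real.exp_pos _), abs_pow, wt]
  refine mul_le_mul_of_nonneg_left ?_ (Real.exp_pos _).le
  calc |x i| ^ β i ≤ (1 + |x i|) ^ β i := by gcongr; linarith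
    _ ≤ (1 + |x i|) ^ m := pow_le_pow_right₀ (by linarith [abs_nonneg (x i)]) (hβ i)

theorem TestSpace.norm_def {d : ℕ} {b : ℝ} {s : Fin d → ℕ} (φ : TestSpace b s) :
    ‖φ‖ = testNorm b s φ.1 := rfl

/-- The functions `e^{b|x|₁} x^β D^α φ`, `0 ≤ α, β ≤ s`, as elements of `L²`. -/
noncomputable def weightedDerivs {d : ℕ} (b : ℝ) (s : Fin d → ℕ) :
    TestSpace b s →ₗ[ℂ] (Finset.Iic s × Finset.Iic s → Lp ℂ 2 (volume : Measure (Fin d → ℝ))) where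
  toFun φ i := (memLp_weakDeriv φ.2 (Finset.mem_Iic.1 i.1.2) (Finset.mem_Iic.1 i.2.2)).toLp _
  map_add' φ χ := by
    funext i
    obtain ⟨v, h1, -, -⟩ := φ.2 i.1 (Finset.mem_Iic.1 i.1.2)
    obtain ⟨v', h1', -, -⟩ := χ.2 i.1 (Finset.mem_Iic.1 i.1.2)
    rw [Pi.add_apply, ← MemLp.toLp_add, MemLp.toLp_eq_toLp_iff]
    filter_upwards [h1.weakDeriv_ae, h1'.weakDeriv_ae, (h1.add h1').weakDeriv_ae] with x e1 e2 e3
    have e3' : weakDeriv (↑i.1) (φ + χ).1 x = (v + v') x := e3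
    simp only [Pi.add_apply, e1, e2, e3', smul_add]
  map_smul' c φ := by
    funext i
    obtain ⟨v, h1, -, -⟩ := φ.2 i.1 (Finset.mem_Iic.1 i.1.2)
    rw [Pi.smul_apply, RingHom.id_apply, ← MemLp.toLp_const_smul, MemLp.toLp_eq_toLp_iff]
    filter_upwards [h1.weakDeriv_ae, (h1.smul c).weakDeriv_ae] with x e1 e2
    have e2' : weakDeriv (↑i.1) (c • φ).1 x = (c • v) x := e2
    simp only [Pi.smul_apply, e1, e2']
    exact smul_comm _ _ _

theorem norm_eq_sum_weightedDerivs {d : ℕ} {b : ℝ} {s : Fin d → ℕ} (φ : TestSpace b s) :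
    ‖φ‖ = ∑ i, ‖weightedDerivs b s φ i‖ := by
  rw [TestSpace.norm_def, testNorm, Fintype.sum_prod_type, ← Finset.sum_coe_sort]
  refine Finset.sum_congr rfl fun α _ => ?_
  rw [← Finset.sum_coe_sort]
  refine Finset.sum_congr rfl fun β _ => ?_
  exact (Lp.norm_toLp _ (memLp_weakDeriv φ.2 (Finset.mem_Iic.1 α.2) (Finset.mem_Iic.1 β.2))).symm

/-- The test norm is at most a constant times the norm of the tuple of weighted derivatives. Hence f
vanishes on the kernel of `weightedDerivs` (the norm is only a seminorm on functions), descends to a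
bounded functional on its range, and extends by Hahn–Banach. -/
theorem exists_extension {d : ℕ} {b : ℝ} {s : Fin d → ℕ} (f : StrongDual ℂ (TestSpace b s)) :
    ∃ G : StrongDual ℂ (Finset.Iic s × Finset.Iic s → Lp ℂ 2 (volume : Measure (Fin d → ℝ))),
      ∀ φ, G (weightedDerivs b s φ) = f φ := by
  set T := weightedDerivs (d := d) b s
  have hbound : ∀ φ, ‖f φ‖ ≤ (‖f‖ * Fintype.card (Finset.Iic s × Finset.Iic s)) * ‖T φ‖ := by
    intro φ
    refine (f.le_opNorm φ).trans ?_
    rw [mul_assoc]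
    gcongr
    rw [norm_eq_sum_weightedDerivs]
    refine (Finset.sum_le_card_nsmul _ _ ‖T φ‖ fun i _ => norm_le_pi_norm (T φ) i).trans
      (le_of_eq ?_)
    rw [nsmul_eq_mul, Finset.card_univ]
  have hker : LinearMap.ker T ≤ LinearMap.ker (f : TestSpace b s →ₗ[ℂ] ℂ) := by
    intro φ hφ
    have h := hbound φ
    rw [LinearMap.mem_ker.1 hφ, norm_zero, mul_zero] at h
    exact norm_le_zero_iff.1 h
  let g₀ : LinearMap.range T →ₗ[ℂ] ℂ :=
    ((LinearMap.ker T).liftQ (f : TestSpace b s →ₗ[ℂ] ℂ) hker) ∘ₗ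
      (T.quotKerEquivRange.symm : LinearMap.range T →ₗ[ℂ] _)
  have hg₀ : ∀ φ, g₀ ⟨T φ, LinearMap.mem_range_self T φ⟩ = f φ := by
    intro φ
    have : T.quotKerEquivRange.symm ⟨T φ, LinearMap.mem_range_self T φ⟩
        = (LinearMap.ker T).mkQ φ := LinearMap.quotKerEquivRange_symm_apply_image T φ _
    simp only [g₀, LinearMap.comp_apply, LinearEquiv.coe_coe, this]
    simp
  let g : StrongDual ℂ (LinearMap.range T) := g₀.mkContinuous _ (by
    rintro ⟨_, φ, rfl⟩
    rw [hg₀]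
    exact hbound φ)
  obtain ⟨G, hG, -⟩ := exists_extension_norm_eq (LinearMap.range T) g
  exact ⟨G, fun φ => (hG ⟨T φ, LinearMap.mem_range_self T φ⟩).trans (hg₀ φ)⟩

theorem exists_integral_repr {d : ℕ} {b : ℝ} {s : Fin d → ℕ} (f : StrongDual ℂ (TestSpace b s)) :
    ∃ y : Finset.Iic s × Finset.Iic s → Lp ℂ 2 (volume : Measure (Fin d → ℝ)),
      ∀ φ, f φ = ∑ i, ∫ x, weightedDerivs b s φ i x * (starRingEnd ℂ) (y i x) := by
  obtain ⟨G, hG⟩ := exists_extension f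
  let h : ∀ i, StrongDual ℂ (Lp ℂ 2 (volume : Measure (Fin d → ℝ))) := fun i =>
    G ∘L ContinuousLinearMap.single ℂ (fun _ => Lp ℂ 2 (volume : Measure (Fin d → ℝ))) i
  refine ⟨fun i => (InnerProductSpace.toDual ℂ _).symm (h i), fun φ => ?_⟩
  rw [← hG]
  conv_lhs => rw [← Finset.univ_sum_single (weightedDerivs b s φ), map_sum]
  refine Finset.sum_congr rfl fun i _ => ?_
  have h1 : h i (weightedDerivs b s φ i) = G (Pi.single i (weightedDerivs b s φ i)) := rfl
  rw [← h1, ← InnerProductSpace.toDual_symm_apply, L2.inner_def]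
  simp only [RCLike.inner_apply]

theorem memLp_inv_pwt_smul_sum {d : ℕ} {b : ℝ} {m : ℕ} {ι : Type*} (t : Finset ι)
    {β : ι → Fin d → ℕ} (hβ : ∀ j ∈ t, ∀ i, β j i ≤ m) {g : ι → (Fin d → ℝ) → ℂ}
    (hg : ∀ j, MemLp (g j) 2 volume) :
    MemLp (fun x => (pwt b m x)⁻¹ • ∑ j ∈ t, expMonomial b (β j) x • g j x) 2 volume := by
  have : ∀ x, (pwt b m x)⁻¹ • ∑ j ∈ t, expMonomial b (β j) x • g j x
      = ∑ j ∈ t, ((pwt b m x)⁻¹ * expMonomial b (β j) x) • g j x := by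
    intro x
    simp only [Finset.smul_sum, smul_smul]
  simp_rw [this]
  refine memLp_finsetSum (f := fun j x => ((pwt b m x)⁻¹ * expMonomial b (β j) x) • g j x) t
    fun j hj => ?_
  refine (hg j).mono ?_ (Filter.Eventually.of_forall fun x => ?_)
  · exact (((continuous_pwt b m).inv₀ fun x => (pwt_pos b m x).ne').mul
      (continuous_expMonomial b (β j))).aestronglyMeasurable.smul (hg j).1
  · rw [norm_smul, norm_mul, norm_inv, Real.norm_of_nonneg (pwt_pos b m x).le, Real.norm_eq_abs]
    refine mul_le_of_le_one_left (norm_nonneg _) ?_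
    rw [inv_mul_le_iff₀ (pwt_pos b m x), mul_one]
    exact abs_expMonomial_le b (hβ j hj) x

/-- Every functional on `X_b^s`, `s = (m, …, m)`, is `φ ↦ ∑_α ∫ D^α φ U_α` with `U_α` in the
`L²` space with the reciprocal weight. -/
theorem exists_density {d : ℕ} {b : ℝ} {m : ℕ}
    (f : StrongDual ℂ (TestSpace b (fun _ : Fin d => m))) :
    ∃ U : Finset.Iic (fun _ : Fin d => m) → (Fin d → ℝ) → ℂ,
      (∀ α, MemLp (fun x => (pwt b m x)⁻¹ • U α x) 2 volume) ∧
      ∀ (φ : testFunctions b fun _ : Fin d => m) (v : (Fin d → ℕ) → (Fin d → ℝ) → ℂ),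
        (∀ α ≤ fun _ => m, IsWeakDeriv α φ.1 (v α)) →
        f φ = ∑ α : Finset.Iic (fun _ : Fin d => m), ∫ x, v α x * U α x := by
  obtain ⟨y, hy⟩ := exists_integral_repr f
  have hyL : ∀ i, MemLp (fun x => (starRingEnd ℂ) (y i x)) 2 volume := fun i => (Lp.memLp (y i)).star
  refine ⟨fun α x => ∑ β : Finset.Iic (fun _ : Fin d => m), expMonomial b β x • (starRingEnd ℂ) (y (α, β) x), fun α => ?_,
    fun φ v hv => ?_⟩
  · exact memLp_inv_pwt_smul_sum Finset.univ (β := fun β : Finset.Iic (fun _ : Fin d => m) => β.1)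
      (fun β _ i => Finset.mem_Iic.1 β.2 i) fun β => hyL (α, β)
  · refine (hy φ).trans ?_
    rw [Fintype.sum_prod_type]
    refine Finset.sum_congr rfl fun α _ => ?_
    have hα := Finset.mem_Iic.1 α.2
    have hae := (hv α hα).weakDeriv_ae
    have e : ∀ β : Finset.Iic (fun _ : Fin d => m), weightedDerivs b (fun _ : Fin d => m) φ (α, β)
        =ᵐ[volume] fun x => expMonomial b β x • v α x := by
      intro β
      refine (MemLp.coeFn_toLp (memLp_weakDeriv φ.2 hα (Finset.mem_Iic.1 β.2))).trans ?_
      filter_upwards [hae] with x hx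
      rw [hx]
    have hi : ∀ β : Finset.Iic (fun _ : Fin d => m), Integrable fun x =>
        weightedDerivs b (fun _ : Fin d => m) φ (α, β) x * (starRingEnd ℂ) (y (α, β) x) := fun β =>
      (Lp.memLp (weightedDerivs b (fun _ : Fin d => m) φ (α, β))).integrable_mul (hyL (α, β))
    rw [← integral_finsetSum _ fun β _ => hi β]
    refine integral_congr_ae ?_
    have e' := Filter.eventually_all.2 e
    filter_upwards [e'] with x hx
    rw [Finset.mul_sum]
    refine Finset.sum_congr rfl fun β _ => ?_
    rw [hx β, smul_mul_assoc, mul_smul_comm]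

/-! ### Weak derivatives of tensor products -/

/-- Smooth functions of compact support. -/
def IsTest {d : ℕ} (η : (Fin d → ℝ) → ℝ) : Prop := ContDiff ℝ ∞ η ∧ HasCompactSupport η

theorem IsTest.pderiv {d : ℕ} {η : (Fin d → ℝ) → ℝ} (h : IsTest η) (i : Fin d) :
    IsTest (pderiv i η) :=
  ⟨(h.1.fderiv_right (m := ∞) (by simp)).clm_apply contDiff_const,
    h.2.fderiv_apply (𝕜 := ℝ) (Pi.single i 1)⟩

theorem IsTest.iterate_pderiv {d : ℕ} {η : (Fin d → ℝ) → ℝ} (h : IsTest η) (i : Fin d) (n : ℕ) :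
    IsTest ((VBesov.pderiv i)^[n] η) := by
  induction n with
  | zero => exact h
  | succ n ih => rw [Function.iterate_succ_apply']; exact ih.pderiv i

theorem IsTest.foldr {d : ℕ} {η : (Fin d → ℝ) → ℝ} (h : IsTest η) (α : Fin d → ℕ)
    (l : List (Fin d)) : IsTest (l.foldr (fun i g => (VBesov.pderiv i)^[α i] g) η) := by
  induction l with
  | nil => exact h
  | cons i l ih => exact ih.iterate_pderiv i (α i)

theorem IsTest.integrable_smul {d : ℕ} {η : (Fin d → ℝ) → ℝ} (h : IsTest η)
    {u : (Fin d → ℝ) → ℂ} (hu : Integrable u) : Integrable fun x => η x • u x := by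
  obtain ⟨C, hC⟩ := h.2.exists_bound_of_continuous h.1.continuous
  exact hu.bdd_smul C h.1.continuous.aestronglyMeasurable (Filter.Eventually.of_forall hC)

theorem iteratedDeriv_comp_update {d : ℕ} {η : (Fin d → ℝ) → ℝ} (h : IsTest η) (i : Fin d)
    (x : Fin d → ℝ) (n : ℕ) : iteratedDeriv n (fun t => η (Function.update x i t))
      = fun t => (pderiv i)^[n] η (Function.update x i t) := by
  induction n with
  | zero => simp
  | succ n ih =>
    rw [iteratedDeriv_succ, ih]
    funext t
    rw [Function.iterate_succ_apply', pderiv]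
    have hd := ((h.iterate_pderiv i n).1.differentiable (by simp) (Function.update x i t)).hasFDerivAt
    exact (hd.comp_hasDerivAt t (hasDerivAt_update x i t)).deriv

theorem IsTest.contDiff_comp_update {d : ℕ} {η : (Fin d → ℝ) → ℝ} (h : IsTest η) (i : Fin d)
    (x : Fin d → ℝ) : ContDiff ℝ ∞ (fun t => η (Function.update x i t)) :=
  h.1.comp (contDiff_update _ x i)

theorem IsTest.hasCompactSupport_comp_update {d : ℕ} {η : (Fin d → ℝ) → ℝ} (h : IsTest η)
    (i : Fin d) (x : Fin d → ℝ) : HasCompactSupport (fun t => η (Function.update x i t)) := by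
  refine HasCompactSupport.intro (h.2.isCompact.image (continuous_apply i)) fun t ht => ?_
  by_contra hne
  exact ht ⟨Function.update x i t, subset_tsupport _ hne, Function.update_self ..⟩

/-- Fubini isolates the i-th variable. On each line parallel to that axis η restricts to a
one-dimensional test function, to which `IsWeak` applies. -/
theorem integral_iterate_pderiv_smul {d : ℕ} {η : (Fin d → ℝ) → ℝ} (hη : IsTest η) (i : Fin d)
    {n : ℕ} {u v : ℝ → ℂ} (huv : IsWeak n u v) (hu : Integrable u) (hv : Integrable v)
    {c : Fin d → ℝ → ℂ} (hc : ∀ k, Integrable (c k)) :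
    ∫ x, (pderiv i)^[n] η x • ∏ k, Function.update c i u k (x k)
      = (-1 : ℝ) ^ n • ∫ x, η x • ∏ k, Function.update c i v k (x k) := by
  obtain ⟨e, rfl⟩ : ∃ e, d = e + 1 := ⟨d - 1, by have := i.pos; omega⟩
  have hmp := (volume_preserving_piFinSuccAbove (fun _ : Fin (e + 1) => ℝ) i).symm
  set Φ := (MeasurableEquiv.piFinSuccAbove (fun _ : Fin (e + 1) => ℝ) i).symm
  have hΦ : ∀ t y, Φ (t, y) = Function.update (i.insertNth 0 y : Fin (e + 1) → ℝ) i t := by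
    intro t y
    rw [Fin.update_insertNth]
    rfl
  have hint : ∀ {w : ℝ → ℂ}, Integrable w →
      Integrable fun x : Fin (e + 1) → ℝ => ∏ k, Function.update c i w k (x k) := by
    intro w hw
    refine Integrable.fintype_prod fun k => ?_
    rcases eq_or_ne k i with rfl | hk
    · simpa using hw
    · simpa [hk] using hc k
  have hprod : ∀ (w : ℝ → ℂ) (t : ℝ) (y : Fin e → ℝ),
      ∏ k, Function.update c i w k (Φ (t, y) k) = w t * ∏ k, c (i.succAbove k) (y k) := by
    intro w t y
    rw [Fin.prod_univ_succAbove _ i, hΦ]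
    simp [Fin.succAbove_ne]
  have key : ∀ (g : (Fin (e + 1) → ℝ) → ℝ) (w : ℝ → ℂ), IsTest g → Integrable w →
      ∫ x, g x • ∏ k, Function.update c i w k (x k)
        = ∫ y, (∫ t, g (Function.update (i.insertNth 0 y : Fin (e + 1) → ℝ) i t) • w t) *
            ∏ k, c (i.succAbove k) (y k) := by
    intro g w hg hw
    have hi := (hmp.integrable_comp_emb Φ.measurableEmbedding).2 (hg.integrable_smul (hint hw))
    rw [← hmp.integral_comp' (f := Φ), Measure.volume_eq_prod, integral_prod_symm]
    · refine integral_congr_ae (Filter.Eventually.of_forall fun y => ?_)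
      simp only [hprod]
      rw [← integral_mul_const]
      refine integral_congr_ae (Filter.Eventually.of_forall fun t => ?_)
      simp only [hΦ, smul_mul_assoc]
    · exact hi
  rw [key _ _ (hη.iterate_pderiv i n) hu, key _ _ hη hv, ← integral_smul]
  refine integral_congr_ae (Filter.Eventually.of_forall fun y => ?_)
  have h1 := huv _ (hη.contDiff_comp_update i (i.insertNth 0 y))
    (hη.hasCompactSupport_comp_update i (i.insertNth 0 y))
  rw [iteratedDeriv_comp_update hη] at h1
  simp only [h1, smul_mul_assoc]

/-- The outermost derivative is moved first, turning the factor c_i into v_i. The induction runs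
over arbitrary tuples c because this changed tuple enters the next step; without repetitions in the
list, no factor is differentiated twice. -/
theorem integral_foldr_pderiv_smul {d : ℕ} {η : (Fin d → ℝ) → ℝ} (hη : IsTest η)
    (α : Fin d → ℕ) {v : Fin d → ℝ → ℂ} (hv : ∀ k, Integrable (v k)) (l : List (Fin d))
    (hl : l.Nodup) (c : Fin d → ℝ → ℂ) (hc : ∀ k, Integrable (c k))
    (hw : ∀ k ∈ l, IsWeak (α k) (c k) (v k)) :
    ∫ x, l.foldr (fun i g => (pderiv i)^[α i] g) η x • ∏ k, c k (x k)
      = (-1 : ℝ) ^ (l.map α).sum • ∫ x, η x • ∏ k, (if k ∈ l then v k else c k) (x k) := by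
  induction l generalizing c with
  | nil => simp
  | cons i l ih =>
    have hi : i ∉ l := (List.nodup_cons.1 hl).1
    have h1 := integral_iterate_pderiv_smul (hη.foldr α l) i (hw i List.mem_cons_self) (hc i) (hv i) hc
    rw [Function.update_eq_self] at h1
    have h2 := ih (List.nodup_cons.1 hl).2 (Function.update c i (v i)) (fun k => by
      rcases eq_or_ne k i with rfl | hk
      · simpa using hv k
      · simpa [hk] using hc k) (fun k hk => by
      have hki : k ≠ i := fun h => hi (h ▸ hk)
      simpa [hki] using hw k (List.mem_cons_of_mem _ hk))
    rw [List.foldr_cons, h1, h2, smul_smul, ← pow_add, List.map_cons, List.sum_cons]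
    congr 2
    funext x
    congr 1
    refine Finset.prod_congr rfl fun k _ => ?_
    rcases eq_or_ne k i with rfl | hk
    · simp [hi]
    · simp [hk]

theorem isWeakDeriv_prod {d : ℕ} {α : Fin d → ℕ} {u v : Fin d → ℝ → ℂ}
    (hu : ∀ k, Integrable (u k)) (hv : ∀ k, Integrable (v k)) (h : ∀ k, IsWeak (α k) (u k) (v k)) :
    IsWeakDeriv α (fun x => ∏ k, u k (x k)) (fun x => ∏ k, v k (x k)) := by
  refine ⟨(Integrable.fintype_prod hu).locallyIntegrable,
    (Integrable.fintype_prod hv).locallyIntegrable, fun η hη hc => ?_⟩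
  have := integral_foldr_pderiv_smul ⟨hη, hc⟩ α hv (List.finRange d) (List.nodup_finRange d) u hu
    fun k _ => h k
  simp only [List.mem_finRange, if_true] at this
  rw [mixedDeriv, this, Fin.sum_univ_def]

theorem IsWeakDeriv.congr_left {d : ℕ} {α : Fin d → ℕ} {u u' v : (Fin d → ℝ) → ℂ}
    (h : IsWeakDeriv α u v) (hu : u =ᵐ[volume] u') : IsWeakDeriv α u' v := by
  refine ⟨h.1.congr hu, h.2.1, fun η hη hc => ?_⟩
  rw [← h.2.2 η hη hc]
  refine integral_congr_ae ?_
  filter_upwards [hu] with x hx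
  rw [hx]

theorem memLp_pwt_smul_prod {d : ℕ} {b : ℝ} {m : ℕ} {a : Fin d → ℝ → ℂ}
    (ha : ∀ k, Dec b m (a k)) :
    MemLp (fun x : Fin d → ℝ => pwt b m x • ∏ k, a k (x k)) 2 volume := by
  have e : (fun x : Fin d → ℝ => pwt b m x • ∏ k, a k (x k))
      = fun x => ∏ k, wt b m (x k) • a k (x k) := by
    funext x
    simp only [pwt, Complex.real_smul, Complex.ofReal_prod, Finset.prod_mul_distrib]
  have hm : Measurable fun x : Fin d → ℝ => ∏ k, wt b m (x k) • a k (x k) :=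
    Finset.measurable_prod _ fun k _ =>
      ((measurable_wt b m).smul (ha k).1).comp (measurable_pi_apply k)
  rw [e, memLp_two_iff_integrable_sq_norm hm.aestronglyMeasurable]
  simp_rw [norm_prod, ← Finset.prod_pow]
  exact Integrable.fintype_prod (f := fun k t => ‖wt b m t • a k t‖ ^ 2) fun k =>
    (memLp_two_iff_integrable_sq_norm (ha k).2.1).1 (ha k).2

theorem one_le_pwt {d : ℕ} {b : ℝ} (hb : 0 ≤ b) (m : ℕ) (x : Fin d → ℝ) : 1 ≤ pwt b m x :=
  Finset.one_le_prod fun i _ => one_le_wt hb m (x i)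

theorem measurable_prod_comp {d : ℕ} {a : Fin d → ℝ → ℂ} (ha : ∀ k, Measurable (a k)) :
    Measurable fun x : Fin d → ℝ => ∏ k, a k (x k) :=
  Finset.measurable_prod _ fun k _ => (ha k).comp (measurable_pi_apply k)

theorem isWeakDeriv_jet_prod {d : ℕ} {b : ℝ} (hb : 0 ≤ b) {m : ℕ} {B : Fin d → ℕ → ℝ → ℂ}
    (hB : ∀ k, Jet b (m + 1) (B k)) {α : Fin d → ℕ} (hα : α ≤ fun _ => m + 1) :
    IsWeakDeriv α (fun x => ∏ k, B k 0 (x k)) (fun x => ∏ k, B k (α k) (x k)) :=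
  isWeakDeriv_prod (fun k => (hB k).dec_zero.integrable hb)
    (fun k => ((hB k).dec _ (hα k)).integrable hb) fun k => (hB k).weak _ (hα k)

theorem mem_testFunctions_of_jet {d : ℕ} {b : ℝ} (hb : 0 ≤ b) {m : ℕ} {B : Fin d → ℕ → ℝ → ℂ}
    (hB : ∀ k, Jet b (m + 1) (B k)) {g : (Fin d → ℝ) → ℂ}
    (hg : (fun x => ∏ k, B k 0 (x k)) =ᵐ[volume] g) :
    g ∈ testFunctions b (fun _ : Fin d => m + 1) := by
  intro α hα
  have h1 := memLp_pwt_smul_prod fun k => (hB k).dec _ (hα k)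
  have hm := (measurable_prod_comp fun k => ((hB k).dec _ (hα k)).1).aestronglyMeasurable
    (μ := (volume : Measure (Fin d → ℝ)))
  refine ⟨_, (isWeakDeriv_jet_prod hb hB hα).congr_left hg, ?_, fun β hβ => ?_⟩
  · refine h1.mono hm (Filter.Eventually.of_forall fun x => ?_)
    rw [norm_smul, Real.norm_of_nonneg (pwt_pos _ _ _).le]
    exact le_mul_of_one_le_left (norm_nonneg _) (one_le_pwt hb _ x)
  · refine h1.mono ((continuous_expMonomial b β).aestronglyMeasurable.smul hm)
      (Filter.Eventually.of_forall fun x => ?_)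
    rw [norm_smul, norm_smul, Real.norm_of_nonneg (pwt_pos _ _ _).le, Real.norm_eq_abs]
    exact mul_le_mul_of_nonneg_right (abs_expMonomial_le b hβ x) (norm_nonneg _)

theorem comp_sub_ae_eq_jrefl {d : ℕ} {A : Fin d → ℕ → ℝ → ℂ} {g : (Fin d → ℝ) → ℂ}
    (hg : (fun x => ∏ k, A k 0 (x k)) =ᵐ[volume] g) (x : Fin d → ℝ) :
    (fun y => ∏ k, jrefl (x k) (A k) 0 (y k)) =ᵐ[volume] fun y => g (x - y) := by
  filter_upwards [(Measure.measurePreserving_sub_left volume x).quasiMeasurePreserving.ae hg]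
    with y hy
  rw [← hy]
  simp [jrefl]

/-! ### Convolution with a density -/

/-- The convolution of a function with a density. -/
noncomputable def gconv {d : ℕ} (g U : (Fin d → ℝ) → ℂ) (x : Fin d → ℝ) : ℂ :=
  ∫ y, g (x - y) * U y

theorem comp_sub_mem_testFunctions {d : ℕ} {b : ℝ} (hb : 0 ≤ b) {m : ℕ} {A : Fin d → ℕ → ℝ → ℂ}
    (hA : ∀ k, Jet b (m + 1) (A k)) {g : (Fin d → ℝ) → ℂ}
    (hg : (fun x => ∏ k, A k 0 (x k)) =ᵐ[volume] g) (x : Fin d → ℝ) :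
    (fun y => g (x - y)) ∈ testFunctions b (fun _ : Fin d => m + 1) :=
  mem_testFunctions_of_jet hb (fun k => (hA k).jrefl hb (x k)) (comp_sub_ae_eq_jrefl hg x)

/-- There are densities which represent all convolutions of a functional with tensor products. -/
theorem exists_density_conv {d : ℕ} {b : ℝ} (hb : 0 ≤ b) {m : ℕ}
    (f : StrongDual ℂ (TestSpace b (fun _ : Fin d => m + 1))) :
    ∃ U : Finset.Iic (fun _ : Fin d => m + 1) → (Fin d → ℝ) → ℂ,
      (∀ α, MemLp (fun x => (pwt b (m + 1) x)⁻¹ • U α x) 2 volume) ∧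
      ∀ (A : Fin d → ℕ → ℝ → ℂ) (g : (Fin d → ℝ) → ℂ), (∀ k, Jet b (m + 1) (A k)) →
        (fun x => ∏ k, A k 0 (x k)) =ᵐ[volume] g → ∀ x,
        conv g f x = ∑ α : Finset.Iic (fun _ : Fin d => m + 1),
          (∏ k, (-1 : ℂ) ^ α.1 k) * gconv (fun z => ∏ k, A k (α.1 k) (z k)) (U α) x := by
  obtain ⟨U, hU, h⟩ := exists_density f
  refine ⟨U, hU, fun A g hA hg x => ?_⟩
  have hmem := comp_sub_mem_testFunctions hb hA hg x
  rw [conv, dif_pos hmem]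
  refine (h ⟨_, hmem⟩ (fun α y => ∏ k, jrefl (x k) (A k) (α k) (y k)) fun α hα =>
    (isWeakDeriv_jet_prod hb (fun k => (hA k).jrefl hb (x k)) hα).congr_left
      (comp_sub_ae_eq_jrefl hg x)).trans ?_
  refine Finset.sum_congr rfl fun α _ => ?_
  rw [gconv, ← integral_const_mul]
  simp only [jrefl, Finset.prod_mul_distrib, mul_assoc, Pi.sub_apply]

/-- The densities `U` with `U / ∏ᵢ e^{b|xᵢ|} (1 + |xᵢ|)^m ∈ L²`. -/
def IsDensity {d : ℕ} (b : ℝ) (m : ℕ) (U : (Fin d → ℝ) → ℂ) : Prop :=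
  MemLp (fun x => (pwt b m x)⁻¹ • U x) 2 volume

theorem eq_pwt_smul_inv_smul {d : ℕ} (b : ℝ) (m : ℕ) (U : (Fin d → ℝ) → ℂ) (x : Fin d → ℝ) :
    U x = pwt b m x • (pwt b m x)⁻¹ • U x := by
  rw [smul_smul, mul_inv_cancel₀ (pwt_pos b m x).ne', one_smul]

theorem IsDensity.aestronglyMeasurable {d : ℕ} {b : ℝ} {m : ℕ} {U : (Fin d → ℝ) → ℂ}
    (hU : IsDensity b m U) : AEStronglyMeasurable U volume :=
  ((continuous_pwt b m).aestronglyMeasurable.smul hU.1).congr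
    (Filter.Eventually.of_forall fun x => (eq_pwt_smul_inv_smul b m U x).symm)

theorem IsDensity.locallyIntegrable {d : ℕ} {b : ℝ} {m : ℕ} {U : (Fin d → ℝ) → ℂ}
    (hU : IsDensity b m U) : LocallyIntegrable U volume := by
  have h : LocallyIntegrable (fun x => (pwt b m x)⁻¹ • U x) volume :=
    MemLp.locallyIntegrable (p := 2) (show MemLp _ 2 volume from hU) one_le_two
  rw [← locallyIntegrableOn_univ] at h ⊢
  have := h.continuousOn_smul isOpen_univ.isLocallyClosed (continuous_pwt b m).continuousOn
  simpa only [← eq_pwt_smul_inv_smul b m U] using this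

theorem eLpNorm_pwt_comp_sub_le {d : ℕ} {b : ℝ} (hb : 0 ≤ b) (m : ℕ) {g : (Fin d → ℝ) → ℂ}
    (hg : AEStronglyMeasurable (fun y => pwt b m y • g y) volume) (x : Fin d → ℝ) :
    eLpNorm (fun y => pwt b m y • g (x - y)) 2 volume
      ≤ ENNReal.ofReal (pwt b m x) * eLpNorm (fun y => pwt b m y • g y) 2 volume := by
  have hmp := Measure.measurePreserving_sub_left (volume : Measure (Fin d → ℝ)) x
  rw [← eLpNorm_comp_measurePreserving hg hmp]
  refine eLpNorm_le_mul_eLpNorm_of_ae_le_mul (Filter.Eventually.of_forall fun y => ?_) 2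
  simp only [Function.comp_apply]
  rw [norm_smul, norm_smul, Real.norm_of_nonneg (pwt_pos _ _ _).le,
    Real.norm_of_nonneg (pwt_pos _ _ _).le, ← mul_assoc]
  exact mul_le_mul_of_nonneg_right (pwt_le_mul hb m x y) (norm_nonneg _)

theorem mul_eq_inv_pwt_mul {d : ℕ} (b : ℝ) (m : ℕ) (U g : (Fin d → ℝ) → ℂ) :
    (fun y => g y * U y)
      = (fun y => pwt b m y • g y) • fun y => (pwt b m y)⁻¹ • U y := by
  funext y
  have h : (pwt b m y : ℂ) ≠ 0 := by exact_mod_cast (pwt_pos b m y).ne'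
  simp only [Pi.smul_apply', smul_eq_mul, Complex.real_smul, Complex.ofReal_inv]
  field_simp

/-- Cauchy–Schwarz after moving the weight from U to g; reflecting and translating g by x costs the
factor `pwt b m x`. -/
theorem enorm_gconv_le {d : ℕ} {b : ℝ} (hb : 0 ≤ b) {m : ℕ} {U g : (Fin d → ℝ) → ℂ}
    (hU : IsDensity b m U) (hg : AEStronglyMeasurable g volume)
    (x : Fin d → ℝ) :
    ‖gconv g U x‖ₑ ≤ ENNReal.ofReal (pwt b m x) * eLpNorm (fun y => pwt b m y • g y) 2 volume *
      eLpNorm (fun y => (pwt b m y)⁻¹ • U y) 2 volume := by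
  have hw := (continuous_pwt (d := d) b m).aestronglyMeasurable (μ := volume)
  have hgx : AEStronglyMeasurable (fun y => g (x - y)) volume :=
    hg.comp_measurePreserving (Measure.measurePreserving_sub_left volume x)
  refine (enorm_integral_le_lintegral_enorm _).trans ?_
  rw [← eLpNorm_one_eq_lintegral_enorm, mul_eq_inv_pwt_mul b m U fun y => g (x - y)]
  refine (eLpNorm_smul_le_mul_eLpNorm (p := 2) (q := 2) (r := 1) hU.1 (hw.smul hgx)).trans ?_
  gcongr
  exact eLpNorm_pwt_comp_sub_le hb m (hw.smul hg) x

theorem integrable_gconv {d : ℕ} {b : ℝ} (hb : 0 ≤ b) {m : ℕ} {U : (Fin d → ℝ) → ℂ}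
    (hU : IsDensity b m U) {a : Fin d → ℝ → ℂ} (ha : ∀ k, Dec b m (a k)) (x : Fin d → ℝ) :
    Integrable fun y => (∏ k, a k (x k - y k)) * U y := by
  have h := memLp_pwt_smul_prod fun k => (ha k).comp_sub hb (x k)
  rw [mul_eq_inv_pwt_mul b m U fun y => ∏ k, a k (x k - y k)]
  exact memLp_one_iff_integrable.1 (hU.smul (r := 1) h)

theorem exists_norm_gconv_le {d : ℕ} {b : ℝ} (hb : 0 ≤ b) {m : ℕ} {U : (Fin d → ℝ) → ℂ}
    (hU : IsDensity b m U) {a : Fin d → ℝ → ℂ} (ha : ∀ k, Dec b m (a k)) :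
    ∃ C, ∀ x, ‖gconv (fun z => ∏ k, a k (z k)) U x‖ ≤ C * pwt b m x := by
  have h := memLp_pwt_smul_prod ha
  refine ⟨(eLpNorm (fun y => pwt b m y • ∏ k, a k (y k)) 2 volume *
      eLpNorm (fun y => (pwt b m y)⁻¹ • U y) 2 volume).toReal, fun x => ?_⟩
  have hx := enorm_gconv_le hb hU
    (measurable_prod_comp fun k => (ha k).1).aestronglyMeasurable x
  rw [mul_assoc] at hx
  have hfin := (ENNReal.mul_lt_top h.2 hU.2).ne
  have h2 := ENNReal.toReal_mono (ENNReal.mul_ne_top ENNReal.ofReal_ne_top hfin) hx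
  rwa [toReal_enorm, ENNReal.toReal_mul, ENNReal.toReal_ofReal (pwt_pos b m x).le, mul_comm] at h2

theorem gconv_sub {d : ℕ} {U g g' : (Fin d → ℝ) → ℂ} {x : Fin d → ℝ}
    (h : Integrable fun y => g (x - y) * U y) (h' : Integrable fun y => g' (x - y) * U y) :
    gconv (g - g') U x = gconv g U x - gconv g' U x := by
  unfold gconv
  rw [← integral_sub h h']
  simp only [Pi.sub_apply, sub_mul]

theorem continuous_gconv_of_hasCompactSupport {d : ℕ} {U g : (Fin d → ℝ) → ℂ}
    (hU : LocallyIntegrable U volume) (hg : Continuous g) (hc : HasCompactSupport g) :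
    Continuous (gconv g U) := by
  have h := hc.continuous_convolution_right (ContinuousLinearMap.mul ℂ ℂ) hU hg
  have e : gconv g U = convolution U g (ContinuousLinearMap.mul ℂ ℂ) volume := by
    funext x
    simp only [gconv, convolution, ContinuousLinearMap.mul_apply', mul_comm]
  rwa [e]

theorem exists_hasCompactSupport_eLpNorm_pwt_sub_le {d : ℕ} {b : ℝ} {m : ℕ}
    {g : (Fin d → ℝ) → ℂ} (h : MemLp (fun y => pwt b m y • g y) 2 volume) {η : ℝ≥0∞}
    (hη : η ≠ 0) :
    ∃ g' : (Fin d → ℝ) → ℂ, Continuous g' ∧ HasCompactSupport g' ∧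
      eLpNorm (fun y => pwt b m y • (g - g') y) 2 volume ≤ η := by
  obtain ⟨h₀, hc, hle, hcont, -⟩ :=
    h.exists_hasCompactSupport_eLpNorm_sub_le ENNReal.ofNat_ne_top hη
  refine ⟨fun y => (pwt b m y)⁻¹ • h₀ y,
    ((continuous_pwt b m).inv₀ fun y => (pwt_pos b m y).ne').smul hcont,
    hc.mono' (Function.support_subset_iff'.2 fun y hy => ?_), ?_⟩
  · rw [image_eq_zero_of_notMem_tsupport hy, smul_zero]
  refine le_of_eq_of_le ?_ hle
  congr 1
  funext y
  simp only [Pi.sub_apply, smul_sub, smul_smul, mul_inv_cancel₀ (pwt_pos b m y).ne', one_smul]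

theorem integrable_comp_sub_mul_of_hasCompactSupport {d : ℕ} {U g : (Fin d → ℝ) → ℂ}
    (hU : LocallyIntegrable U volume) (hg : Continuous g) (hc : HasCompactSupport g)
    (x : Fin d → ℝ) : Integrable (fun z => g (x - z) * U z) volume := by
  have h := hc.convolutionExists_right (ContinuousLinearMap.mul ℂ ℂ) hU hg x
  refine Integrable.congr h (Filter.Eventually.of_forall fun z => ?_)
  simp only [ContinuousLinearMap.mul_apply', mul_comm]

theorem exists_norm_gconv_sub_le {d : ℕ} {b : ℝ} (hb : 0 ≤ b) {m : ℕ} {U : (Fin d → ℝ) → ℂ}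
    (hU : IsDensity b m U) {a : Fin d → ℝ → ℂ} (ha : ∀ k, Dec b m (a k)) {ε : ℝ} (hε : 0 < ε) :
    ∃ G : (Fin d → ℝ) → ℂ, Continuous G ∧
      ∀ y, ‖gconv (fun z => ∏ k, a k (z k)) U y - G y‖ ≤ ε * pwt b m y := by
  have hgm : AEStronglyMeasurable (fun z : Fin d → ℝ => ∏ k, a k (z k)) volume :=
    (measurable_prod_comp fun k => (ha k).1).aestronglyMeasurable
  -- The added 1 keeps the divisor nonzero when U vanishes.
  have hKt : eLpNorm (fun y => (pwt b m y)⁻¹ • U y) 2 volume + 1 ≠ ⊤ :=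
    ENNReal.add_ne_top.2 ⟨hU.2.ne, ENNReal.one_ne_top⟩
  have hK0 : eLpNorm (fun y => (pwt b m y)⁻¹ • U y) 2 volume + 1 ≠ 0 := by simp
  obtain ⟨g', hg'c, hg's, hle⟩ := exists_hasCompactSupport_eLpNorm_pwt_sub_le
    (memLp_pwt_smul_prod ha)
    (ENNReal.div_pos (ENNReal.ofReal_pos.2 hε).ne' hKt).ne'
  refine ⟨gconv g' U, continuous_gconv_of_hasCompactSupport hU.locallyIntegrable hg'c hg's,
    fun y => ?_⟩
  have hi' : Integrable (fun z => g' (y - z) * U z) volume :=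
    integrable_comp_sub_mul_of_hasCompactSupport hU.locallyIntegrable hg'c hg's y
  have hi : Integrable (fun z => (fun z : Fin d → ℝ => ∏ k, a k (z k)) (y - z) * U z) volume :=
    integrable_gconv hb hU ha y
  have e := gconv_sub (g := fun z => ∏ k, a k (z k)) (g' := g') hi hi'
  rw [← e]
  have h := enorm_gconv_le hb hU (hgm.sub hg'c.aestronglyMeasurable) y
  rw [← ENNReal.ofReal_le_ofReal_iff (by have := pwt_pos b m y; positivity), ofReal_norm,
    mul_comm ε, ENNReal.ofReal_mul (pwt_pos b m y).le]
  refine h.trans ?_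
  rw [mul_assoc]
  gcongr
  calc _ ≤ ENNReal.ofReal ε / (eLpNorm (fun y => (pwt b m y)⁻¹ • U y) 2 volume + 1) *
        (eLpNorm (fun y => (pwt b m y)⁻¹ • U y) 2 volume + 1) :=
        mul_le_mul' hle le_self_add
    _ = ENNReal.ofReal ε := ENNReal.div_mul_cancel hK0 hKt

/-- Continuous compactly supported kernels give continuous convolutions. Approximating the tensor
product by such kernels leaves an error of at most ε times `pwt`, which is uniformly small on the
open set where `pwt` stays below its value at x plus 1. -/
theorem continuous_gconv {d : ℕ} {b : ℝ} (hb : 0 ≤ b) {m : ℕ} {U : (Fin d → ℝ) → ℂ}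
    (hU : IsDensity b m U) {a : Fin d → ℝ → ℂ} (ha : ∀ k, Dec b m (a k)) :
    Continuous (gconv (fun z => ∏ k, a k (z k)) U) := by
  refine continuous_of_locally_uniform_approx_of_continuousAt fun x u hu => ?_
  obtain ⟨ε, hε, hεu⟩ := Metric.mem_uniformity_dist.1 hu
  have hp := pwt_pos b m x
  obtain ⟨G, hG, hle⟩ := exists_norm_gconv_sub_le hb hU ha
    (ε := ε / (pwt b m x + 1)) (by positivity)
  refine ⟨{y | pwt b m y < pwt b m x + 1}, ?_, G, hG.continuousAt, fun y hy => hεu ?_⟩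
  · exact (isOpen_lt (continuous_pwt b m) continuous_const).mem_nhds (by simp)
  · rw [dist_eq_norm]
    refine (hle y).trans_lt ?_
    have hy' : pwt b m y < pwt b m x + 1 := hy
    calc _ < ε / (pwt b m x + 1) * (pwt b m x + 1) := by gcongr
      _ = ε := div_mul_cancel₀ _ (by positivity)

theorem cv_norm_eq (a c : ℝ → ℂ) (t : ℝ) :
    cv (fun s => (‖a s‖ : ℂ)) (fun s => (‖c s‖ : ℂ)) t = ((∫ s, ‖a s * c (t - s)‖ : ℝ) : ℂ) := by
  rw [← integral_complex_ofReal]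
  simp [cv]

/-- Integrating absolute values over the kernel variable first produces the convolutions of |K_k|
with |a_k|, which again lie in `Dec`; the remaining integral is then covered by `integrable_gconv`.
-/
theorem integrable_prod_mul_gconv {d : ℕ} {b : ℝ} (hb : 0 ≤ b) {m : ℕ} {U : (Fin d → ℝ) → ℂ}
    (hU : IsDensity b (m + 1) U) {K a : Fin d → ℝ → ℂ} (hK : ∀ k, Dec b (m + 1) (K k))
    (ha : ∀ k, Dec b (m + 1) (a k)) (x : Fin d → ℝ) :
    Integrable (fun p : (Fin d → ℝ) × (Fin d → ℝ) =>
      (∏ k, K k (p.2 k) * a k (x k - p.1 k - p.2 k)) * U p.1) (volume.prod volume) := by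
  have hm : Measurable fun p : (Fin d → ℝ) × (Fin d → ℝ) =>
      ∏ k, K k (p.2 k) * a k (x k - p.1 k - p.2 k) := by
    refine Finset.measurable_prod _ fun k _ => ?_
    have h1 := (hK k).1
    have h2 := (ha k).1
    fun_prop
  have hms := hm.aestronglyMeasurable (μ := volume.prod volume) |>.mul
    (hU.aestronglyMeasurable.comp_fst (ν := (volume : Measure (Fin d → ℝ))))
  refine (integrable_prod_iff hms).2 ⟨Filter.Eventually.of_forall fun z => ?_, ?_⟩
  · have h : Integrable (fun y : Fin d → ℝ => ∏ k, K k (y k) * a k (x k - z k - y k)) volume :=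
      Integrable.fintype_prod (f := fun k t => K k t * a k (x k - z k - t)) fun k =>
        (hK k).integrable_cv hb (ha k) _
    exact h.mul_const (U z)
  · have h := (integrable_gconv hb hU (fun k => (hK k).norm.cv hb (ha k).norm) x).norm
    refine h.congr (Filter.Eventually.of_forall fun z => ?_)
    simp only [norm_mul, Pi.mul_apply]
    rw [integral_mul_const]
    congr 1
    simp only [norm_prod]
    rw [integral_fintype_prod_volume_eq_prod (fun k t => ‖K k t * a k (x k - z k - t)‖)]
    refine Finset.prod_congr rfl fun k _ => ?_
    rw [cv_norm_eq, Complex.norm_real, Real.norm_of_nonneg (integral_nonneg fun _ => norm_nonneg _)]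

theorem integrable_prod_mul_gconv_comp_sub {d : ℕ} {b : ℝ} (hb : 0 ≤ b) {m : ℕ}
    {U : (Fin d → ℝ) → ℂ} (hU : IsDensity b (m + 1) U) {K a : Fin d → ℝ → ℂ}
    (hK : ∀ k, Dec b (m + 1) (K k)) (ha : ∀ k, Dec b (m + 1) (a k)) (x : Fin d → ℝ) :
    Integrable (fun y : Fin d → ℝ => (∏ k, K k (y k)) *
      gconv (fun z => ∏ k, a k (z k)) U (x - y)) volume ∧
    gconv (fun z => ∏ k, cv (K k) (a k) (z k)) U x
      = ∫ y : Fin d → ℝ, (∏ k, K k (y k)) * gconv (fun z => ∏ k, a k (z k)) U (x - y) := by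
  have hi := integrable_prod_mul_gconv hb hU hK ha x
  have e : ∀ y : Fin d → ℝ, (∏ k, K k (y k)) * gconv (fun z => ∏ k, a k (z k)) U (x - y)
      = ∫ z : Fin d → ℝ, (∏ k, K k (y k) * a k (x k - z k - y k)) * U z := by
    intro y
    rw [gconv, ← integral_const_mul]
    refine integral_congr_ae (Filter.Eventually.of_forall fun z => ?_)
    simp only [Pi.sub_apply, Finset.prod_mul_distrib, sub_right_comm, mul_assoc]
  simp_rw [e]
  refine ⟨hi.integral_prod_right, ?_⟩
  rw [← integral_integral_swap hi, gconv]
  refine integral_congr_ae (Filter.Eventually.of_forall fun z => ?_)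
  simp only [Pi.sub_apply, cv]
  rw [integral_mul_const,
    integral_fintype_prod_volume_eq_prod (fun k t => K k t * a k (x k - z k - t))]

/-! ### Convolution with a functional -/

theorem conv_add {d : ℕ} {b : ℝ} {s : Fin d → ℕ} (f : StrongDual ℂ (TestSpace b s))
    {g g' : (Fin d → ℝ) → ℂ} {x : Fin d → ℝ} (h : (fun y => g (x - y)) ∈ testFunctions b s)
    (h' : (fun y => g' (x - y)) ∈ testFunctions b s) :
    conv (g + g') f x = conv g f x + conv g' f x := by
  have h2 : (fun y => (g + g') (x - y)) ∈ testFunctions b s := (testFunctions b s).add_mem h h'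
  rw [conv, conv, conv, dif_pos h, dif_pos h', dif_pos h2]
  exact f.map_add (⟨_, h⟩ : testFunctions b s) (⟨_, h'⟩ : testFunctions b s)

theorem conv_zero {d : ℕ} {b : ℝ} {s : Fin d → ℕ} (f : StrongDual ℂ (TestSpace b s))
    (x : Fin d → ℝ) : conv (0 : (Fin d → ℝ) → ℂ) f x = 0 := by
  have h2 : (fun y => (0 : (Fin d → ℝ) → ℂ) (x - y)) ∈ testFunctions b s :=
    (testFunctions b s).zero_mem
  rw [conv, dif_pos h2]
  exact f.map_zero

theorem conv_sum {d : ℕ} {b : ℝ} {s : Fin d → ℕ} (f : StrongDual ℂ (TestSpace b s)) {ι : Type*}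
    (t : Finset ι) {g : ι → (Fin d → ℝ) → ℂ} {x : Fin d → ℝ}
    (h : ∀ i ∈ t, (fun y => g i (x - y)) ∈ testFunctions b s) :
    conv (∑ i ∈ t, g i) f x = ∑ i ∈ t, conv (g i) f x := by
  classical
  induction t using Finset.induction_on with
  | empty => exact conv_zero f x
  | insert i t hi ih =>
    have h1 : (fun y => (∑ i ∈ t, g i) (x - y)) ∈ testFunctions b s := by
      have := (testFunctions b s).sum_mem (t := t) (f := fun i y => g i (x - y))
        fun i hi => h i (Finset.mem_insert_of_mem hi)
      convert this using 1
      funext y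
      simp only [Finset.sum_apply]
    rw [Finset.sum_insert hi, Finset.sum_insert hi,
      conv_add f (h i (Finset.mem_insert_self i t)) h1,
      ih fun i hi => h i (Finset.mem_insert_of_mem hi)]

section

variable {d : ℕ} {b : ℝ} {m : ℕ} {A : Fin d → ℕ → ℝ → ℂ}

theorem conv_congr (hb : 0 ≤ b) (f : StrongDual ℂ (TestSpace b (fun _ : Fin d => m + 1)))
    (hA : ∀ k, Jet b (m + 1) (A k)) {g : (Fin d → ℝ) → ℂ}
    (hg : (fun x => ∏ k, A k 0 (x k)) =ᵐ[volume] g) :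
    conv g f = conv (fun x => ∏ k, A k 0 (x k)) f := by
  obtain ⟨U, -, hU⟩ := exists_density_conv hb f
  funext x
  rw [hU A g hA hg x, hU A _ hA (Filter.EventuallyEq.refl _ _) x]

theorem continuous_conv (hb : 0 ≤ b) (f : StrongDual ℂ (TestSpace b (fun _ : Fin d => m + 1)))
    (hA : ∀ k, Jet b (m + 1) (A k)) : Continuous (conv (fun x => ∏ k, A k 0 (x k)) f) := by
  obtain ⟨U, hd, hU⟩ := exists_density_conv hb f
  rw [funext (hU A _ hA (Filter.EventuallyEq.refl _ _))]
  refine continuous_finsetSum _ fun α _ => continuous_const.mul ?_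
  exact continuous_gconv hb (hd α) fun k => (hA k).dec _ (Finset.mem_Iic.1 α.2 k)

theorem exists_norm_conv_le (hb : 0 ≤ b) (f : StrongDual ℂ (TestSpace b (fun _ : Fin d => m + 1)))
    (hA : ∀ k, Jet b (m + 1) (A k)) :
    ∃ C, ∀ x, ‖conv (fun x => ∏ k, A k 0 (x k)) f x‖ ≤ C * pwt b (m + 1) x := by
  obtain ⟨U, hd, hU⟩ := exists_density_conv hb f
  have H : ∀ α : Finset.Iic (fun _ : Fin d => m + 1), ∃ C, ∀ x,
      ‖gconv (fun z => ∏ k, A k (α.1 k) (z k)) (U α) x‖ ≤ C * pwt b (m + 1) x := fun α =>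
    exists_norm_gconv_le hb (hd α) fun k => (hA k).dec _ (Finset.mem_Iic.1 α.2 k)
  choose C hC using H
  refine ⟨∑ α, C α, fun x => ?_⟩
  rw [hU A _ hA (Filter.EventuallyEq.refl _ _), Finset.sum_mul]
  refine (norm_sum_le _ _).trans (Finset.sum_le_sum fun α _ => ?_)
  rw [norm_mul, norm_prod]
  simpa using hC α x

/-- Associativity (K * g) * f = K * (g * f). Derivatives of K * g may all be taken on g, so the
densities reduce it to Fubini for each multi-index. -/
theorem integrable_prod_mul_conv (hb : 0 ≤ b)
    (f : StrongDual ℂ (TestSpace b (fun _ : Fin d => m + 1)))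
    (hA : ∀ k, Jet b (m + 1) (A k)) {K : Fin d → ℝ → ℂ} (hK : ∀ k, Dec b (m + 1) (K k))
    (x : Fin d → ℝ) :
    Integrable (fun y : Fin d → ℝ => (∏ k, K k (y k)) *
      conv (fun x => ∏ k, A k 0 (x k)) f (x - y)) volume ∧
    conv (fun x => ∏ k, cv (K k) (A k 0) (x k)) f x
      = ∫ y : Fin d → ℝ, (∏ k, K k (y k)) * conv (fun x => ∏ k, A k 0 (x k)) f (x - y) := by
  obtain ⟨U, hd, hU⟩ := exists_density_conv hb f
  have h := fun α : Finset.Iic (fun _ : Fin d => m + 1) =>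
    integrable_prod_mul_gconv_comp_sub hb (hd α) hK
      (fun k => (hA k).dec _ (Finset.mem_Iic.1 α.2 k)) x
  have e : (fun y : Fin d → ℝ => (∏ k, K k (y k)) * conv (fun x => ∏ k, A k 0 (x k)) f (x - y))
      = fun y => ∑ α : Finset.Iic (fun _ : Fin d => m + 1), (∏ k, (-1 : ℂ) ^ α.1 k) *
        ((∏ k, K k (y k)) * gconv (fun z => ∏ k, A k (α.1 k) (z k)) (U α) (x - y)) := by
    funext y
    rw [hU A _ hA (Filter.EventuallyEq.refl _ _), Finset.mul_sum]
    exact Finset.sum_congr rfl fun α _ => mul_left_comm _ _ _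
  rw [e]
  refine ⟨integrable_finsetSum _ fun α _ => (h α).1.const_mul _, ?_⟩
  rw [integral_finsetSum _ fun α _ => (h α).1.const_mul _,
    hU (fun k => jcv (K k) (A k)) (fun x => ∏ k, cv (K k) (A k 0) (x k))
      (fun k => (hA k).jcv hb (hK k)) (Filter.EventuallyEq.refl _ _)]
  refine Finset.sum_congr rfl fun α _ => ?_
  rw [integral_const_mul, ← (h α).2]
  rfl

end

/-! ### Approximate identity and reproducing formula -/

/-- Contraction by at least 2 frees a factor e^{b|t|/2}, which absorbs one power of the polynomial:
1 + s ≤ (1 + b⁻¹)(1 + bs) ≤ (1 + b⁻¹) e^{bs} with s = |t|/2. This repays the power lost in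
`Dec.integrable_wt` and yields an integrable majorant for the approximate identity. -/
theorem wt_half_le {b : ℝ} (hb : 0 < b) (m : ℕ) {r : ℝ} (hr : 2 ≤ r) (t : ℝ) :
    wt b (m + 1) (r⁻¹ * t) ≤ (1 + b⁻¹) * wt b m t := by
  have h1 : |r⁻¹ * t| ≤ |2⁻¹ * t| := by
    rw [abs_mul, abs_mul, abs_of_pos (by positivity : (0 : ℝ) < r⁻¹),
      abs_of_pos (by norm_num : (0 : ℝ) < 2⁻¹)]
    gcongr
  refine (wt_mono_right hb.le (m + 1) h1).trans ?_
  unfold wt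
  rw [abs_mul, abs_of_pos (by norm_num : (0 : ℝ) < 2⁻¹)]
  have ht := abs_nonneg t
  have h2 : 1 + 2⁻¹ * |t| ≤ (1 + b⁻¹) * Real.exp (b * (2⁻¹ * |t|)) := by
    calc 1 + 2⁻¹ * |t| ≤ (1 + b⁻¹) * (b * (2⁻¹ * |t|) + 1) := by
          have : (1 + b⁻¹) * (b * (2⁻¹ * |t|) + 1) = 1 + 2⁻¹ * |t| + (b * (2⁻¹ * |t|) + b⁻¹) := by
            field_simp
            ring
          rw [this]
          have : 0 ≤ b * (2⁻¹ * |t|) + b⁻¹ := by positivity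
          linarith
      _ ≤ _ := by
        gcongr
        exact Real.add_one_le_exp _
  have h3 : (1 + 2⁻¹ * |t|) ^ m ≤ (1 + |t|) ^ m := by
    gcongr
    linarith
  calc Real.exp (b * (2⁻¹ * |t|)) * (1 + 2⁻¹ * |t|) ^ (m + 1)
      = Real.exp (b * (2⁻¹ * |t|)) * (1 + 2⁻¹ * |t|) ^ m * (1 + 2⁻¹ * |t|) := by ring
    _ ≤ Real.exp (b * (2⁻¹ * |t|)) * (1 + |t|) ^ m *
        ((1 + b⁻¹) * Real.exp (b * (2⁻¹ * |t|))) := by gcongr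
    _ = (1 + b⁻¹) * (Real.exp (b * (2⁻¹ * |t|)) * Real.exp (b * (2⁻¹ * |t|)) *
        (1 + |t|) ^ m) := by ring
    _ = _ := by
      rw [← Real.exp_add]
      ring_nf

theorem integral_prod_dil_mul {d : ℕ} (h : Fin d → ℝ → ℂ) (F : (Fin d → ℝ) → ℂ) {r : ℝ}
    (hr : 0 < r) (x : Fin d → ℝ) :
    ∫ y : Fin d → ℝ, (∏ k, dil r (h k) (y k)) * F (x - y)
      = ∫ u : Fin d → ℝ, (∏ k, h k (u k)) * F (x - r⁻¹ • u) := by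
  have e := Measure.integral_comp_smul (volume : Measure (Fin d → ℝ))
    (fun u => (∏ k, h k (u k)) * F (x - r⁻¹ • u)) r
  rw [Module.finrank_fin_fun, abs_of_pos (by positivity)] at e
  have e2 : ∀ y : Fin d → ℝ, (∏ k, dil r (h k) (y k)) * F (x - y)
      = (r : ℂ) ^ d * ((∏ k, h k ((r • y) k)) * F (x - r⁻¹ • r • y)) := by
    intro y
    rw [inv_smul_smul₀ hr.ne']
    simp only [dil, Finset.prod_mul_distrib, Finset.prod_const, Finset.card_univ, Fintype.card_fin,
      Pi.smul_apply, smul_eq_mul, mul_assoc]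
  simp_rw [e2]
  rw [integral_const_mul, e, Complex.real_smul]
  have : (r : ℂ) ≠ 0 := by exact_mod_cast hr.ne'
  push_cast
  rw [← mul_assoc, mul_inv_cancel₀ (pow_ne_zero _ this), one_mul]

/-- Dilates of tensor products of integral one are an approximate identity on continuous functions
of exponential growth. -/
theorem tendsto_integral_prod_dil_mul {d : ℕ} {b : ℝ} (hb : 0 < b) {m : ℕ} {h : Fin d → ℝ → ℂ}
    (hd : ∀ k, Dec b (m + 1) (h k)) (h1 : ∀ k, ∫ t, h k t = 1) {F : (Fin d → ℝ) → ℂ}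
    (hF : Continuous F) {C : ℝ} (hC : ∀ x, ‖F x‖ ≤ C * pwt b (m + 1) x) (x : Fin d → ℝ) :
    Filter.Tendsto (fun N : ℕ => ∫ y : Fin d → ℝ, (∏ k, dil (2 ^ N) (h k) (y k)) * F (x - y))
      Filter.atTop (nhds (F x)) := by
  have hlim : F x = ∫ u : Fin d → ℝ, (∏ k, h k (u k)) * F x := by
    rw [integral_mul_const, integral_fintype_prod_volume_eq_prod]
    simp [h1]
  rw [hlim]
  have hpx := pwt_pos b (m + 1) x
  have hC0 : 0 ≤ C := by
    by_contra hneg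
    have := (norm_nonneg _).trans (hC x)
    nlinarith
  have hint : Integrable (fun u : Fin d → ℝ => ∏ k, ((1 + b⁻¹) * ‖wt b m (u k) • h k (u k)‖))
      volume :=
    Integrable.fintype_prod (f := fun k t => (1 + b⁻¹) * ‖wt b m t • h k t‖) fun k =>
      (hd k).integrable_wt.norm.const_mul _
  -- After the substitution u = 2^N y, N occurs only in the argument of F, and dominated convergence
  -- applies.
  refine Filter.Tendsto.congr' (f₁ := fun N : ℕ => ∫ u : Fin d → ℝ,
    (∏ k, h k (u k)) * F (x - ((2 : ℝ) ^ N)⁻¹ • u))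
    (Filter.Eventually.of_forall fun N => (integral_prod_dil_mul h F (by positivity) x).symm) ?_
  refine tendsto_integral_filter_of_dominated_convergence _ (Filter.Eventually.of_forall fun N => ?_)
    ?_ (hint.const_mul (C * pwt b (m + 1) x)) (Filter.Eventually.of_forall fun u => ?_)
  · exact ((measurable_prod_comp fun k => (hd k).1).aestronglyMeasurable).mul
      (hF.comp (by fun_prop)).aestronglyMeasurable
  -- N ≥ 1 gives the contraction factor of at least 2 required by `wt_half_le`.
  · filter_upwards [Filter.eventually_ge_atTop 1] with N hN
    refine Filter.Eventually.of_forall fun u => ?_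
    have h2 : (2 : ℝ) ≤ 2 ^ N := by
      calc (2 : ℝ) = 2 ^ 1 := by norm_num
        _ ≤ 2 ^ N := pow_le_pow_right₀ one_le_two hN
    have hp : pwt b (m + 1) (x - ((2 : ℝ) ^ N)⁻¹ • u)
        ≤ pwt b (m + 1) x * ∏ k, ((1 + b⁻¹) * wt b m (u k)) := by
      refine (pwt_le_mul hb.le (m + 1) x _).trans ?_
      rw [sub_sub_cancel]
      refine mul_le_mul_of_nonneg_left ?_ hpx.le
      exact Finset.prod_le_prod (fun k _ => (wt_pos _ _ _).le) fun k _ => wt_half_le hb m h2 _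
    rw [norm_mul, norm_prod]
    calc (∏ k, ‖h k (u k)‖) * ‖F (x - ((2 : ℝ) ^ N)⁻¹ • u)‖
        ≤ (∏ k, ‖h k (u k)‖) * (C * (pwt b (m + 1) x * ∏ k, ((1 + b⁻¹) * wt b m (u k)))) := by
          refine mul_le_mul_of_nonneg_left ((hC _).trans ?_)
            (Finset.prod_nonneg fun _ _ => norm_nonneg _)
          exact mul_le_mul_of_nonneg_left hp hC0
      _ = C * pwt b (m + 1) x * ((∏ k, ((1 + b⁻¹) * wt b m (u k))) * ∏ k, ‖h k (u k)‖) := by ring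
      _ = _ := by
        rw [← Finset.prod_mul_distrib]
        congr 1
        refine Finset.prod_congr rfl fun k _ => ?_
        rw [norm_smul, Real.norm_of_nonneg (wt_pos _ _ _).le, mul_assoc]
  · refine Filter.Tendsto.mul tendsto_const_nhds ?_
    have ht : Filter.Tendsto (fun N : ℕ => ((2 : ℝ) ^ N)⁻¹) Filter.atTop (nhds 0) :=
      tendsto_inv_atTop_zero.comp (tendsto_pow_atTop_atTop_of_one_lt one_lt_two)
    have h2 : Filter.Tendsto (fun N : ℕ => x - ((2 : ℝ) ^ N)⁻¹ • u) Filter.atTop (nhds x) := by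
      have := tendsto_const_nhds (x := x) |>.sub (ht.smul_const u)
      simpa using this
    exact (hF.tendsto x).comp h2

/-- The Calderón reproducing formula: a convolution with a tensor product is the limit of sums over
boxes of convolutions with the dyadic tensor products. -/
theorem tendsto_sum_integral_conv {d : ℕ} {b : ℝ} (hb : 0 < b) {m : ℕ}
    (f : StrongDual ℂ (TestSpace b (fun _ : Fin d => m + 1))) {P B : Fin d → ℕ → ℝ → ℂ}
    (hP : ∀ i, Jet b (m + 1) (P i)) (hB : ∀ i, Jet b (m + 1) (B i)) {ε : Fin d → ℂ}
    (hε : ∀ i, moment 0 (P i 0) = ε i) (h1 : ∀ i, ε i * ε i = 1) (x : Fin d → ℝ) :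
    Filter.Tendsto (fun N : ℕ => ∑ κ ∈ Fintype.piFinset fun _ : Fin d => Finset.range (N + 1),
      ∫ y : Fin d → ℝ, (∏ i, cv (dualJet (ε i) (P i) (κ i) 0) (B i 0) (y i)) *
        conv (fun z => ∏ i, diffJet (P i) (κ i) 0 (z i)) f (x - y))
      Filter.atTop (nhds (conv (fun z => ∏ i, B i 0 (z i)) f x)) := by
  obtain ⟨C, hC⟩ := exists_norm_conv_le hb.le f hB
  have hdec := fun i => (hP i).dec_zero.approxId hb.le (ε i)
  refine (tendsto_integral_prod_dil_mul hb hdec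
    (fun i => integral_approxId hb.le (hP i).dec_zero (hε i) (h1 i))
    (continuous_conv hb.le f hB) hC x).congr fun N => ?_
  have hK : ∀ (κ : Fin d → ℕ) i, Dec b (m + 1) (cv (dualJet (ε i) (P i) (κ i) 0) (B i 0)) :=
    fun κ i => ((hP i).dualJet hb.le (ε i) (κ i)).dec_zero.cv hb.le (hB i).dec_zero
  rw [← (integrable_prod_mul_conv hb.le f hB
    (fun i => (hdec i).dil hb.le (one_le_pow₀ one_le_two)) x).2]
  -- Expanding the product over i of the one-dimensional telescoping sums gives the sum over the box
  -- of indices κ.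
  have e : (fun z : Fin d → ℝ => ∏ i, cv (dil (2 ^ N) (approxId (ε i) (P i 0))) (B i 0) (z i))
      = ∑ κ ∈ Fintype.piFinset fun _ : Fin d => Finset.range (N + 1), fun z : Fin d → ℝ =>
        ∏ i, cv (cv (dualJet (ε i) (P i) (κ i) 0) (B i 0)) (diffJet (P i) (κ i) 0) (z i) := by
    funext z
    rw [Finset.sum_apply, ← Finset.prod_univ_sum (fun _ => Finset.range (N + 1)) fun i k =>
      cv (cv (dualJet (ε i) (P i) k 0) (B i 0)) (diffJet (P i) k 0) (z i)]
    refine Finset.prod_congr rfl fun i _ => ?_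
    rw [← sum_cv_cv_eq hb.le (hP i) (ε i) (hB i).dec_zero N, Finset.sum_apply]
  rw [e, conv_sum]
  · refine Finset.sum_congr rfl fun κ _ => ?_
    exact (integrable_prod_mul_conv hb.le f (fun i => (hP i).diffJet hb.le (κ i)) (hK κ) x).2
  · intro κ _
    exact comp_sub_mem_testFunctions hb.le
      (fun i => ((hP i).diffJet hb.le (κ i)).jcv hb.le (hK κ i)) (Filter.EventuallyEq.refl _ _) x

/-! ### Young's inequality in L^p(w dx) -/

/-- The measure `w dx`. -/
noncomputable abbrev wMeasure {d : ℕ} (w : (Fin d → ℝ) → ℝ) : Measure (Fin d → ℝ) :=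
  volume.withDensity fun x => ENNReal.ofReal (w x)

theorem IsExpWeight.aemeasurable {d : ℕ} {w : (Fin d → ℝ) → ℝ} {c : ℝ} (hw : IsExpWeight w c) :
    AEMeasurable (fun x => ENNReal.ofReal (w x)) volume :=
  hw.locallyIntegrable.aestronglyMeasurable.aemeasurable.ennreal_ofReal

theorem IsExpWeight.absolutelyContinuous {d : ℕ} {w : (Fin d → ℝ) → ℝ} {c : ℝ}
    (hw : IsExpWeight w c) : volume ≪ wMeasure w :=
  withDensity_absolutelyContinuous' hw.aemeasurable
    (Filter.Eventually.of_forall fun x => (ENNReal.ofReal_pos.2 (hw.pos x)).ne')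

theorem IsExpWeight.exists_lintegral_comp_sub_le {d : ℕ} {w : (Fin d → ℝ) → ℝ} {c : ℝ}
    (hw : IsExpWeight w c) : ∃ C : ℝ, 0 < C ∧ ∀ (G : (Fin d → ℝ) → ℝ≥0∞), Measurable G → ∀ y,
      ∫⁻ x, G (x - y) ∂wMeasure w
        ≤ ENNReal.ofReal (C * Real.exp (c * ∑ i, |y i|)) * ∫⁻ x, G x ∂wMeasure w := by
  obtain ⟨C, hC, h⟩ := hw.growth
  refine ⟨C, hC, fun G hG y => ?_⟩
  have hGy : Measurable fun x => G (x - y) := hG.comp (measurable_id.sub_const y)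
  rw [lintegral_withDensity_eq_lintegral_mul₀ hw.aemeasurable hGy.aemeasurable,
    lintegral_withDensity_eq_lintegral_mul₀ hw.aemeasurable hG.aemeasurable,
    ← lintegral_const_mul' _ _ ENNReal.ofReal_ne_top,
    ← lintegral_sub_right_eq_self (fun x => ENNReal.ofReal (C * Real.exp (c * ∑ i, |y i|)) *
      ((fun x => ENNReal.ofReal (w x)) * G) x) y]
  refine lintegral_mono fun x => ?_
  simp only [Pi.mul_apply]
  rw [← mul_assoc, ← ENNReal.ofReal_mul (by positivity)]
  gcongr
  refine (h x y).trans (le_of_eq ?_)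
  ring

theorem lintegral_prod_enorm_mul_exp {d : ℕ} (b : ℝ) {K : Fin d → ℝ → ℂ}
    (hK : ∀ i, Measurable (K i)) :
    ∫⁻ y : Fin d → ℝ, (∏ i, ‖K i (y i)‖ₑ) * ENNReal.ofReal (Real.exp (b * ∑ i, |y i|))
      = ∏ i, expNorm b (K i) := by
  unfold expNorm
  rw [← lintegral_fintype_prod (f := fun i t => ‖K i t‖ₑ * ENNReal.ofReal (wt b 0 t))
    fun i => (hK i).enorm.mul (continuous_wt b 0).measurable.ennreal_ofReal]
  refine lintegral_congr fun y => ?_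
  rw [Finset.prod_mul_distrib, ← ENNReal.ofReal_prod_of_nonneg fun i _ => (wt_pos b 0 _).le]
  congr 2
  simp only [wt, pow_zero, mul_one]
  rw [Finset.mul_sum, Real.exp_sum]

/-- Young's inequality in `L^p(w dx)` for kernels of tensor product form. -/
theorem IsExpWeight.exists_eLpNorm_integral_le {d : ℕ} {w : (Fin d → ℝ) → ℝ} {b c : ℝ}
    (hw : IsExpWeight w c) (hb : 0 < b) {p : ℝ≥0∞} (hp : 1 ≤ p)
    (hcb : ENNReal.ofReal c / p < ENNReal.ofReal b) :
    ∃ C : ℝ, 0 < C ∧ ∀ (K : Fin d → ℝ → ℂ) (F : (Fin d → ℝ) → ℂ), (∀ i, Measurable (K i)) →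
      Measurable F → eLpNorm (fun x => ∫ y : Fin d → ℝ, (∏ i, K i (y i)) * F (x - y)) p (wMeasure w)
        ≤ ENNReal.ofReal C * (∏ i, expNorm b (K i)) * eLpNorm F p (wMeasure w) := by
  have hle : ∀ (K : Fin d → ℝ → ℂ) (F : (Fin d → ℝ) → ℂ) x,
      ‖∫ y : Fin d → ℝ, (∏ i, K i (y i)) * F (x - y)‖ₑ
        ≤ ∫⁻ y : Fin d → ℝ, (∏ i, ‖K i (y i)‖ₑ) * ‖F (x - y)‖ₑ := by
    intro K F x
    refine (enorm_integral_le_lintegral_enorm _).trans (le_of_eq ?_)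
    refine lintegral_congr fun y => ?_
    rw [enorm_mul]
    congr 1
    simp only [enorm_eq_nnnorm, nnnorm_prod, ENNReal.ofNNReal_finsetProd]
  -- For p = ∞ the weight enters only through null sets, and e^{b|y|} ≥ 1 bounds the L¹ norm of the
  -- kernel.
  rcases eq_or_ne p ⊤ with rfl | hpt
  · refine ⟨1, one_pos, fun K F hK hF => ?_⟩
    rw [ENNReal.ofReal_one, one_mul]
    simp only [eLpNorm_exponent_top]
    refine eLpNormEssSup_le_of_ae_enorm_bound (Filter.Eventually.of_forall fun x => ?_)
    refine (hle K F x).trans ?_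
    have h1 : ∀ᵐ z ∂(volume : Measure (Fin d → ℝ)), ‖F z‖ₑ ≤ eLpNormEssSup F (wMeasure w) :=
      hw.absolutelyContinuous.ae_le (enorm_ae_le_eLpNormEssSup F _)
    have h2 := (Measure.measurePreserving_sub_left
      (volume : Measure (Fin d → ℝ)) x).quasiMeasurePreserving.ae h1
    rw [← lintegral_prod_enorm_mul_exp b hK, ← lintegral_mul_const _ (by
      have := fun i => (hK i).enorm
      fun_prop)]
    refine lintegral_mono_ae ?_
    filter_upwards [h2] with y hy
    gcongr
    refine le_mul_of_one_le_right zero_le ?_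
    rw [← ENNReal.ofReal_one]
    exact ENNReal.ofReal_le_ofReal (Real.one_le_exp
      (mul_nonneg hb.le (Finset.sum_nonneg fun _ _ => abs_nonneg _)))
  · have hp0 : p ≠ 0 := (zero_lt_one.trans_le hp).ne'
    have hr : 1 ≤ p.toReal := by
      rw [← ENNReal.toReal_one]
      exact ENNReal.toReal_mono hpt hp
    have hr0 : 0 < p.toReal := by linarith
    -- Translation by y costs (C e^{c|y|₁})^{1/p} on L^p(w dx), and c ≤ bp bounds this by C^{1/p}
    -- e^{b|y|₁}.
    have hcr : c ≤ b * p.toReal := by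
      have h1 : ENNReal.ofReal c ≤ ENNReal.ofReal b * p :=
        (ENNReal.div_le_iff hp0 hpt).1 hcb.le
      rw [← ENNReal.ofReal_toReal hpt, ← ENNReal.ofReal_mul hb.le] at h1
      exact (ENNReal.ofReal_le_ofReal_iff (by positivity)).1 h1
    obtain ⟨C, hC, h⟩ := hw.exists_lintegral_comp_sub_le
    refine ⟨C ^ (1 / p.toReal), by positivity, fun K F hK hF => ?_⟩
    rw [eLpNorm_eq_lintegral_rpow_enorm_toReal hp0 hpt,
      eLpNorm_eq_lintegral_rpow_enorm_toReal hp0 hpt]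
    have hk : Measurable fun y : Fin d → ℝ => ∏ i, ‖K i (y i)‖ₑ := by
      have := fun i => (hK i).enorm
      fun_prop
    have hA : Measurable fun y : Fin d → ℝ => ENNReal.ofReal (C ^ (1 / p.toReal)) *
        ENNReal.ofReal (Real.exp (b * ∑ i, |y i|)) := by fun_prop
    have key := lintegral_conv_rpow_le (μ := wMeasure w) (ν := volume) hk hF.enorm hA
      (fun y => mul_ne_zero (ENNReal.ofReal_pos.2 (by positivity)).ne'
        (ENNReal.ofReal_pos.2 (by positivity)).ne')
      (fun y => ENNReal.mul_ne_top ENNReal.ofReal_ne_top ENNReal.ofReal_ne_top) hr fun y => by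
        refine (h (fun x => ‖F x‖ₑ ^ p.toReal) (hF.enorm.pow_const _) y).trans ?_
        gcongr
        rw [← ENNReal.ofReal_mul (by positivity), ENNReal.ofReal_rpow_of_nonneg (by positivity)
          hr0.le, Real.mul_rpow (by positivity) (by positivity), ← Real.rpow_mul hC.le,
          one_div_mul_cancel hr0.ne', Real.rpow_one, ← Real.exp_mul]
        refine ENNReal.ofReal_le_ofReal ?_
        refine mul_le_mul_of_nonneg_left (Real.exp_le_exp.2 ?_) hC.le
        rw [mul_right_comm]
        exact mul_le_mul_of_nonneg_right hcr (Finset.sum_nonneg fun _ _ => abs_nonneg _)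
    refine (ENNReal.rpow_le_rpow (lintegral_mono fun x =>
      ENNReal.rpow_le_rpow (hle K F x) hr0.le) (by positivity)).trans ?_
    refine (ENNReal.rpow_le_rpow key (by positivity)).trans (le_of_eq ?_)
    rw [ENNReal.mul_rpow_of_nonneg _ _ (by positivity), ← ENNReal.rpow_mul,
      mul_one_div_cancel hr0.ne', ENNReal.rpow_one, ← lintegral_prod_enorm_mul_exp b hK,
      ← lintegral_const_mul' _ _ ENNReal.ofReal_ne_top]
    congr 1
    refine lintegral_congr fun y => mul_left_comm _ _ _

/-! ### Sequence norms, Schur's test and geometric sums -/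

/-- The norm of `ℓ^q`, as an element of `[0, ∞]`. -/
noncomputable def seqNorm {ι : Type*} (q : ℝ≥0∞) (a : ι → ℝ≥0∞) : ℝ≥0∞ :=
  if q = ⊤ then ⨆ j, a j else (∑' j, a j ^ q.toReal) ^ (1 / q.toReal)

theorem seqNorm_mono {ι : Type*} (q : ℝ≥0∞) {a a' : ι → ℝ≥0∞} (h : ∀ j, a j ≤ a' j) :
    seqNorm q a ≤ seqNorm q a' := by
  unfold seqNorm
  split_ifs with hq
  · exact iSup_mono h
  · exact ENNReal.rpow_le_rpow (ENNReal.tsum_le_tsum fun j =>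
      ENNReal.rpow_le_rpow (h j) ENNReal.toReal_nonneg) (by positivity)

theorem tsum_mul_rpow_le {ι : Type*} (k g : ι → ℝ≥0∞) {r : ℝ} (hr : 1 ≤ r) :
    (∑' i, k i * g i) ^ r ≤ (∑' i, k i) ^ (r - 1) * ∑' i, k i * g i ^ r := by
  let _ : MeasurableSpace ι := ⊤
  have h := lintegral_mul_rpow_le (ν := (Measure.count : Measure ι)) (k := k) (g := g)
    Measurable.of_discrete.aemeasurable Measurable.of_discrete.aemeasurable hr
  simpa only [lintegral_count] using h

/-- Schur's test in `ℓ^q`. -/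
theorem seqNorm_tsum_mul_le {ι : Type*} {q : ℝ≥0∞} (hq : 1 ≤ q) {K : ι → ι → ℝ≥0∞} {S : ℝ≥0∞}
    (h1 : ∀ j, ∑' k, K j k ≤ S) (h2 : ∀ k, ∑' j, K j k ≤ S) (a : ι → ℝ≥0∞) :
    seqNorm q (fun j => ∑' k, K j k * a k) ≤ S * seqNorm q a := by
  unfold seqNorm
  split_ifs with hqt
  · refine iSup_le fun j => ?_
    calc ∑' k, K j k * a k ≤ ∑' k, K j k * ⨆ i, a i :=
          ENNReal.tsum_le_tsum fun k => mul_le_mul_right (le_iSup a k) _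
      _ = (∑' k, K j k) * ⨆ i, a i := ENNReal.tsum_mul_right
      _ ≤ _ := mul_le_mul_left (h1 j) _
  · have hr : 1 ≤ q.toReal := by
      rw [← ENNReal.toReal_one]
      exact ENNReal.toReal_mono hqt hq
    have hr0 : 0 < q.toReal := by linarith
    have key : ∑' j, (∑' k, K j k * a k) ^ q.toReal ≤ S ^ q.toReal * ∑' k, a k ^ q.toReal := by
      calc ∑' j, (∑' k, K j k * a k) ^ q.toReal
          ≤ ∑' j, S ^ (q.toReal - 1) * ∑' k, K j k * a k ^ q.toReal := by
            refine ENNReal.tsum_le_tsum fun j => (tsum_mul_rpow_le (K j) a hr).trans ?_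
            exact mul_le_mul_left (ENNReal.rpow_le_rpow (h1 j) (by linarith)) _
        _ = S ^ (q.toReal - 1) * ∑' k, (∑' j, K j k) * a k ^ q.toReal := by
            rw [ENNReal.tsum_mul_left, ENNReal.tsum_comm]
            simp only [ENNReal.tsum_mul_right]
        _ ≤ S ^ (q.toReal - 1) * ∑' k, S * a k ^ q.toReal := by
            refine mul_le_mul_right (ENNReal.tsum_le_tsum fun k => ?_) _
            exact mul_le_mul_left (h2 k) _
        _ = _ := by
            rw [ENNReal.tsum_mul_left, ← mul_assoc]
            congr 1
            nth_rewrite 2 [← ENNReal.rpow_one S]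
            rw [← ENNReal.rpow_add_of_nonneg _ _ (by linarith) zero_le_one, sub_add_cancel]
    refine (ENNReal.rpow_le_rpow key (by positivity)).trans (le_of_eq ?_)
    rw [ENNReal.mul_rpow_of_nonneg _ _ (by positivity), ← ENNReal.rpow_mul,
      mul_one_div_cancel hr0.ne', ENNReal.rpow_one]

theorem tsum_prod_eq_prod_tsum {α : Type*} {d : ℕ} (f : Fin d → α → ℝ≥0∞) :
    ∑' κ : Fin d → α, ∏ i, f i (κ i) = ∏ i, ∑' k, f i k := by
  induction d with
  | zero => simp
  | succ n ih =>
    rw [← (Fin.consEquiv fun _ : Fin (n + 1) => α).tsum_eq, ENNReal.tsum_prod', Fin.prod_univ_succ,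
      ← ih, ← ENNReal.tsum_mul_right]
    refine tsum_congr fun k => ?_
    rw [← ENNReal.tsum_mul_left]
    refine tsum_congr fun κ => ?_
    simp [Fin.consEquiv, Fin.prod_univ_succ]

theorem summable_two_rpow_neg_abs {ε : ℝ} (hε : 0 < ε) :
    Summable fun z : ℤ => (2 : ℝ) ^ (-(ε * |(z : ℝ)|)) := by
  have h : Summable fun n : ℕ => (2 : ℝ) ^ (-(ε * n)) := by
    have e : ∀ n : ℕ, (2 : ℝ) ^ (-(ε * n)) = ((2 : ℝ) ^ (-ε)) ^ n := fun n => by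
      rw [← Real.rpow_mul_natCast two_pos.le, neg_mul]
    simp_rw [e]
    exact summable_geometric_of_lt_one (by positivity)
      (Real.rpow_lt_one_of_one_lt_of_neg one_lt_two (by linarith))
  exact Summable.of_nat_of_neg (by simpa using h) (by simpa using h)

/-- The sum factors over the coordinates, and k ↦ k - j_i embeds ℕ into ℤ, which bounds each factor
by a two-sided geometric sum independent of j. -/
theorem exists_tsum_prod_two_rpow_le (d : ℕ) {ε : ℝ} (hε : 0 < ε) : ∃ S : ℝ, 0 < S ∧
    ∀ j : Fin d → ℕ, ∑' κ : Fin d → ℕ,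
      ENNReal.ofReal ((2 : ℝ) ^ (-(ε * ∑ i, |(κ i : ℝ) - j i|))) ≤ ENNReal.ofReal S := by
  have hs := summable_two_rpow_neg_abs hε
  refine ⟨(∑' z : ℤ, (2 : ℝ) ^ (-(ε * |(z : ℝ)|))) ^ d, ?_, fun j => ?_⟩
  · exact pow_pos (hs.tsum_pos (fun _ => by positivity) 0 (by positivity)) d
  · have e : ∀ κ : Fin d → ℕ, ENNReal.ofReal ((2 : ℝ) ^ (-(ε * ∑ i, |(κ i : ℝ) - j i|)))
        = ∏ i, ENNReal.ofReal ((2 : ℝ) ^ (-(ε * |(((κ i : ℤ) - (j i : ℤ) : ℤ) : ℝ)|))) := by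
      intro κ
      rw [← ENNReal.ofReal_prod_of_nonneg fun i _ => by positivity, Finset.mul_sum,
        ← Finset.sum_neg_distrib, Real.rpow_sum_of_pos two_pos]
      push_cast
      rfl
    simp_rw [e]
    rw [tsum_prod_eq_prod_tsum fun i (k : ℕ) =>
      ENNReal.ofReal ((2 : ℝ) ^ (-(ε * |(((k : ℤ) - (j i : ℤ) : ℤ) : ℝ)|))),
      ENNReal.ofReal_pow (tsum_nonneg fun _ => by positivity),
      ENNReal.ofReal_tsum_of_nonneg (fun _ => by positivity) hs]
    rw [← Fin.prod_const]
    refine Finset.prod_le_prod' fun i _ => ?_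
    have hinj : Function.Injective fun k : ℕ => (k : ℤ) - (j i : ℤ) := fun k k' h => by
      simpa using h
    refine le_trans (le_of_eq ?_) (ENNReal.tsum_comp_le_tsum_of_injective hinj
      fun z : ℤ => ENNReal.ofReal ((2 : ℝ) ^ (-(ε * |(z : ℝ)|))))
    push_cast
    rfl

/-! ### Growth of δ -/

/-- Testing the hypothesis on the finitely many unit vectors already gives a uniform margin;
subadditivity spreads it to all differences in `seminorm_le_add_mul_sum_abs`. -/
theorem exists_seminorm_single_le {d : ℕ} {L : ℕ} (δ : Seminorm ℝ (Fin d → ℝ))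
    (hδL : ∀ j : Fin d → ℕ, j ≠ 0 → δ (fun i => (j i : ℝ)) < L * ∑ i, (j i : ℝ)) :
    ∃ ε : ℝ, 0 < ε ∧ ∀ i, δ (Pi.single i 1) ≤ L - ε := by
  have h : ∀ i : Fin d, δ (Pi.single i 1) < L := by
    intro i
    have := hδL (Pi.single i 1) (by simp)
    have e : (fun k => ((Pi.single i 1 : Fin d → ℕ) k : ℝ)) = Pi.single i 1 := by
      funext k
      rw [Pi.single_apply, Pi.single_apply]
      split_ifs <;> simp
    rw [e] at this
    have e2 : ∑ k, (Pi.single i 1 : Fin d → ℝ) k = 1 := by simp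
    rwa [show Finset.univ.sum (Pi.single i 1 : Fin d → ℝ) = 1 from e2, mul_one] at this
  rcases isEmpty_or_nonempty (Fin d) with he | hne
  · exact ⟨1, one_pos, fun i => he.elim i⟩
  · obtain ⟨i₀, hi₀⟩ := Finite.exists_max fun i : Fin d => δ (Pi.single i 1)
    exact ⟨L - δ (Pi.single i₀ 1), sub_pos.2 (h i₀), fun i => by simpa using hi₀ i⟩

theorem seminorm_le_add_mul_sum_abs {d : ℕ} (δ : Seminorm ℝ (Fin d → ℝ)) {M : ℝ}
    (h : ∀ i, δ (Pi.single i 1) ≤ M) (x y : Fin d → ℝ) :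
    δ x ≤ δ y + M * ∑ i, |y i - x i| := by
  have h1 : δ x ≤ δ y + δ (x - y) := by
    have := map_add_le_add δ y (x - y)
    rwa [add_sub_cancel] at this
  have h2 : δ (x - y) ≤ ∑ i, |y i - x i| * M := by
    have e : x - y = ∑ i, (x i - y i) • (Pi.single i 1 : Fin d → ℝ) := by
      funext k
      simp [Finset.sum_apply, Pi.single_apply]
    rw [e]
    refine (Finset.le_sum_of_subadditive δ (map_zero δ).le (map_add_le_add δ) _ _).trans (Finset.sum_le_sum fun i _ => ?_)
    rw [map_smul_eq_mul, Real.norm_eq_abs, abs_sub_comm]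
    exact mul_le_mul_of_nonneg_left (h i) (abs_nonneg _)
  rw [← Finset.sum_mul, mul_comm] at h2
  linarith

/-! ### Comparison of the two families -/

theorem prod_diffJet_ae_eq_tensor {d : ℕ} {ψ₀ : Fin d → ℝ → ℂ} {P : Fin d → ℕ → ℝ → ℂ}
    (h : ∀ i, P i 0 =ᵐ[volume] ψ₀ i) (j : Fin d → ℕ) :
    (fun x : Fin d → ℝ => ∏ i, diffJet (P i) (j i) 0 (x i)) =ᵐ[volume] tensor ψ₀ j := by
  have H : ∀ i, ∀ᵐ x : Fin d → ℝ, dyadic (ψ₀ i) (j i) (x i) = diffJet (P i) (j i) 0 (x i) :=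
    fun i => (Measure.quasiMeasurePreserving_eval (fun _ : Fin d => (volume : Measure ℝ)) i).ae (dyadic_ae_eq (h i) (j i))
  filter_upwards [ae_all_iff.2 H] with x hx
  exact Finset.prod_congr rfl fun i _ => (hx i).symm

theorem IsGenerator.exists_jet {b : ℝ} (hb : 0 ≤ b) {L : ℕ} {ψ : ℝ → ℂ} (h : IsGenerator b L ψ) :
    ∃ P, Jet b (L + 1) P ∧ P 0 =ᵐ[volume] ψ ∧ FlatMoments L (P 0) ∧
      moment 0 (P 0) * moment 0 (P 0) = 1 := by
  obtain ⟨P, hP, hae⟩ := VBesov.exists_jet hb h.mem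
  exact ⟨P, hP, hae, fun s h1 hs => h.moment_eq_zero hb hP.dec_zero hae h1 hs.le,
    h.moment_zero_sq hb hP.dec_zero hae⟩

/-- Estimate of the convolutions with one family of dyadic tensor products by those with another. -/
theorem exists_eLpNorm_conv_tensor_le {d L : ℕ} (hL : L ≠ 0) {b c : ℝ} (hb : 0 < b) {p : ℝ≥0∞}
    (hp : 1 ≤ p) (hcb : ENNReal.ofReal c / p < ENNReal.ofReal b) {w : (Fin d → ℝ) → ℝ}
    (hw : IsExpWeight w c) {φ₀ ψ₀ : Fin d → ℝ → ℂ} (hφ : ∀ i, IsGenerator b L (φ₀ i))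
    (hψ : ∀ i, IsGenerator b L (ψ₀ i)) :
    ∃ C : ℝ, 0 ≤ C ∧ ∀ (f : StrongDual ℂ (TestSpace b (fun _ : Fin d => L + 1))) (j : Fin d → ℕ),
      eLpNorm (conv (tensor ψ₀ j) f) p (wMeasure w) ≤ ∑' κ : Fin d → ℕ,
        ENNReal.ofReal (C * (2 : ℝ) ^ (-((L : ℝ) * ∑ i, |(κ i : ℝ) - j i|))) *
          eLpNorm (conv (tensor φ₀ κ) f) p (wMeasure w) := by
  choose P hP hPae hPf hP1 using fun i => (hφ i).exists_jet hb.le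
  choose Q hQ hQae hQf hQ1 using fun i => (hψ i).exists_jet hb.le
  -- The λ's are built from `φ₀` and are paired with the dyadic functions of `ψ₀`.
  choose C hC0 hC using fun i => (dyadicFamily_dualJet hb.le (hP i) (hPf i) rfl
    (hP1 i)).exists_expNorm_cv_le hb.le hL (dyadicFamily_diffJet hb.le (hQ i) (hQf i))
  obtain ⟨D, hD, hY⟩ := hw.exists_eLpNorm_integral_le hb hp hcb
  refine ⟨D * ∏ i, C i, mul_nonneg hD.le (Finset.prod_nonneg fun i _ => hC0 i), fun f j => ?_⟩
  rw [conv_congr hb.le f (fun i => (hQ i).diffJet hb.le (j i)) (prod_diffJet_ae_eq_tensor hQae j)]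
  simp_rw [fun κ : Fin d → ℕ => conv_congr hb.le f (fun i => (hP i).diffJet hb.le (κ i))
    (prod_diffJet_ae_eq_tensor hPae κ)]
  set K : (Fin d → ℕ) → Fin d → ℝ → ℂ := fun κ i =>
    cv (dualJet (moment 0 (P i 0)) (P i) (κ i) 0) (diffJet (Q i) (j i) 0) with hKdef
  have hKd : ∀ (κ : Fin d → ℕ) i, Dec b (L + 1) (K κ i) := fun κ i =>
    ((hP i).dualJet hb.le _ (κ i)).dec_zero.cv hb.le ((hQ i).diffJet hb.le (j i)).dec_zero
  set G : (Fin d → ℕ) → (Fin d → ℝ) → ℂ := fun κ x => ∫ y : Fin d → ℝ, (∏ i, K κ i (y i)) *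
    conv (fun z => ∏ i, diffJet (P i) (κ i) 0 (z i)) f (x - y) with hG
  have hcont : ∀ κ : Fin d → ℕ, Continuous (conv (fun z => ∏ i, diffJet (P i) (κ i) 0 (z i)) f) := fun κ =>
    continuous_conv hb.le f fun i => (hP i).diffJet hb.le (κ i)
  have hGm : ∀ κ : Fin d → ℕ, AEStronglyMeasurable (G κ) (wMeasure w) := by
    intro κ
    have h1 : conv (fun x => ∏ i, cv (K κ i) (diffJet (P i) (κ i) 0) (x i)) f = G κ :=
      funext fun x => (integrable_prod_mul_conv hb.le f (fun i => (hP i).diffJet hb.le (κ i))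
        (hKd κ) x).2
    rw [← h1]
    exact (continuous_conv hb.le f fun i =>
      ((hP i).diffJet hb.le (κ i)).jcv hb.le (hKd κ i)).aestronglyMeasurable
  have hGle : ∀ κ : Fin d → ℕ, eLpNorm (G κ) p (wMeasure w) ≤
      ENNReal.ofReal (D * (∏ i, C i) * (2 : ℝ) ^ (-((L : ℝ) * ∑ i, |(κ i : ℝ) - j i|))) *
        eLpNorm (conv (fun z => ∏ i, diffJet (P i) (κ i) 0 (z i)) f) p (wMeasure w) := by
    intro κ
    refine (hY (K κ) _ (fun i => (hKd κ i).1) (hcont κ).measurable).trans ?_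
    refine mul_le_mul_left ?_ _
    rw [mul_assoc, ENNReal.ofReal_mul hD.le]
    refine mul_le_mul_right ?_ _
    rw [Finset.mul_sum, ← Finset.sum_neg_distrib, Real.rpow_sum_of_pos two_pos,
      ← Finset.prod_mul_distrib, ENNReal.ofReal_prod_of_nonneg fun i _ =>
        mul_nonneg (hC0 i) (by positivity)]
    refine Finset.prod_le_prod' fun i _ => ?_
    rw [abs_sub_comm]
    exact hC i (κ i) (j i)
  have hlim := fun x => tendsto_sum_integral_conv hb f hP
    (fun i => (hQ i).diffJet hb.le (j i)) (fun _ => rfl) hP1 x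
  -- The reproducing formula converges only pointwise, so the L^p norm of the limit is bounded by
  -- Fatou's lemma; the norms of the box sums are bounded by the full series.
  refine (Lp.eLpNorm_lim_le_liminf_eLpNorm (f := fun N : ℕ => ∑ κ ∈ Fintype.piFinset
    fun _ : Fin d => Finset.range (N + 1), G κ) (fun N => ?_) _
    (Filter.Eventually.of_forall fun x => ?_)).trans ?_
  · exact Finset.aestronglyMeasurable_sum _ fun κ _ => hGm κ
  · simpa only [Finset.sum_apply] using hlim x
  · refine (Filter.liminf_le_liminf (v := fun _ => _) (Filter.Eventually.of_forall fun N => ?_)).trans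
      (Filter.liminf_const _).le
    refine (eLpNorm_sum_le (fun κ _ => hGm κ) hp).trans ?_
    exact (Finset.sum_le_sum fun κ _ => hGle κ).trans (ENNReal.sum_le_tsum _)

theorem quasinorm_eq_seqNorm {d : ℕ} (δ : Seminorm ℝ (Fin d → ℝ)) (w : (Fin d → ℝ) → ℝ)
    (p q : ℝ≥0∞) {b : ℝ} {s : Fin d → ℕ} (ψ₀ : Fin d → ℝ → ℂ)
    (f : StrongDual ℂ (TestSpace b s)) :
    quasinorm δ w p q ψ₀ f = seqNorm q (term δ w p ψ₀ f) := rfl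

/-- One direction of the equivalence of the quasinorms. -/
theorem exists_quasinorm_le {d L : ℕ} {b c : ℝ} (hb : 0 < b) {p q : ℝ≥0∞}
    (hp : 1 ≤ p) (hq : 1 ≤ q) (hcb : ENNReal.ofReal c / p < ENNReal.ofReal b)
    {w : (Fin d → ℝ) → ℝ} (hw : IsExpWeight w c) (δ : Seminorm ℝ (Fin d → ℝ))
    (hδL : ∀ j : Fin d → ℕ, j ≠ 0 → δ (fun i => (j i : ℝ)) < L * ∑ i, (j i : ℝ))
    {φ₀ ψ₀ : Fin d → ℝ → ℂ} (hφ : ∀ i, IsGenerator b L (φ₀ i))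
    (hψ : ∀ i, IsGenerator b L (ψ₀ i)) :
    ∃ C : ℝ, 0 < C ∧ ∀ f : StrongDual ℂ (TestSpace b (fun _ : Fin d => L + 1)),
      quasinorm δ w p q ψ₀ f ≤ ENNReal.ofReal C * quasinorm δ w p q φ₀ f := by
  obtain ⟨ε, hε, hδε⟩ := exists_seminorm_single_le δ hδL
  -- For d = 0 the two families coincide. For d ≥ 1, 0 ≤ δ(e_i) ≤ L - ε forces L > 0, which almost
  -- orthogonality needs.
  rcases isEmpty_or_nonempty (Fin d) with he | ⟨⟨i₀⟩⟩
  · refine ⟨1, one_pos, fun f => ?_⟩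
    rw [Subsingleton.elim φ₀ ψ₀, ENNReal.ofReal_one, one_mul]
  have hL : L ≠ 0 := by
    rintro rfl
    have h1 := hδε i₀
    have h2 := apply_nonneg δ (Pi.single i₀ 1)
    push_cast at h1
    linarith
  obtain ⟨C, hC, H⟩ := exists_eLpNorm_conv_tensor_le hL hb hp hcb hw hφ hψ
  obtain ⟨S, hS, hsum⟩ := exists_tsum_prod_two_rpow_le d hε
  refine ⟨(C + 1) * S, by positivity, fun f => ?_⟩
  set K : (Fin d → ℕ) → (Fin d → ℕ) → ℝ≥0∞ := fun j κ =>
    ENNReal.ofReal (C + 1) * ENNReal.ofReal ((2 : ℝ) ^ (-(ε * ∑ i, |(κ i : ℝ) - j i|))) with hK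
  have h1 : ∀ j, ∑' κ, K j κ ≤ ENNReal.ofReal ((C + 1) * S) := by
    intro j
    rw [ENNReal.tsum_mul_left, ENNReal.ofReal_mul (by positivity)]
    exact mul_le_mul_right (hsum j) _
  have h2 : ∀ κ, ∑' j, K j κ ≤ ENNReal.ofReal ((C + 1) * S) := by
    intro κ
    have e : ∀ j, K j κ = K κ j := fun j => by
      simp only [hK, abs_sub_comm]
    simp_rw [e]
    exact h1 κ
  rw [quasinorm_eq_seqNorm, quasinorm_eq_seqNorm]
  refine (seqNorm_mono q fun j => ?_).trans (seqNorm_tsum_mul_le hq h1 h2 _)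
  unfold term
  refine (mul_le_mul_right (H f j) _).trans ?_
  rw [← ENNReal.tsum_mul_left]
  refine ENNReal.tsum_le_tsum fun κ => ?_
  rw [← mul_assoc, ← mul_assoc]
  refine mul_le_mul_left ?_ _
  simp only [hK]
  rw [← ENNReal.ofReal_mul (by positivity), ← ENNReal.ofReal_mul (by positivity),
    ← ENNReal.ofReal_mul (by positivity)]
  refine ENNReal.ofReal_le_ofReal ?_
  -- This gives 2^{δ(j)} 2^{-L|κ-j|₁} ≤ 2^{δ(κ)} 2^{-ε|κ-j|₁}: what remains of the decay is
  -- summable.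
  have h3 := seminorm_le_add_mul_sum_abs δ hδε (fun i => (j i : ℝ)) (fun i => (κ i : ℝ))
  rw [mul_left_comm, mul_assoc (C + 1), ← Real.rpow_add two_pos, ← Real.rpow_add two_pos]
  refine mul_le_mul (by linarith) (Real.rpow_le_rpow_of_exponent_le one_le_two ?_)
    (by positivity) (by positivity)
  nlinarith [h3]

end VBesov

theorem theorem5 (d L : ℕ) (b c : ℝ) (hb : 0 < b) (hc : 0 < c)
    (p q : ℝ≥0∞) (hp : 1 ≤ p) (hq : 1 ≤ q)
    (hcb : ENNReal.ofReal c / p < ENNReal.ofReal b)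
    (w : (Fin d → ℝ) → ℝ) (hw : VBesov.IsExpWeight w c)
    (δ : Seminorm ℝ (Fin d → ℝ)) (hδ : ∀ x, δ x = 0 → x = 0)
    (hδL : ∀ j : Fin d → ℕ, j ≠ 0 → δ (fun i => (j i : ℝ)) < L * ∑ i, (j i : ℝ))
    (φ₀ ψ₀ : Fin d → ℝ → ℂ)
    (hφ : ∀ i, VBesov.IsGenerator b L (φ₀ i)) (hψ : ∀ i, VBesov.IsGenerator b L (ψ₀ i)) :
    (∃ c₁ c₂ : ℝ, 0 < c₁ ∧ 0 < c₂ ∧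
      ∀ f : StrongDual ℂ (VBesov.TestSpace b (fun _ : Fin d => L + 1)),
        ENNReal.ofReal c₁ * VBesov.quasinorm δ w p q φ₀ f ≤ VBesov.quasinorm δ w p q ψ₀ f ∧
        VBesov.quasinorm δ w p q ψ₀ f ≤ ENNReal.ofReal c₂ * VBesov.quasinorm δ w p q φ₀ f) ∧
    VBesov.VB δ w p q b (fun _ : Fin d => L + 1) φ₀ =
      VBesov.VB δ w p q b (fun _ : Fin d => L + 1) ψ₀ := by
  obtain ⟨C, hC, h1⟩ := VBesov.exists_quasinorm_le hb hp hq hcb hw δ hδL hψ hφ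
  obtain ⟨C', hC', h2⟩ := VBesov.exists_quasinorm_le hb hp hq hcb hw δ hδL hφ hψ
  refine ⟨⟨C⁻¹, C', inv_pos.2 hC, hC', fun f => ⟨?_, h2 f⟩⟩, Set.ext fun f => ⟨fun h => ?_, fun h => ?_⟩⟩
  · refine (mul_le_mul_right (h1 f) _).trans (le_of_eq ?_)
    rw [← mul_assoc, ← ENNReal.ofReal_mul (inv_pos.2 hC).le, inv_mul_cancel₀ hC.ne',
      ENNReal.ofReal_one, one_mul]
  · exact (h2 f).trans_lt (ENNReal.mul_lt_top ENNReal.ofReal_lt_top h)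
  · exact (h1 f).trans_lt (ENNReal.mul_lt_top ENNReal.ofReal_lt_top h)
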